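/- **Setting.** A multiset $\mathcal M$ of size $n$ over a linearly ordered universe is given as an array $A$. Its $\rho$ *runs* are the maximal nondecreasing subarrays of $A$. Queries arrive online, one at a time: $\mathtt{select}(j)$, $1\le j\le n$, asks for (a position of) the $j$-th smallest element counted with multiplicity, and $\mathtt{rank}(x)$ asks for the number of elements smaller than $x$. In the comparison model the data are accessed only through comparisons between two elements, or between an element and the argument $x$ of the current query; the cost is the number of these data comparisons, including preprocessing. **The Full-Synergistic Deferred Data Structure** stores the runs, the blocks identified so far in sorted order (with the positions where they partition each run), and a finger to the block that answered the last query. The elements that lie between two neighbouring identified blocks (or before the first or after the last one) form an unsorted sub-instance; at the beginning all of $\mathcal M$ is one unsorted sub-instance. A *partitioning step* on an unsorted sub-instance $S$ takes as pivot $\mu$ the median of the middle elements of the nonempty parts of the runs in $S$; with $\max_\ell$ and $\min_r$ the greatest element smaller than $\mu$ and the smallest element greater than $\mu$ in $S$ outside the run of $\mu$ (possibly $\mp\infty$), the elements strictly between $\max_\ell$ and $\min_r$ become identified, and the elements $\le\max_\ell$ and the elements $\ge\min_r$ form two smaller unsorted sub-instances. If $\mu$ occurs in only one run, the newly identified elements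 form one block; otherwise the elements equal to $\mu$ form one *pivot block* in each run where $\mu$ occurs, and the remaining newly identified elements smaller than $\mu$, and those greater than $\mu$, form one block each (if any). All pivot blocks of one value together count as one entry among the identified blocks. A query $\mathtt{select}(j)$ repeats partitioning steps on the unsorted sub-instance that contains the $j$-th smallest element, until that element is in an identified block. A query $\mathtt{rank}(x)$ repeats them on the unsorted sub-instance into which $x$ falls, until $x$ lies between the smallest and greatest element of an identified block, or no unsorted elements are left between the identified blocks neighbouring $x$. The block that answers the query is the one containing the selected element, respectively the greatest element $\le x$ (the minimum of $\mathcal M$ if there is none). **Parameters.** Consider $q$ online queries. After the last one: - the *selection blocks* are the $\beta$ nonempty intersections of the runs with the identified blocks and with the unsorted sub-instances, and $s_1,\dots,s_\beta$ are their sizes; - $m_1,\dots,m_\lambda$ are the numbers of pivot blocks (one per run in which the value occurs) for the identified pivot values of multiplicity greater than $1$; - $\rho_0,\rho_1,\dots$ are the numbers of runs that have elements in the successive unsorted sub-instances. For $2\le j\le q$, let $d_{j-1}$ be the number of entries (identified blocks), at the time when the $j$-th query is asked, strictly between the block that answered the $(j-1)$-th query and the place of the block that answers the $j$-th query. Let $u$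 be the number of $\mathtt{rank}$ queries, and for each of them let $g_i$ be the size of the identified block that has to be searched for the query value, i.e. that has both elements smaller than the value and elements at least the value ($g_i=1$ if there is none). Let $r_1\le\dots\le r_q$ be the sorted ranks hit by the queries ($j$ for $\mathtt{select}(j)$, and the answer for $\mathtt{rank}(x)$), $r_0=0$, $r_{q+1}=n$, $\Delta_i=r_{i+1}-r_i$. Write $\log=\log_2$, $0\log 0=0$, and $\lg y=\max\{1,\log y\}$ (with $\lg 0=1$). **Theorem (Full-Synergistic Deferred Data Structure).** There are an absolute constant $C$ and, for each $n$, an implementation of this data structure in the comparison model (which remembers nothing but the state described above from one query to the next) such that for every multiset $\mathcal M$ of size $n$, given as an array, and every sequence of $q\ge 0$ online $\mathtt{rank}$ and $\mathtt{select}$ queries, all queries are answered correctly and the total number of data comparisons is at most $C\cdot B$, where $$B=n+\sum_{i=1}^{\beta}\log s_i+\beta\log\rho-\sum_{i=1}^{\lambda}m_i\log m_i-\sum_{i}\rho_i\log\rho_i+\sum_{i=1}^{q-1}\lg d_i+\sum_{i=1}^{u}\lg g_i .$$ Moreover $$B\le C\Bigl(n+n\log n-\sum_{i=0}^{q}\Delta_i\log\Delta_i+q\lg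 n\Bigr).$$ -/

import Mathlib

/-! ### The comparison model

A computation sees its data only through three-way comparisons of keys.  `CompTree K R` is a
decision tree over keys `K` with results in `R`; its cost is the number of comparisons made. -/

inductive CompTree (K : Type) (R : Type) : Type
  | done (r : R) : CompTree K R
  | comp (a b : K) (next : Ordering → CompTree K R) : CompTree K R

namespace CompTree

def result {K R : Type} {α : Type*} [LinearOrder α] (val : K → α) : CompTree K R → R
  | done r => r
  | comp a b next => result val (next (cmp (val a) (val b)))

def cost {K R : Type} {α : Type*} [LinearOrder α] (val : K → α) : CompTree K R → ℕ
  | done _ => 0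
  | comp a b next => cost val (next (cmp (val a) (val b))) + 1

end CompTree

/-! ### Queries on a multiset given as an array `A : Fin n → α` -/

/-- `select i` asks for the `(i+1)`-st smallest element (counted with multiplicity), where
`i : Fin n`; `rank x` asks for the number of elements smaller than `x`. -/
inductive Query (n : ℕ) (α : Type*)
  | select (i : Fin n) : Query n α
  | rank (x : α) : Query n α

/-- A `select` query is answered by a pointer to an element, a `rank` query by a number. -/
inductive Answer (n : ℕ) : Type
  | elt (p : Fin n) : Answer n
  | num (r : ℕ) : Answer n

section Multiset

variable {n : ℕ} {α : Type*} [LinearOrder α]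

def numLT (A : Fin n → α) (x : α) : ℕ := (Finset.univ.filter fun p => A p < x).card

def numLE (A : Fin n → α) (x : α) : ℕ := (Finset.univ.filter fun p => A p ≤ x).card

/-- `v` is the value of the `(i+1)`-st smallest element. -/
def IsSelected (A : Fin n → α) (i : Fin n) (v : α) : Prop :=
  numLT A v ≤ i.val ∧ i.val < numLE A v

instance (A : Fin n → α) (i : Fin n) (v : α) : Decidable (IsSelected A i v) :=
  inferInstanceAs (Decidable (_ ∧ _))

def CorrectAnswer (A : Fin n → α) : Query n α → Answer n → Prop
  | .select i, .elt p => IsSelected A i (A p)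
  | .rank x, .num r => r = numLT A x
  | _, _ => False

/-- `p` holds a greatest element among those `≤ x`. -/
def IsPred (A : Fin n → α) (x : α) (p : Fin n) : Prop :=
  A p ≤ x ∧ ∀ p' : Fin n, A p' ≤ x → A p' ≤ A p

/-- `p` holds a smallest element among those `> x`. -/
def IsSucc (A : Fin n → α) (x : α) (p : Fin n) : Prop :=
  x < A p ∧ ∀ p' : Fin n, x < A p' → A p ≤ A p'

instance (A : Fin n → α) (x : α) (p : Fin n) : Decidable (IsPred A x p) :=
  inferInstanceAs (Decidable (_ ∧ _))

instance (A : Fin n → α) (x : α) (p : Fin n) : Decidable (IsSucc A x p) :=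
  inferInstanceAs (Decidable (_ ∧ _))

/-- The run (maximal nondecreasing subarray) of position `p`: runs are numbered from the left, and
the number of a run is the number of descents of `A` at or before `p`. -/
def runIndex (A : Fin n → α) (p : Fin n) : ℕ :=
  (Finset.univ.filter fun p' : Fin n =>
    p' ≤ p ∧ ∃ p'' : Fin n, p''.val + 1 = p'.val ∧ A p' < A p'').card

end Multiset

/-! ### The state of the Full-Synergistic Deferred Data Structure

The positions of the array are distributed over a list of cells, in increasing order of values.  A
cell is either an identified block (`known = true`), or the still unsorted sub-instance between two
neighbouring identified blocks (`known = false`).  The intersections of the cells with the runs are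
intervals of the runs: they are the selection blocks, and they tell for each identified block where
it partitions each run.  A value that occurs in several runs forms a single known cell, which
consists of one pivot block in each of these runs. -/

structure Cell (n : ℕ) : Type where
  known : Bool
  elts : Finset (Fin n)

/-- `runOf` is the decomposition into runs, and `finger` is the identified block that answered the
last query (empty before the first query). -/
structure FSState (n : ℕ) : Type where
  runOf : Fin n → ℕ
  cells : List (Cell n)
  finger : Finset (Fin n)

section FullSynergistic

variable {n : ℕ} {α : Type*} [LinearOrder α]

/-- The part of the sub-instance `S` in the run number `r`. -/
def runPart (runOf : Fin n → ℕ) (S : Finset (Fin n)) (r : ℕ) : Finset (Fin n) :=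
  S.filter fun p => runOf p = r

/-- The middle elements of the nonempty parts of the runs in `S`. -/
def middles (runOf : Fin n → ℕ) (S : Finset (Fin n)) : Finset (Fin n) :=
  S.filter fun p =>
    ((runPart runOf S (runOf p)).filter fun p' => p' < p).card
      = (runPart runOf S (runOf p)).card / 2

/-- The median of the middles: the element of index `⌊k/2⌋` (counted from `0`) among the `k`
middles, ordered by value, ties being broken by position. -/
def medianOfMiddles (A : Fin n → α) (runOf : Fin n → ℕ) (S : Finset (Fin n)) : Option (Fin n) :=
  (List.finRange n).find? fun p => decide
    (p ∈ middles runOf S ∧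
      ((middles runOf S).filter fun p' => A p' < A p ∨ (A p' = A p ∧ p' < p)).card
        = (middles runOf S).card / 2)

/-- The elements of `S` that are at most `maxₗ`, the greatest element smaller than the pivot `μ`
in the runs other than the run of `μ` (none if there is no such element). -/
def lowerPart (A : Fin n → α) (runOf : Fin n → ℕ) (S : Finset (Fin n)) (μ : Fin n) :
    Finset (Fin n) :=
  S.filter fun p => ∃ p' ∈ S, runOf p' ≠ runOf μ ∧ A p' < A μ ∧ A p ≤ A p'

/-- The elements of `S` that are at least `minᵣ`, the smallest element greater than the pivot `μ`
in the runs other than the run of `μ` (none if there is no such element). -/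
def upperPart (A : Fin n → α) (runOf : Fin n → ℕ) (S : Finset (Fin n)) (μ : Fin n) :
    Finset (Fin n) :=
  S.filter fun p => ∃ p' ∈ S, runOf p' ≠ runOf μ ∧ A μ < A p' ∧ A p' ≤ A p

/-- One partitioning step on the unsorted sub-instance `S`.  The elements strictly between `maxₗ`
and `minᵣ` become identified.  If the value of the pivot occurs in its own run only, they form one
block.  Otherwise the elements of that value (one pivot block in each run where it occurs) separate
the other ones, which belong to the run of the pivot, into at most two blocks. -/
def splitCell (A : Fin n → α) (runOf : Fin n → ℕ) (S : Finset (Fin n)) : List (Cell n) :=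
  match medianOfMiddles A runOf S with
  | none => [⟨false, S⟩]
  | some μ =>
    let L := lowerPart A runOf S μ
    let R := upperPart A runOf S μ
    let B := S \ (L ∪ R)
    let blocks : List (Cell n) :=
      if ∃ p ∈ S, A p = A μ ∧ runOf p ≠ runOf μ then
        [⟨true, B.filter fun p => A p < A μ⟩, ⟨true, B.filter fun p => A p = A μ⟩,
          ⟨true, B.filter fun p => A μ < A p⟩]
      else [⟨true, B⟩]
    let parts : List (Cell n) := ⟨false, L⟩ :: (blocks ++ [⟨false, R⟩])
    parts.filter fun c => decide c.elts.Nonempty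

/-- The value `x` lies between the smallest and the greatest element of an identified block. -/
def Covered (A : Fin n → α) (cells : List (Cell n)) (x : α) : Prop :=
  ∃ c ∈ cells, c.known = true ∧ (∃ p ∈ c.elts, A p ≤ x) ∧ ∃ p ∈ c.elts, x ≤ A p

instance (A : Fin n → α) (cells : List (Cell n)) (x : α) : Decidable (Covered A cells x) :=
  inferInstanceAs (Decidable (∃ c ∈ cells, _))

/-- The unsorted cell `c` has to be partitioned further in order to answer the query: for
`select i`, when it contains the selected element; for `rank x`, when `x` is not covered by an
identified block and `x` falls into `c`, in the sense that the greatest element `≤ x` or the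
smallest element `> x` is in `c`. -/
def MustSplit (A : Fin n → α) (cells : List (Cell n)) : Query n α → Cell n → Prop
  | .select i, c => c.known = false ∧ ∃ p ∈ c.elts, IsSelected A i (A p)
  | .rank x, c =>
    c.known = false ∧ ¬ Covered A cells x ∧ ∃ p ∈ c.elts, IsPred A x p ∨ IsSucc A x p

instance (A : Fin n → α) (cells : List (Cell n)) (q : Query n α) (c : Cell n) :
    Decidable (MustSplit A cells q c) :=
  match q with
  | .select _ => inferInstanceAs (Decidable (_ ∧ _))
  | .rank _ => inferInstanceAs (Decidable (_ ∧ _))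

def refineOnce (A : Fin n → α) (runOf : Fin n → ℕ) (q : Query n α) (cells : List (Cell n)) :
    List (Cell n) :=
  cells.flatMap fun c => if MustSplit A cells q c then splitCell A runOf c.elts else [c]

/-- The elements whose block answers the query: the selected element for `select i`; the greatest
element `≤ x` for `rank x`, or the minimum of the multiset if all elements are `> x`. -/
def answerElts (A : Fin n → α) : Query n α → Finset (Fin n)
  | .select i => Finset.univ.filter fun p => IsSelected A i (A p)
  | .rank x => Finset.univ.filter fun p => IsPred A x p ∨ (IsSucc A x p ∧ ∀ p', x < A p')

/-- The known cell that meets `T` (empty if there is none). -/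
def blockMeeting (cells : List (Cell n)) (T : Finset (Fin n)) : Finset (Fin n) :=
  match cells.find? fun c => c.known && decide (∃ p ∈ T, p ∈ c.elts) with
  | none => ∅
  | some c => c.elts

/-- The state before the first query: only the runs are known. -/
def fsInitial (A : Fin n → α) : FSState n where
  runOf := runIndex A
  cells := if n = 0 then [] else [⟨false, Finset.univ⟩]
  finger := ∅

/-- The new state after a query: partition the cell of the query until the query is answered (every
partitioning step identifies at least one more element, so that `n` rounds suffice), and move the
finger to the block that answers the query. -/
def fsServe (A : Fin n → α) (s : FSState n) (q : Query n α) : FSState n :=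
  let cells := (refineOnce A s.runOf q)^[n] s.cells
  { runOf := s.runOf
    cells := cells
    finger := blockMeeting cells (answerElts A q) }

/-- The state after the queries `qs`, asked in this order. -/
def fsState (A : Fin n → α) (qs : List (Query n α)) : FSState n :=
  qs.foldl (fsServe A) (fsInitial A)

/-- All elements of `S` are smaller than all elements of `T`. -/
def Below (A : Fin n → α) (S T : Finset (Fin n)) : Prop := ∀ p ∈ S, ∀ p' ∈ T, A p < A p'

instance (A : Fin n → α) (S T : Finset (Fin n)) : Decidable (Below A S T) :=
  inferInstanceAs (Decidable (∀ p ∈ S, _))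

/-- The finger distance of the query `q` in the state `s` in which it is asked: the number of
identified blocks of `s` strictly between the block that answered the previous query and the place
of the block that answers `q`. -/
def fingerDistance (A : Fin n → α) (s : FSState n) (q : Query n α) : ℕ :=
  s.cells.countP fun c => c.known &&
    decide ((Below A s.finger c.elts ∧ Below A c.elts (answerElts A q)) ∨
      (Below A (answerElts A q) c.elts ∧ Below A c.elts s.finger))

/-- The finger distances of the successive queries, starting from the state `s`. -/
def fingerDistances (A : Fin n → α) : FSState n → List (Query n α) → List ℕ
  | _, [] => []
  | s, q :: qs => fingerDistance A s q :: fingerDistances A (fsServe A s q) qs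

/-- The size of the identified block that is searched for `x` in the state `s`: the block that has
both elements `< x` and elements `≥ x` (and `1` if no block has to be searched). -/
def searchedSize (A : Fin n → α) (s : FSState n) (x : α) : ℕ :=
  match s.cells.find? fun c => c.known &&
      decide ((∃ p ∈ c.elts, A p < x) ∧ ∃ p ∈ c.elts, x ≤ A p) with
  | none => 1
  | some c => c.elts.card

/-- The sizes of the searched blocks for the successive `rank` queries, from the state `s` on. -/
def searchedSizes (A : Fin n → α) : FSState n → List (Query n α) → List ℕ
  | _, [] => []
  | s, .select i :: qs => searchedSizes A (fsServe A s (.select i)) qs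
  | s, .rank x :: qs =>
    searchedSize A (fsServe A s (.rank x)) x :: searchedSizes A (fsServe A s (.rank x)) qs

/-! ### The two bounds -/

/-- The numbers of the runs that have elements in `S`. -/
def runsMeeting (runOf : Fin n → ℕ) (S : Finset (Fin n)) : Finset ℕ := S.image runOf

/-- The logarithm of the terms that are charged per query, at least `1`. -/
noncomputable def lg (x : ℕ) : ℝ := max 1 (Real.logb 2 x)

/-- `x log₂ x`, which is `0` for `x = 0`. -/
noncomputable def xlogx (x : ℕ) : ℝ := x * Real.logb 2 x

/-- The number `ρ` of runs. -/
def numRuns (A : Fin n → α) : ℕ := (runsMeeting (runIndex A) Finset.univ).card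

/-- The number `β` of (nonempty) selection blocks. -/
def numSelectionBlocks (s : FSState n) : ℕ :=
  (s.cells.map fun c => (runsMeeting s.runOf c.elts).card).sum

/-- `∑ log sᵢ` over the selection blocks. -/
noncomputable def sumLogSelectionBlocks (s : FSState n) : ℝ :=
  (s.cells.map fun c =>
    ∑ r ∈ runsMeeting s.runOf c.elts, Real.logb 2 (runPart s.runOf c.elts r).card).sum

/-- `∑ mᵢ log mᵢ`, where `mᵢ` is the number of pivot blocks of the same value; blocks whose elements
occur in one run only contribute `1 log 1 = 0`. -/
noncomputable def sumPivotBlocks (s : FSState n) : ℝ :=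
  ((s.cells.filter fun c => c.known).map fun c => xlogx (runsMeeting s.runOf c.elts).card).sum

/-- `∑ ρᵢ log ρᵢ`, where `ρᵢ` is the number of runs that have elements strictly between two
neighbouring identified blocks. -/
noncomputable def sumUnsortedRuns (s : FSState n) : ℝ :=
  ((s.cells.filter fun c => !c.known).map fun c => xlogx (runsMeeting s.runOf c.elts).card).sum

/-- `n + ∑ log sᵢ + β log ρ - ∑ mᵢ log mᵢ - ∑ ρᵢ log ρᵢ + ∑ log dᵢ + ∑ log gᵢ`. -/
noncomputable def synergisticBound (A : Fin n → α) (qs : List (Query n α)) : ℝ :=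
  n + sumLogSelectionBlocks (fsState A qs)
    + numSelectionBlocks (fsState A qs) * Real.logb 2 (numRuns A)
    - sumPivotBlocks (fsState A qs) - sumUnsortedRuns (fsState A qs)
    + ((fingerDistances A (fsInitial A) qs).tail.map lg).sum
    + ((searchedSizes A (fsInitial A) qs).map lg).sum

/-- The rank hit by a query. -/
def queryRank (A : Fin n → α) : Query n α → ℕ
  | .select i => i.val + 1
  | .rank x => numLT A x

/-- The sorted ranks `r₁ ≤ … ≤ r_q` hit by the queries. -/
def sortedRanks (A : Fin n → α) (qs : List (Query n α)) : List ℕ :=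
  (qs.map (queryRank A)).insertionSort (· ≤ ·)

/-- The gaps `Δ₀, …, Δ_q` between `0, r₁, …, r_q, n`. -/
def queryGaps (A : Fin n → α) (qs : List (Query n α)) : List ℕ :=
  List.zipWith (fun a b => b - a) (0 :: sortedRanks A qs) (sortedRanks A qs ++ [n])

/-- `n + n log n - ∑ Δᵢ log Δᵢ + q log n`. -/
noncomputable def gapBound (A : Fin n → α) (qs : List (Query n α)) : ℝ :=
  n + xlogx n - ((queryGaps A qs).map xlogx).sum + qs.length * lg n

end FullSynergistic

/-! ### Online implementations in the comparison model

All that is remembered from one query to the next one is the state.  The keys of a `rank` query are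
the elements of the array (`some p`) and the argument of the query (`none`). -/

structure DeferredDS (n : ℕ) : Type where
  preprocess : CompTree (Fin n) (FSState n)
  select : FSState n → Fin n → CompTree (Fin n) (Answer n × FSState n)
  rank : FSState n → CompTree (Option (Fin n)) (Answer n × FSState n)

namespace DeferredDS

variable {n : ℕ} {α : Type*} [LinearOrder α]

/-- The answer and the new state. -/
def serve (D : DeferredDS n) (A : Fin n → α) (s : FSState n) : Query n α → Answer n × FSState n
  | .select i => (D.select s i).result A
  | .rank x => (D.rank s).result fun k => k.elim x A

def serveCost (D : DeferredDS n) (A : Fin n → α) (s : FSState n) : Query n α → ℕ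
  | .select i => (D.select s i).cost A
  | .rank x => (D.rank s).cost fun k => k.elim x A

def answersFrom (D : DeferredDS n) (A : Fin n → α) : FSState n → List (Query n α) → List (Answer n)
  | _, [] => []
  | s, q :: qs => (D.serve A s q).1 :: D.answersFrom A (D.serve A s q).2 qs

def costFrom (D : DeferredDS n) (A : Fin n → α) : FSState n → List (Query n α) → ℕ
  | _, [] => 0
  | s, q :: qs => D.serveCost A s q + D.costFrom A (D.serve A s q).2 qs

/-- The answers to the queries `qs`, asked one at a time in this order. -/
def answers (D : DeferredDS n) (A : Fin n → α) (qs : List (Query n α)) : List (Answer n) :=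
  D.answersFrom A (D.preprocess.result A) qs

/-- The state after the queries `qs`. -/
def finalState (D : DeferredDS n) (A : Fin n → α) (qs : List (Query n α)) : FSState n :=
  qs.foldl (fun s q => (D.serve A s q).2) (D.preprocess.result A)

/-- The number of data comparisons of the preprocessing and the queries `qs` together. -/
def comparisons (D : DeferredDS n) (A : Fin n → α) (qs : List (Query n α)) : ℕ :=
  D.preprocess.cost A + D.costFrom A (D.preprocess.result A) qs

end DeferredDS

-- The first bound is an amortized analysis. The part of a cell in a run is sorted by position, so
-- it can be cut at a pivot by a search from the nearer end, at a cost logarithmic in the smaller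
-- piece. If a nonempty part of `s` elements has weight `2 log s + 2` (`blockWeight`), such a cut
-- costs a constant plus the growth of the total weight (`search_le_blockWeight`, `exists_cut`).
-- Hence a partitioning step on a sub-instance that meets `k` runs costs `O(k)` plus the growth of
-- the weight (`exists_splitProgram`): the median of the `k` middles is selected in linear time
-- (`exists_select`), and a bounded number of cuts per run follows.
--
-- The `O(k)` is paid by a second potential. A cell that meets `k` of the `ρ` runs has the excess `k
-- log ρ - k log k` (`runEntropy`). As the pivot is the median of the middles, each remaining
-- sub-instance meets, together with the new blocks, at least half of the `k` runs. So a step either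
-- increases the number of selection blocks by a constant fraction of `k`, or identifies that many
-- new ones, or leaves remainders that are constant fractions of the `k` runs, and then the excess
-- grows (`IsPartitioning.charge`). Every cell is identified or unsorted, so the final potential is,
-- up to constants, the part of the bound that depends on the state (`stateBound_eq`,
-- `potential_le_stateBound`).
--
-- A `select` query finds its cell from the sizes alone. A `rank` query searches the identified
-- blocks from the finger; after a partitioning step its place has moved by at most three blocks, so
-- it is found again in constant time (`exists_rankLoop`). The search distance is at most the finger
-- distance plus 2 (`dist_fingerIndex_le`), and one search inside a block may be left at the end.
-- The structural facts behind this are in `CellsInv`: cells are ordered, identified blocks are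
-- sorted by position, and between two unsorted cells there is an identified one.
--
-- Programs are produced by statements in which the decision tree is chosen before the type and the
-- array. So a tree can depend on the stored state, but learns about the data by comparisons only.
--
-- For the second bound the essential point is that the sum of `k log n - k log k` over the final
-- cells is at most `n log n - ∑ Δ log Δ + O(n + q log n)`. The `O(q)` ranks next to query ranks are
-- charged `log n` each (`runEntropy_le_sum`). Inside a gap of `Δ` ranks it has to be shown that `∑
-- k log (Δ / k) = O(Δ)`, where `k` counts the runs that a cell meets within the gap. Since `log y =
-- O(y ^ (1/4))`, it suffices that the sum of `k ^ (3/4) * Δ ^ (1/4)` (`fourthRootMean`) is `O(Δ)`.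
-- No query falls into the gap, so cells inside it are never split. For a cell that crosses one
-- border, let `V` be the sum over the runs of the square roots of the sizes of its parts inside the
-- gap (`sqrtWeight`). When pieces of it are cut off inside the gap, half of the runs of the cell
-- lose half of their elements, so `V ≤ √(k Δ)` drops by a constant times `k`, now with `k` the
-- number of runs of the cell. Then `√Δ √V` drops by a constant times `k ^ (3/4) * Δ ^ (1/4)`, which
-- pays for the pieces (`gapPotential_add_le`, `sum_gapPotential_splitCell_le`).

universe u

/-! ### Decision trees as programs, and searching for a threshold -/

namespace CompTree

variable {K K' R R' : Type} {α : Type*} [LinearOrder α]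

def bind : CompTree K R → (R → CompTree K R') → CompTree K R'
  | done r, f => f r
  | comp a b next, f => comp a b fun o => bind (next o) f

@[simp] theorem result_bind (val : K → α) (T : CompTree K R) (f : R → CompTree K R') :
    (T.bind f).result val = (f (T.result val)).result val := by
  induction T with
  | done r => rfl
  | comp a b next ih => simp only [bind, result, ih]

@[simp] theorem cost_bind (val : K → α) (T : CompTree K R) (f : R → CompTree K R') :
    (T.bind f).cost val = T.cost val + (f (T.result val)).cost val := by
  induction T with
  | done r => simp [bind, cost, result]
  | comp a b next ih => simp only [bind, cost, result, ih]; omega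

@[simp] theorem result_done (val : K → α) (r : R) : (done r : CompTree K R).result val = r := rfl

@[simp] theorem cost_done (val : K → α) (r : R) : (done r : CompTree K R).cost val = 0 := rfl

@[simp] theorem result_ite (val : K → α) (c : Prop) [Decidable c] (S T : CompTree K R) :
    (if c then S else T).result val = if c then S.result val else T.result val := by
  split_ifs <;> rfl

@[simp] theorem cost_ite (val : K → α) (c : Prop) [Decidable c] (S T : CompTree K R) :
    (if c then S else T).cost val = if c then S.cost val else T.cost val := by
  split_ifs <;> rfl

/-- A single comparison. -/
def ask (a b : K) : CompTree K Ordering := comp a b done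

@[simp] theorem result_ask (val : K → α) (a b : K) :
    (ask a b).result val = cmp (val a) (val b) := rfl

@[simp] theorem cost_ask (val : K → α) (a b : K) : (ask a b).cost val = 1 := rfl

/-- Run programs one after the other. -/
def traverse {ι : Type} (f : ι → CompTree K R) : List ι → CompTree K (List R)
  | [] => done []
  | i :: l => (f i).bind fun r => (traverse f l).bind fun rs => done (r :: rs)

@[simp] theorem result_traverse {ι : Type} (val : K → α) (f : ι → CompTree K R) (l : List ι) :
    (traverse f l).result val = l.map fun i => (f i).result val := by
  induction l with
  | nil => rfl
  | cons i l ih => simp [traverse, ih]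

@[simp] theorem cost_traverse {ι : Type} (val : K → α) (f : ι → CompTree K R) (l : List ι) :
    (traverse f l).cost val = (l.map fun i => (f i).cost val).sum := by
  induction l with
  | nil => rfl
  | cons i l ih => simp [traverse, ih]

/-- Run programs for the elements of a finite set, and collect the results in a function. -/
noncomputable def collect {ι : Type} [DecidableEq ι] [Inhabited R] (f : ι → CompTree K R)
    (s : Finset ι) : CompTree K (ι → R) :=
  -- The result for `i` stands at the index of `i` in the list; the default is read only outside
  -- `s`.
  (traverse f s.toList).bind fun rs => done fun i => rs.getD (s.toList.idxOf i) default

theorem result_collect {ι : Type} [DecidableEq ι] [Inhabited R] (val : K → α)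
    (f : ι → CompTree K R) (s : Finset ι) {i : ι} (hi : i ∈ s) :
    (collect f s).result val i = (f i).result val := by
  have h : s.toList.idxOf i < s.toList.length := List.idxOf_lt_length_iff.2 (by simpa using hi)
  simp only [collect, result_bind, result_traverse, result_done]
  rw [List.getD_eq_getElem _ _ (by simpa using h), List.getElem_map, List.getElem_idxOf]

theorem cost_collect {ι : Type} [DecidableEq ι] [Inhabited R] (val : K → α)
    (f : ι → CompTree K R) (s : Finset ι) :
    (collect f s).cost val = ∑ i ∈ s, (f i).cost val := by
  simp [collect]

def mapKeys (g : K → K') : CompTree K R → CompTree K' R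
  | done r => done r
  | comp a b next => comp (g a) (g b) fun o => mapKeys g (next o)

@[simp] theorem result_mapKeys (g : K → K') (val : K' → α) (T : CompTree K R) :
    (T.mapKeys g).result val = T.result fun k => val (g k) := by
  induction T with
  | done r => rfl
  | comp a b next ih => simp only [mapKeys, result, ih]

@[simp] theorem cost_mapKeys (g : K → K') (val : K' → α) (T : CompTree K R) :
    (T.mapKeys g).cost val = T.cost fun k => val (g k) := by
  induction T with
  | done r => rfl
  | comp a b next ih => simp only [mapKeys, cost, ih]

/-- Break ties between equal keys by the keys themselves. -/
def breakTies [LinearOrder K] : CompTree K R → CompTree K R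
  | done r => done r
  | comp a b next => comp a b fun o => breakTies (next (o.then (cmp a b)))

theorem cmp_toLex {β : Type*} [LinearOrder β] (a a' : α) (b b' : β) :
    cmp (toLex (a, b)) (toLex (a', b')) = (cmp a a').then (cmp b b') := by
  rcases lt_trichotomy a a' with h | rfl | h
  · rw [(cmp_eq_lt_iff _ _).2 h]
    exact (cmp_eq_lt_iff _ _).2 (Prod.Lex.toLex_lt_toLex.2 (Or.inl h))
  · rw [cmp_self_eq_eq]
    rcases lt_trichotomy b b' with h | rfl | h
    · rw [(cmp_eq_lt_iff _ _).2 h]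
      exact (cmp_eq_lt_iff _ _).2 (Prod.Lex.toLex_lt_toLex.2 (Or.inr ⟨rfl, h⟩))
    · simp
    · rw [(cmp_eq_gt_iff _ _).2 h]
      exact (cmp_eq_gt_iff _ _).2 (Prod.Lex.toLex_lt_toLex.2 (Or.inr ⟨rfl, h⟩))
  · rw [(cmp_eq_gt_iff _ _).2 h]
    exact (cmp_eq_gt_iff _ _).2 (Prod.Lex.toLex_lt_toLex.2 (Or.inl h))

/-- The second components are the keys themselves, and comparing them asks nothing of the data. So a
program for distinct values runs on arbitrary values at the same cost. -/
theorem breakTies_spec [LinearOrder K] (val : K → α) (T : CompTree K R) :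
    T.breakTies.result val = T.result (fun k => toLex (val k, k)) ∧
      T.breakTies.cost val = T.cost (fun k => toLex (val k, k)) := by
  induction T with
  | done r => exact ⟨rfl, rfl⟩
  | comp a b next ih =>
    simp only [breakTies, result, cost, cmp_toLex]
    exact ⟨(ih _).1, by rw [(ih _).2]⟩

/-- Find the first index `t` below `N` (or `N`) for which the monotone test succeeds: test `0`, find
the first odd index recursively, and test its predecessor. -/
def search : ℕ → ℕ → (ℕ → CompTree K Bool) → CompTree K ℕ
  | 0, _, _ => done 0
  | f + 1, N, P =>
    if N = 0 then done 0 else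
      (P 0).bind fun b => if b = true then done 0 else
        (search f (N / 2) fun i => P (2 * i + 1)).bind fun t =>
          if 2 * t < N then (P (2 * t)).bind fun b => done (if b = true then 2 * t else 2 * t + 1)
          else done (2 * t)

/-- On the odd indices the threshold is `t / 2`. Each level thus halves the threshold at the price
of two tests, and the cost depends on the answer `t` and not on the range. The first argument of
`search` is fuel. -/
theorem search_spec (val : K → α) (f N t : ℕ) (P : ℕ → CompTree K Bool) (hf : N ≤ f) (ht : t ≤ N)
    (hP : ∀ i < N, (P i).result val = decide (t ≤ i) ∧ (P i).cost val ≤ 1) :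
    (search f N P).result val = t ∧
      (search f N P).cost val ≤ if t = 0 then 1 else 2 * Nat.log 2 t + 3 := by
  induction f generalizing N t P with
  | zero =>
    obtain rfl : N = 0 := by omega
    obtain rfl : t = 0 := by omega
    simp [search]
  | succ f ih =>
    by_cases hN : N = 0
    · obtain rfl : t = 0 := by omega
      simp [search, hN]
    · obtain ⟨h0, h0'⟩ := hP 0 (by omega)
      by_cases ht0 : t = 0
      · subst ht0
        simp only [search, hN, if_false, result_bind, cost_bind, h0]
        simpa using h0'
      · obtain ⟨ir, ic⟩ := ih (N / 2) (t / 2) (fun i => P (2 * i + 1)) (by omega) (by omega) (by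
          intro i hi
          obtain ⟨h1, h2⟩ := hP (2 * i + 1) (by omega)
          refine ⟨?_, h2⟩
          rw [h1]
          exact decide_eq_decide.2 (by omega))
        -- The two tests of this level are paid by the decrease of the logarithm, or by the constant
        -- if `t = 1`.
        have hlog : (if t / 2 = 0 then 1 else 2 * Nat.log 2 (t / 2) + 3) + 2
            ≤ 2 * Nat.log 2 t + 3 := by
          split_ifs with h
          · omega
          · have : Nat.log 2 t = Nat.log 2 (t / 2) + 1 := Nat.log_of_one_lt_of_le (by norm_num) (by omega)
            omega
        have hb : decide (t ≤ 0) = false := decide_eq_false (by omega)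
        simp only [search, hN, if_false, result_bind, cost_bind, h0, hb, result_ite, cost_ite,
          result_done, cost_done, ir, ht0, Bool.false_eq_true]
        by_cases h2 : 2 * (t / 2) < N
        · obtain ⟨g1, g2⟩ := hP _ h2
          simp only [h2, if_true, g1, decide_eq_true_eq]
          constructor
          · split_ifs <;> omega
          · omega
        · simp only [h2, if_false]
          omega

def searchDown (h : ℕ) (P : ℕ → CompTree K Bool) : CompTree K ℕ :=
  (search h h fun i => (P (h - 1 - i)).bind fun b => done (!b)).bind fun t => done (h - t)

/-- Reversing the indices and negating the answers turns the threshold `t` into `h - t`, its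
distance from the top. -/
theorem searchDown_spec (val : K → α) (h t : ℕ) (P : ℕ → CompTree K Bool) (ht : t ≤ h)
    (hP : ∀ i < h, (P i).result val = decide (t ≤ i) ∧ (P i).cost val ≤ 1) :
    (searchDown h P).result val = t ∧
      (searchDown h P).cost val ≤ if h = 0 then 0 else 2 * Nat.log 2 (h - t) + 3 := by
  obtain ⟨h1, h2⟩ := search_spec val h h (h - t) (fun i => (P (h - 1 - i)).bind fun b => done (!b))
    le_rfl (by omega) (by
      intro i hi
      obtain ⟨g1, g2⟩ := hP (h - 1 - i) (by omega)
      refine ⟨?_, by simpa using g2⟩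
      simp only [result_bind, result_done, g1]
      rw [← decide_not]
      exact decide_eq_decide.2 (by omega))
  constructor
  · simp only [searchDown, result_bind, result_done, h1]; omega
  · by_cases h0 : h = 0
    · subst h0; simp [searchDown, search]
    · simp only [searchDown, cost_bind, cost_done, h0, if_false]
      split_ifs at h2 <;> omega

/-- Search for the threshold `t` of the test, starting from the index `h`. -/
def fingerSearch (N h : ℕ) (P : ℕ → CompTree K Bool) : CompTree K ℕ :=
  if h < N then (P h).bind fun b => if b = true then searchDown h P else
    (search (N - h - 1) (N - h - 1) fun i => P (h + 1 + i)).bind fun t => done (h + 1 + t)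
  else searchDown N P

/-- One test at `h` tells the side, and the search then moves away from `h`. The empty range costs
nothing, so a query that is asked before any block is identified has no finger term. -/
theorem fingerSearch_spec (val : K → α) (N h t : ℕ) (P : ℕ → CompTree K Bool) (ht : t ≤ N)
    (hh : h ≤ N) (hP : ∀ i < N, (P i).result val = decide (t ≤ i) ∧ (P i).cost val ≤ 1) :
    (fingerSearch N h P).result val = t ∧
      (fingerSearch N h P).cost val
        ≤ if N = 0 then 0 else 2 * Nat.log 2 ((t - h) + (h - t)) + 4 := by
  by_cases hN : h < N
  · have hN0 : N ≠ 0 := by omega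
    obtain ⟨g1, g2⟩ := hP h hN
    simp only [fingerSearch, hN, if_true, result_bind, cost_bind, g1, result_ite, cost_ite,
      decide_eq_true_eq, hN0, if_false, result_done, cost_done]
    by_cases hth : t ≤ h
    · obtain ⟨k1, k2⟩ := searchDown_spec val h t P hth fun i hi => hP i (by omega)
      simp only [hth, if_true, k1, true_and]
      have : t - h + (h - t) = h - t := by omega
      rw [this]
      split_ifs at k2 <;> omega
    · obtain ⟨k1, k2⟩ := search_spec val (N - h - 1) (N - h - 1) (t - h - 1)
        (fun i => P (h + 1 + i)) le_rfl (by omega) (by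
          intro i hi
          obtain ⟨l1, l2⟩ := hP (h + 1 + i) (by omega)
          refine ⟨?_, l2⟩
          rw [l1]
          exact decide_eq_decide.2 (by omega))
      simp only [hth, if_false, k1]
      have : t - h + (h - t) = t - h := by omega
      rw [this]
      have hm : Nat.log 2 (t - h - 1) ≤ Nat.log 2 (t - h) := Nat.log_mono_right (by omega)
      refine ⟨by omega, ?_⟩
      split_ifs at k2 <;> omega
  · obtain rfl : h = N := by omega
    obtain ⟨k1, k2⟩ := searchDown_spec val h t P ht hP
    simp only [fingerSearch, lt_irrefl, if_false, k1, true_and]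
    have : t - h + (h - t) = h - t := by omega
    rw [this]
    split_ifs at k2 ⊢
    all_goals omega

/-- Search for the threshold from the nearer end. -/
def endsSearch (N : ℕ) (P : ℕ → CompTree K Bool) : CompTree K ℕ :=
  if N = 0 then done 0 else (P (N / 2)).bind fun b =>
    if b = true then search (N / 2) (N / 2) P else searchDown N P

/-- The test in the middle tells the nearer end, so the cost is governed by the smaller of the two
pieces. This is what makes cutting payable by block weights. -/
theorem endsSearch_spec (val : K → α) (N t : ℕ) (P : ℕ → CompTree K Bool) (ht : t ≤ N)
    (hP : ∀ i < N, (P i).result val = decide (t ≤ i) ∧ (P i).cost val ≤ 1) :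
    (endsSearch N P).result val = t ∧
      (endsSearch N P).cost val ≤ 2 * Nat.log 2 (min t (N - t)) + 4 := by
  by_cases hN : N = 0
  · obtain rfl : t = 0 := by omega
    simp [endsSearch, hN]
  · obtain ⟨g1, g2⟩ := hP (N / 2) (by omega)
    simp only [endsSearch, hN, if_false, result_bind, cost_bind, g1, result_ite, cost_ite,
      decide_eq_true_eq]
    by_cases hth : t ≤ N / 2
    · obtain ⟨k1, k2⟩ := search_spec val (N / 2) (N / 2) t P le_rfl hth fun i hi => hP i (by omega)
      simp only [hth, if_true, k1, true_and]
      rw [min_eq_left (by omega)]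
      split_ifs at k2 <;> omega
    · obtain ⟨k1, k2⟩ := searchDown_spec val N t P ht hP
      simp only [hth, if_false, k1, true_and]
      rw [min_eq_right (by omega)]
      split_ifs at k2; omega

end CompTree

/-! ### Monotone tests along a list -/

section Lists

/-- A test that can only turn from true to false along the list holds exactly on an initial segment,
whose length is the count. This makes counts the thresholds of searches. -/
theorem List.take_countP_eq_filter {ι : Type*} (p : ι → Bool) (l : List ι)
    (h : l.Pairwise fun a b => p b = true → p a = true) :
    l.take (l.countP p) = l.filter p ∧
      ∀ (i : ℕ) (hi : i < l.length), p l[i] = decide (i < l.countP p) := by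
  induction l with
  | nil => simp
  | cons a l ih =>
    rw [List.pairwise_cons] at h
    obtain ⟨h1, h2⟩ := ih h.2
    by_cases ha : p a = true
    · simp only [List.countP_cons, ha, if_true, List.take_succ_cons, h1, List.filter_cons,
        true_and]
      rintro (_ | i) hi
      · simp [ha]
      · simpa using h2 i (by simpa using hi)
    · have hl : ∀ b ∈ l, p b = false := fun b hb => by
        cases hpb : p b
        · rfl
        · exact absurd (h.1 b hb hpb) ha
      have h0 : l.countP p = 0 := List.countP_eq_zero.2 fun b hb => by simp [hl b hb]
      have h0' : l.filter p = [] := List.filter_eq_nil_iff.2 fun b hb => by simp [hl b hb]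
      simp only [List.countP_cons, ha, List.filter_cons, h0, h0']
      refine ⟨by simp, ?_⟩
      rintro (_ | i) hi
      · simp [ha]
      · simpa using hl _ (List.getElem_mem _)

end Lists

/-! ### Block weights, and cutting a sorted block -/

/-- The weight of a sorted block of `s` elements in the potential that pays for searching. -/
noncomputable def blockWeight (s : ℕ) : ℝ := if s = 0 then 0 else 2 * Real.logb 2 s + 2

theorem blockWeight_zero : blockWeight 0 = 0 := by simp [blockWeight]

theorem natLog_le_logb (s : ℕ) : (Nat.log 2 s : ℝ) ≤ Real.logb 2 s := by
  simpa using Real.natLog_le_logb s 2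

/-- For `0 < a ≤ b` one has `log (a + b) ≤ 1 + log b`, so the split increases the weight by at least
`2 log a`: the second summand `2` of the weight makes up for the `1`. If one piece is empty, the
weight is unchanged and the cost is constant. -/
theorem search_le_blockWeight {a b c : ℕ} (h : c ≤ 2 * Nat.log 2 (min a b) + 4) :
    (c : ℝ) ≤ 4 + (blockWeight a + blockWeight b - blockWeight (a + b)) := by
  wlog hab : a ≤ b generalizing a b
  · rw [add_comm a b, add_comm (blockWeight a)]
    exact this (by rwa [min_comm]) (by omega)
  rw [min_eq_left hab] at h
  have hc : (c : ℝ) ≤ 2 * (Nat.log 2 a : ℝ) + 4 := by exact_mod_cast h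
  rcases Nat.eq_zero_or_pos a with rfl | ha
  · simpa [blockWeight_zero] using hc
  · have hl := natLog_le_logb a
    have hb : (0 : ℝ) < b := by exact_mod_cast (by omega : 0 < b)
    have key : Real.logb 2 ((a + b : ℕ) : ℝ) ≤ 1 + Real.logb 2 b := by
      have : (1 : ℝ) + Real.logb 2 b = Real.logb 2 (2 * b) := by
        rw [Real.logb_mul (by norm_num) hb.ne']; simp
      rw [this]
      apply Real.logb_le_logb_of_le (by norm_num)
      · exact_mod_cast (by omega : 0 < a + b)
      · exact_mod_cast (by omega : a + b ≤ 2 * b)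
    unfold blockWeight
    rw [if_neg (by omega), if_neg (by omega), if_neg (by omega)]
    linarith

/-- Splitting a sorted block: `acc` tells which outcomes of the comparison with `y` put an element
into the upper part. -/
theorem exists_cut {K : Type} [LinearOrder K] (T : Finset K) (y : K) (acc : Ordering → Bool) :
    ∃ t : CompTree K (Finset K), ∀ (α : Type*) [LinearOrder α] (A : K → α),
      (∀ p ∈ T, ∀ p' ∈ T, p ≤ p' → acc (cmp (A p) (A y)) = true → acc (cmp (A p') (A y)) = true) →
      t.result A = T.filter (fun p => acc (cmp (A p) (A y)) = false) ∧
      (t.cost A : ℝ) ≤ 4 + (blockWeight (T.filter fun p => acc (cmp (A p) (A y)) = false).card +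
        blockWeight (T.filter fun p => acc (cmp (A p) (A y)) = true).card
        - blockWeight T.card) := by
  set l := T.sort (· ≤ ·) with hl
  -- The test is monotone in the index because the list is sorted by position. The default `y` is
  -- out of reach, as indices stay below the length.
  refine ⟨(CompTree.endsSearch l.length fun i =>
    (CompTree.ask (l.getD i y) y).bind fun o => .done (acc o)).bind fun t =>
      .done (l.take t).toFinset, ?_⟩
  intro α _ A hA
  have hT : l.toFinset = T := by simp [hl]
  have hsort : l.Pairwise (· ≤ ·) := Finset.pairwise_sort T (· ≤ ·)
  have hnd : l.Nodup := Finset.sort_nodup T (· ≤ ·)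
  set p : K → Bool := fun a => !acc (cmp (A a) (A y)) with hp
  have hmem : ∀ a ∈ l, a ∈ T := fun a ha => by rw [← hT]; simpa using ha
  obtain ⟨h1, h2⟩ := List.take_countP_eq_filter p l (by
    refine List.Pairwise.imp_of_mem ?_ hsort
    intro a b ha hb hab hpb
    by_contra hpa
    simp only [hp, Bool.not_eq_true', Bool.not_eq_false] at hpa hpb
    rw [hA a (hmem a ha) b (hmem b hb) hab hpa] at hpb
    exact absurd hpb (by simp))
  have hcount : l.countP p = (T.filter fun a => acc (cmp (A a) (A y)) = false).card := by
    rw [List.countP_eq_length_filter, ← List.toFinset_card_of_nodup (hnd.filter _),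
      List.toFinset_filter, hT]
    simp [hp]
  have hlen : l.length = T.card := by simp [hl]
  have hcompl : T.card = (T.filter fun a => acc (cmp (A a) (A y)) = false).card
      + (T.filter fun a => acc (cmp (A a) (A y)) = true).card := by
    rw [add_comm, ← Finset.card_filter_add_card_filter_not (s := T)
      (fun a => acc (cmp (A a) (A y)) = true)]
    simp
  obtain ⟨g1, g2⟩ := CompTree.endsSearch_spec A l.length (l.countP p)
    (fun i => (CompTree.ask (l.getD i y) y).bind fun o => .done (acc o))
    List.countP_le_length (by
      intro i hi
      refine ⟨?_, by simp⟩
      have := h2 i hi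
      simp only [CompTree.result_bind, CompTree.result_ask, CompTree.result_done]
      rw [List.getD_eq_getElem _ _ hi]
      simp only [hp] at this
      rw [← Bool.not_not (acc _), this, ← decide_not]
      exact decide_eq_decide.2 not_lt)
  constructor
  · simp only [CompTree.result_bind, g1, CompTree.result_done, h1, List.toFinset_filter, hT]
    simp [hp]
  · have hrest : l.length - l.countP p
        = (T.filter fun a => acc (cmp (A a) (A y)) = true).card := by omega
    rw [hrest, hcount] at g2
    rw [CompTree.cost_bind, CompTree.cost_done, add_zero, hcompl]
    exact search_le_blockWeight g2

/-! ### Selection in linear time by the median of medians -/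

section Selection

variable {K : Type} [DecidableEq K]

/-- The element of rank `k + 1` is the least one above the element of rank `k`; injectivity excludes
ties. -/
theorem exists_card_lt_eq {K : Type*} [DecidableEq K] {α : Type*} [LinearOrder α] (val : K → α) (S : Finset K)
    (hval : Set.InjOn val S) (k : ℕ) (hk : k < S.card) :
    ∃ p ∈ S, (S.filter fun y => val y < val p).card = k := by
  induction k with
  | zero =>
    obtain ⟨p, hp, hmin⟩ := S.exists_min_image val (Finset.card_pos.1 hk)
    refine ⟨p, hp, ?_⟩
    rw [Finset.card_eq_zero, Finset.filter_eq_empty_iff]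
    exact fun y hy => not_lt.2 (hmin y hy)
  | succ k ih =>
    obtain ⟨p, hp, hpk⟩ := ih (by omega)
    have hne : (S.filter fun y => val p < val y).Nonempty := by
      by_contra h
      rw [Finset.not_nonempty_iff_eq_empty, Finset.filter_eq_empty_iff] at h
      have : S ⊆ insert p (S.filter fun y => val y < val p) := by
        intro y hy
        rcases (not_lt.1 (h hy)).lt_or_eq with h' | h'
        · exact Finset.mem_insert_of_mem (Finset.mem_filter.2 ⟨hy, h'⟩)
        · rw [hval hy hp h']; exact Finset.mem_insert_self _ _
      have := (Finset.card_le_card this).trans (Finset.card_insert_le _ _)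
      omega
    obtain ⟨s, hs, hmin⟩ := Finset.exists_min_image _ val hne
    rw [Finset.mem_filter] at hs
    refine ⟨s, hs.1, ?_⟩
    have : (S.filter fun y => val y < val s) = insert p (S.filter fun y => val y < val p) := by
      ext y
      simp only [Finset.mem_filter, Finset.mem_insert]
      constructor
      · rintro ⟨hy, hlt⟩
        rcases lt_trichotomy (val y) (val p) with h | h | h
        · exact Or.inr ⟨hy, h⟩
        · exact Or.inl (hval hy hp h)
        · exact absurd (hmin y (Finset.mem_filter.2 ⟨hy, h⟩)) (not_le.2 hlt)
      · rintro (rfl | ⟨hy, hlt⟩)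
        · exact ⟨hp, hs.2⟩
        · exact ⟨hy, hlt.trans hs.2⟩
    rw [this, Finset.card_insert_of_notMem (by simp), hpk]

/-- Selection by comparing all pairs. -/
theorem exists_select_allPairs [Inhabited K] (S : Finset K) (k : ℕ) :
    ∃ T : CompTree K K, ∀ (α : Type u) [LinearOrder α] (val : K → α), Set.InjOn val S →
      k < S.card → (T.result val ∈ S ∧
        (S.filter fun y => val y < val (T.result val)).card = k ∧ T.cost val ≤ S.card ^ 2) := by
  classical
  let _ : Inhabited Ordering := ⟨.eq⟩
  -- Once all pairs are compared, the ranks are read off the table without further cost.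
  let res : (K × K → Ordering) → K := fun o =>
    if h : ∃ p ∈ S, (S.filter fun y => o (y, p) = .lt).card = k then h.choose else default
  refine ⟨(CompTree.collect (fun q : K × K => CompTree.ask q.1 q.2) (S ×ˢ S)).bind
    fun o => .done (res o), ?_⟩
  intro α _ val hval hk
  set o := (CompTree.collect (fun q : K × K => CompTree.ask q.1 q.2) (S ×ˢ S)).result val with ho
  have hoe : ∀ p ∈ S, (S.filter fun y => o (y, p) = .lt) = S.filter fun y => val y < val p := by
    intro p hp
    refine Finset.filter_congr fun y hy => ?_
    rw [ho, CompTree.result_collect _ _ _ (Finset.mk_mem_product hy hp)]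
    exact cmp_eq_lt_iff _ _
  have hex : ∃ p ∈ S, (S.filter fun y => o (y, p) = .lt).card = k := by
    obtain ⟨p, hp, h⟩ := exists_card_lt_eq val S hval k hk
    exact ⟨p, hp, by rw [hoe p hp, h]⟩
  have hres : res o = hex.choose := dif_pos hex
  simp only [CompTree.result_bind, CompTree.result_done, CompTree.cost_bind, CompTree.cost_done,
    ← ho, hres, CompTree.cost_collect]
  refine ⟨hex.choose_spec.1, ?_, ?_⟩
  · rw [← hoe _ hex.choose_spec.1]; exact hex.choose_spec.2
  · simp [sq]

/-- Greedy: as long as five elements are left over, they form another group. -/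
theorem exists_groups {K : Type*} [DecidableEq K] (S : Finset K) (g : ℕ) (hg : 5 * g ≤ S.card) :
    ∃ Gs : Finset (Finset K), Gs.card = g ∧ (∀ G ∈ Gs, G ⊆ S ∧ G.card = 5) ∧
      (Gs : Set (Finset K)).PairwiseDisjoint id := by
  induction g with
  | zero => exact ⟨∅, by simp⟩
  | succ g ih =>
    obtain ⟨Gs, h1, h2, h3⟩ := ih (by omega)
    have hc : (Gs.biUnion id).card = 5 * g := by
      rw [Finset.card_biUnion h3, Finset.sum_congr rfl fun G hG => show (id G).card = 5 from (h2 G hG).2]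
      simp [h1, mul_comm]
    have hsub : Gs.biUnion id ⊆ S := Finset.biUnion_subset.2 fun G hG => (h2 G hG).1
    obtain ⟨G, hG, hG5⟩ := Finset.exists_subset_card_eq (s := S \ Gs.biUnion id) (n := 5) (by
      rw [Finset.card_sdiff_of_subset hsub]; omega)
    have hdis : ∀ H ∈ Gs, Disjoint G H := fun H hH => by
      refine Finset.disjoint_left.2 fun x hx hxH => ?_
      exact (Finset.mem_sdiff.1 (hG hx)).2 (Finset.mem_biUnion.2 ⟨H, hH, hxH⟩)
    have hnot : G ∉ Gs := fun h => by
      have := hdis G h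
      rw [disjoint_self] at this
      rw [this] at hG5
      simp at hG5
    refine ⟨insert G Gs, by rw [Finset.card_insert_of_notMem hnot, h1], ?_, ?_⟩
    · intro H hH
      rcases Finset.mem_insert.1 hH with rfl | hH
      · exact ⟨hG.trans Finset.sdiff_subset, hG5⟩
      · exact h2 H hH
    · rw [Finset.coe_insert]
      exact h3.insert fun H hH _ => hdis H hH

/-- If `Gs` are disjoint groups in `S`, and three elements of a group satisfy `P` whenever its
median satisfies `P`, then there are three times as many such elements as such medians. -/
theorem three_mul_card_le {K : Type*} [DecidableEq K] (S : Finset K) (Gs : Finset (Finset K))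
    (hsub : ∀ G ∈ Gs, G ⊆ S) (hdis : (Gs : Set (Finset K)).PairwiseDisjoint id)
    (med : Finset K → K) (P : K → Prop) [DecidablePred P]
    (h3 : ∀ G ∈ Gs, P (med G) → 3 ≤ (G.filter P).card) :
    3 * ((Gs.image med).filter P).card ≤ (S.filter P).card := by
  have h1 : ((Gs.image med).filter P).card ≤ (Gs.filter fun G => P (med G)).card := by
    rw [Finset.filter_image]; exact Finset.card_image_le
  have h2 : ((Gs.filter fun G => P (med G)).biUnion fun G => G.filter P) ⊆ S.filter P := by
    intro x hx
    simp only [Finset.mem_biUnion, Finset.mem_filter] at hx ⊢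
    obtain ⟨G, hG, hxG, hx⟩ := hx
    exact ⟨hsub G hG.1 hxG, hx⟩
  have h4 := Finset.card_le_card h2
  rw [Finset.card_biUnion] at h4
  · have h5 : (Gs.filter fun G => P (med G)).card * 3
        ≤ ∑ G ∈ Gs.filter fun G => P (med G), (G.filter P).card := by
      rw [← smul_eq_mul]
      exact Finset.card_nsmul_le_sum _ _ _ fun G hG =>
        h3 G (Finset.mem_filter.1 hG).1 (Finset.mem_filter.1 hG).2
    omega
  · intro G hG H hH hne
    exact (hdis (Finset.mem_filter.1 hG).1 (Finset.mem_filter.1 hH).1 hne).mono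
      (Finset.filter_subset _ _) (Finset.filter_subset _ _)

theorem card_filter_trichotomy {K : Type*} [DecidableEq K] {α : Type*} [LinearOrder α]
    (val : K → α) (S : Finset K) (hval : Set.InjOn val S) {x : K} (hx : x ∈ S) :
    (S.filter fun y => val y < val x).card + 1 + (S.filter fun y => val x < val y).card = S.card ∧
    (S.filter fun y => val y ≤ val x).card = (S.filter fun y => val y < val x).card + 1 ∧
    (S.filter fun y => val x ≤ val y).card = (S.filter fun y => val x < val y).card + 1 := by
  have e1 : (S.filter fun y => val y ≤ val x) = insert x (S.filter fun y => val y < val x) := by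
    ext y
    simp only [Finset.mem_filter, Finset.mem_insert]
    constructor
    · rintro ⟨hy, h⟩
      rcases h.lt_or_eq with h | h
      · exact Or.inr ⟨hy, h⟩
      · exact Or.inl (hval hy hx h)
    · rintro (rfl | ⟨hy, h⟩)
      · exact ⟨hx, le_rfl⟩
      · exact ⟨hy, h.le⟩
  have e2 : (S.filter fun y => val x ≤ val y) = insert x (S.filter fun y => val x < val y) := by
    ext y
    simp only [Finset.mem_filter, Finset.mem_insert]
    constructor
    · rintro ⟨hy, h⟩
      rcases h.lt_or_eq with h | h
      · exact Or.inr ⟨hy, h⟩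
      · exact Or.inl (hval hy hx h.symm)
    · rintro (rfl | ⟨hy, h⟩)
      · exact ⟨hx, le_rfl⟩
      · exact ⟨hy, h.le⟩
  have c1 : (S.filter fun y => val y ≤ val x).card = (S.filter fun y => val y < val x).card + 1 := by
    rw [e1, Finset.card_insert_of_notMem (by simp)]
  have c2 : (S.filter fun y => val x ≤ val y).card = (S.filter fun y => val x < val y).card + 1 := by
    rw [e2, Finset.card_insert_of_notMem (by simp)]
  refine ⟨?_, c1, c2⟩
  have := Finset.card_filter_add_card_filter_not (s := S) (fun y => val y ≤ val x)
  simp only [not_le] at this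
  omega

/-- The arithmetic of the median of medians: few elements are below (above) the median of the
medians of the groups. -/
theorem median_of_medians_bounds {K : Type*} [DecidableEq K] {α : Type*} [LinearOrder α]
    (val : K → α) (S : Finset K) (hval : Set.InjOn val S) (Gs : Finset (Finset K))
    (hG : ∀ G ∈ Gs, G ⊆ S ∧ G.card = 5) (hdis : (Gs : Set (Finset K)).PairwiseDisjoint id)
    (med : Finset K → K)
    (hmed : ∀ G ∈ Gs, med G ∈ G ∧ (G.filter fun y => val y < val (med G)).card = 2)
    {x : K} (hx : x ∈ Gs.image med)
    (hxm : ((Gs.image med).filter fun y => val y < val x).card = (Gs.image med).card / 2) :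
    2 * (S.filter fun y => val y < val x).card + 3 * Gs.card ≤ 2 * S.card ∧
    2 * (S.filter fun y => val x < val y).card + 3 * Gs.card ≤ 2 * S.card := by
  have hinj : Set.InjOn med Gs := by
    intro G hGm H hHm h
    by_contra hne
    have := Finset.disjoint_left.1 (hdis hGm hHm hne) (hmed G hGm).1
    exact this (h ▸ (hmed H hHm).1)
  have hcard : (Gs.image med).card = Gs.card := Finset.card_image_of_injOn hinj
  have hMS : Gs.image med ⊆ S := by
    intro y hy
    obtain ⟨G, hGm, rfl⟩ := Finset.mem_image.1 hy
    exact (hG G hGm).1 (hmed G hGm).1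
  have hMi : Set.InjOn val (Gs.image med : Finset K) := hval.mono (by exact_mod_cast hMS)
  have hGi : ∀ G ∈ Gs, Set.InjOn val G := fun G h => hval.mono (by exact_mod_cast (hG G h).1)
  obtain ⟨m1, m2, m3⟩ := card_filter_trichotomy val _ hMi hx
  obtain ⟨s1, s2, s3⟩ := card_filter_trichotomy val _ hval (hMS hx)
  -- If the median of a group is at most `x`, so are the two elements below it; and at least half of
  -- the medians are at most `x`. The other direction is symmetric.
  have a1 := three_mul_card_le S Gs (fun G h => (hG G h).1) hdis med (fun y => val y ≤ val x) (by
    intro G h hle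
    obtain ⟨_, g2, _⟩ := card_filter_trichotomy val G (hGi G h) (hmed G h).1
    rw [(hmed G h).2] at g2
    exact g2.symm.le.trans (Finset.card_le_card fun y hy => by
      rw [Finset.mem_filter] at hy ⊢
      exact ⟨hy.1, hy.2.trans hle⟩))
  have a2 := three_mul_card_le S Gs (fun G h => (hG G h).1) hdis med (fun y => val x ≤ val y) (by
    intro G h hle
    obtain ⟨g1, _, g3⟩ := card_filter_trichotomy val G (hGi G h) (hmed G h).1
    rw [(hmed G h).2, (hG G h).2] at g1
    refine le_trans (by omega : 3 ≤ _) (g3.symm.le.trans (Finset.card_le_card fun y hy => ?_))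
    rw [Finset.mem_filter] at hy ⊢
    exact ⟨hy.1, hle.trans hy.2⟩)
  omega

/-- Selection in linear time. -/
theorem exists_select [Inhabited K] (S : Finset K) (k : ℕ) :
    ∃ T : CompTree K K, ∀ (α : Type u) [LinearOrder α] (val : K → α), Set.InjOn val S →
      k < S.card → (T.result val ∈ S ∧
        (S.filter fun y => val y < val (T.result val)).card = k ∧
          T.cost val ≤ 120 * S.card) := by
  classical
  let _ : Inhabited Ordering := ⟨.eq⟩
  induction hm : S.card using Nat.strong_induction_on generalizing S k with
  | _ m ih =>
  subst hm
  by_cases hsmall : S.card ≤ 24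
  · obtain ⟨T, hT⟩ := exists_select_allPairs.{u} S k
    refine ⟨T, fun α _ val hval hk => ?_⟩
    obtain ⟨h1, h2, h3⟩ := hT α val hval hk
    exact ⟨h1, h2, h3.trans (by nlinarith)⟩
  -- The subsets on which the recursion is called depend on the outcomes of comparisons, so a
  -- program is needed for every set in advance. Sets that are not smaller get a dummy.
  · have ih' : ∀ (S' : Finset K) (k' : ℕ), ∃ T : CompTree K K, S'.card < S.card →
        ∀ (α : Type u) [LinearOrder α] (val : K → α), Set.InjOn val S' →
        k' < S'.card → (T.result val ∈ S' ∧
          (S'.filter fun y => val y < val (T.result val)).card = k' ∧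
            T.cost val ≤ 120 * S'.card) := by
      intro S' k'
      by_cases h : S'.card < S.card
      · obtain ⟨T, hT⟩ := ih _ h S' k' rfl
        exact ⟨T, fun _ => hT⟩
      · exact ⟨.done default, fun h' => absurd h' h⟩
    choose sel hsel using ih'
    choose small hsmallsel using fun G : Finset K => exists_select_allPairs.{u} G 2
    obtain ⟨Gs, hGc, hG, hdis⟩ := exists_groups S (S.card / 5) (by omega)
    -- With `g` groups and `s = S.card` the cost is at most `25 g + 120 g + s + 120 (s - 3 g / 2) =
    -- 121 s - 35 g`, and `s ≤ 35 g`.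
    refine ⟨(CompTree.collect small Gs).bind fun med =>
      (sel (Gs.image med) ((Gs.image med).card / 2)).bind fun x =>
      (CompTree.collect (fun y => CompTree.ask y x) S).bind fun o =>
      if (S.filter fun y => o y = .lt).card = k then .done x
      else if k < (S.filter fun y => o y = .lt).card then sel (S.filter fun y => o y = .lt) k
      else sel (S.filter fun y => o y = .gt) (k - (S.filter fun y => o y = .lt).card - 1), ?_⟩
    intro α _ val hval hk
    have hGi : ∀ G ∈ Gs, Set.InjOn val G := fun G h => hval.mono (by exact_mod_cast (hG G h).1)
    set med := (CompTree.collect small Gs).result val with hmeddef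
    have hmed' : ∀ G ∈ Gs, med G ∈ G ∧ (G.filter fun y => val y < val (med G)).card = 2 ∧
        (small G).cost val ≤ 25 := by
      intro G h
      obtain ⟨h1, h2, h3⟩ := hsmallsel G α val (hGi G h) (by rw [(hG G h).2]; norm_num)
      rw [hmeddef, CompTree.result_collect _ _ _ h]
      rw [(hG G h).2] at h3
      exact ⟨h1, h2, h3⟩
    have hMS : Gs.image med ⊆ S := by
      intro y hy
      obtain ⟨G, hGm, rfl⟩ := Finset.mem_image.1 hy
      exact (hG G hGm).1 (hmed' G hGm).1
    have hMle : (Gs.image med).card ≤ S.card / 5 := hGc ▸ Finset.card_image_le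
    have hMpos : 0 < (Gs.image med).card := by
      rw [Finset.card_pos, Finset.image_nonempty, ← Finset.card_pos, hGc]; omega
    obtain ⟨x1, x2, x3⟩ := hsel (Gs.image med) ((Gs.image med).card / 2) (by omega) α val
      (hval.mono (by exact_mod_cast hMS)) (by omega)
    set x := (sel (Gs.image med) ((Gs.image med).card / 2)).result val with hxdef
    set o := (CompTree.collect (fun y => CompTree.ask y x) S).result val with hodef
    have ho : ∀ y ∈ S, o y = cmp (val y) (val x) := fun y hy => by
      rw [hodef, CompTree.result_collect _ _ _ hy, CompTree.result_ask]
    have hlt : (S.filter fun y => o y = .lt) = S.filter fun y => val y < val x :=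
      Finset.filter_congr fun y hy => by rw [ho y hy]; exact cmp_eq_lt_iff _ _
    have hgt : (S.filter fun y => o y = .gt) = S.filter fun y => val x < val y :=
      Finset.filter_congr fun y hy => by rw [ho y hy]; exact cmp_eq_gt_iff _ _
    obtain ⟨b1, b2⟩ := median_of_medians_bounds val S hval Gs hG hdis med
      (fun G h => ⟨(hmed' G h).1, (hmed' G h).2.1⟩) x1 x2
    obtain ⟨s1, s2, -⟩ := card_filter_trichotomy val S hval (hMS x1)
    have hcost1 : (CompTree.collect small Gs).cost val ≤ 25 * (S.card / 5) := by
      rw [CompTree.cost_collect, ← hGc, mul_comm, ← smul_eq_mul]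
      exact Finset.sum_le_card_nsmul _ _ _ fun G h => (hmed' G h).2.2
    have hcost2 : (CompTree.collect (fun y => CompTree.ask y x) S).cost val = S.card := by
      simp [CompTree.cost_collect]
    simp only [CompTree.result_bind, CompTree.cost_bind, ← hmeddef, ← hxdef, ← hodef,
      CompTree.result_ite, CompTree.cost_ite, CompTree.result_done, CompTree.cost_done, hlt, hgt,
      hcost2]
    set lo := S.filter fun y => val y < val x with hlo
    set up := S.filter fun y => val x < val y with hup
    rw [hGc] at b1 b2
    by_cases c1 : lo.card = k
    · rw [if_pos c1, if_pos c1]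
      refine ⟨hMS x1, c1, by omega⟩
    · rw [if_neg c1, if_neg c1]
      by_cases c2 : k < lo.card
      · rw [if_pos c2, if_pos c2]
        obtain ⟨r1, r2, r3⟩ := hsel lo k (by omega) α val
          (hval.mono (by exact_mod_cast Finset.filter_subset _ _)) c2
        refine ⟨(Finset.mem_filter.1 r1).1, ?_, by omega⟩
        refine (congrArg Finset.card ?_).trans r2
        rw [hlo, Finset.filter_filter]
        refine Finset.filter_congr fun y hy => ?_
        exact ⟨fun h => ⟨h.trans (Finset.mem_filter.1 r1).2, h⟩, fun h => h.2⟩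
      · rw [if_neg c2, if_neg c2]
        obtain ⟨r1, r2, r3⟩ := hsel up (k - lo.card - 1) (by omega) α val
          (hval.mono (by exact_mod_cast Finset.filter_subset _ _)) (by omega)
        set r := (sel up (k - lo.card - 1)).result val
        have hr := (Finset.mem_filter.1 r1).2
        refine ⟨(Finset.mem_filter.1 r1).1, ?_, by omega⟩
        have hsplit : (S.filter fun y => val y < val r)
            = (S.filter fun y => val y ≤ val x) ∪ up.filter fun y => val y < val r := by
          ext y
          simp only [hup, Finset.mem_filter, Finset.mem_union]
          constructor
          · rintro ⟨hy, h⟩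
            rcases le_or_gt (val y) (val x) with h' | h'
            · exact Or.inl ⟨hy, h'⟩
            · exact Or.inr ⟨⟨hy, h'⟩, h⟩
          · rintro (⟨hy, h⟩ | ⟨⟨hy, h'⟩, h⟩)
            · exact ⟨hy, h.trans_lt hr⟩
            · exact ⟨hy, h⟩
        have hd : Disjoint (S.filter fun y => val y ≤ val x) (up.filter fun y => val y < val r) := by
          refine Finset.disjoint_left.2 fun y hy hy' => ?_
          have h1 := (Finset.mem_filter.1 hy).2
          have h2 := (Finset.mem_filter.1 (Finset.mem_filter.1 hy').1).2
          exact absurd h1 (not_le.2 h2)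
        rw [hsplit, Finset.card_union_of_disjoint hd, r2, s2]
        omega

end Selection

/-! ### What a partitioning step does -/

section Partitioning

variable {n : ℕ} {α : Type*} [LinearOrder α]

/-- The runs are nondecreasing. -/
def RunsSorted (A : Fin n → α) (runOf : Fin n → ℕ) : Prop :=
  ∀ p p' : Fin n, runOf p = runOf p' → p ≤ p' → A p ≤ A p'

/-- A descent between two positions raises the number of descents, so there is none between
positions of the same run. -/
theorem runsSorted_runIndex (A : Fin n → α) : RunsSorted A (runIndex A) := by
  have key : ∀ (d : ℕ) (p p' : Fin n), p.val + d = p'.val → runIndex A p = runIndex A p' →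
      A p ≤ A p' := by
    intro d
    induction d with
    | zero =>
      intro p p' h _
      rw [Fin.ext (by simpa using h : p.val = p'.val)]
    | succ d ih =>
      intro p p' h hr
      have hlt : p.val + d < n := by omega
      set m : Fin n := ⟨p.val + d, hlt⟩ with hm
      have hmono : ∀ a b : Fin n, a ≤ b → runIndex A a ≤ runIndex A b := fun a b hab =>
        Finset.card_le_card fun x hx => by
          simp only [Finset.mem_filter] at hx ⊢
          exact ⟨hx.1, hx.2.1.trans hab, hx.2.2⟩
      have hpm : p ≤ m := Fin.le_def.2 (by simp [hm])
      have hmp : m ≤ p' := Fin.le_def.2 (by simp [hm]; omega)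
      have h1 : runIndex A p = runIndex A m :=
        le_antisymm (hmono _ _ hpm) (hr ▸ hmono _ _ hmp)
      refine (ih p m rfl h1).trans (not_lt.1 fun hdesc => ?_)
      have hsub : runIndex A m < runIndex A p' := by
        refine Finset.card_lt_card (Finset.ssubset_iff_of_subset (fun x hx => ?_) |>.2
          ⟨p', ?_, ?_⟩)
        · simp only [Finset.mem_filter] at hx ⊢
          exact ⟨hx.1, hx.2.1.trans hmp, hx.2.2⟩
        · simp only [Finset.mem_filter, Finset.mem_univ, true_and]
          exact ⟨le_rfl, m, by simp only [hm]; omega, hdesc⟩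
        · simp only [Finset.mem_filter, Finset.mem_univ, true_and, not_and]
          intro hle
          have := Fin.le_def.1 hle
          simp only [hm] at this
          omega
      omega
  intro p p' hr hle
  exact key (p'.val - p.val) p p' (by have := Fin.le_def.1 hle; omega) hr

theorem mem_runPart {runOf : Fin n → ℕ} {S : Finset (Fin n)} {r : ℕ} {p : Fin n} :
    p ∈ runPart runOf S r ↔ p ∈ S ∧ runOf p = r := by simp [runPart]

theorem mem_runsMeeting {runOf : Fin n → ℕ} {S : Finset (Fin n)} {r : ℕ} :
    r ∈ runsMeeting runOf S ↔ ∃ p ∈ S, runOf p = r := by simp [runsMeeting]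

theorem exists_middle (runOf : Fin n → ℕ) (S : Finset (Fin n)) {r : ℕ}
    (hr : r ∈ runsMeeting runOf S) : ∃ p ∈ middles runOf S, runOf p = r := by
  obtain ⟨p0, hp0, hr0⟩ := mem_runsMeeting.1 hr
  have hpos : 0 < (runPart runOf S r).card := Finset.card_pos.2 ⟨p0, mem_runPart.2 ⟨hp0, hr0⟩⟩
  obtain ⟨p, hp, hc⟩ := exists_card_lt_eq (id : Fin n → Fin n) (runPart runOf S r)
    (Function.injective_id.injOn) ((runPart runOf S r).card / 2) (by omega)
  obtain ⟨hpS, hpr⟩ := mem_runPart.1 hp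
  refine ⟨p, ?_, hpr⟩
  simp only [middles, Finset.mem_filter]
  exact ⟨hpS, by rw [hpr]; exact hc⟩

theorem eq_of_card_lt_eq {K β : Type*} [LinearOrder β] (val : K → β) (S : Finset K) {p p' : K}
    (hp : p ∈ S) (hp' : p' ∈ S)
    (h : (S.filter fun y => val y < val p).card = (S.filter fun y => val y < val p').card) :
    val p = val p' := by
  wlog hlt : val p < val p' generalizing p p'
  · rcases lt_trichotomy (val p) (val p') with h1 | h1 | h1
    · exact absurd h1 hlt
    · exact h1
    · exact (this hp' hp h.symm h1).symm
  have : (S.filter fun y => val y < val p).card < (S.filter fun y => val y < val p').card := by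
    refine Finset.card_lt_card (Finset.ssubset_iff_of_subset (fun y hy => ?_) |>.2 ⟨p, ?_, ?_⟩)
    · simp only [Finset.mem_filter] at hy ⊢
      exact ⟨hy.1, hy.2.trans hlt⟩
    · exact Finset.mem_filter.2 ⟨hp, hlt⟩
    · simp
  omega

theorem runOf_injOn_middles (runOf : Fin n → ℕ) (S : Finset (Fin n)) :
    Set.InjOn runOf (middles runOf S) := by
  intro p hp p' hp' h
  simp only [middles, Finset.coe_filter, Set.mem_ofPred_eq] at hp hp'
  have h1 := hp.2
  have h2 := hp'.2
  rw [← h] at h2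
  exact eq_of_card_lt_eq (id : Fin n → Fin n) (runPart runOf S (runOf p))
    (mem_runPart.2 ⟨hp.1, rfl⟩) (mem_runPart.2 ⟨hp'.1, h.symm⟩) (h1.trans h2.symm)

theorem image_runOf_middles (runOf : Fin n → ℕ) (S : Finset (Fin n)) :
    (middles runOf S).image runOf = runsMeeting runOf S := by
  ext r
  constructor
  · intro h
    obtain ⟨p, hp, rfl⟩ := Finset.mem_image.1 h
    exact mem_runsMeeting.2 ⟨p, (Finset.mem_filter.1 hp).1, rfl⟩
  · intro h
    obtain ⟨p, hp, rfl⟩ := exists_middle runOf S h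
    exact Finset.mem_image_of_mem _ hp

/-- Each run that meets `S` has exactly one middle. So the selection of the pivot is linear in the
number of runs, not of elements. -/
theorem card_middles (runOf : Fin n → ℕ) (S : Finset (Fin n)) :
    (middles runOf S).card = (runsMeeting runOf S).card := by
  rw [← image_runOf_middles, Finset.card_image_of_injOn (runOf_injOn_middles runOf S)]

/-- The order by values, ties being broken by position. -/
def lexKey {α : Type*} (A : Fin n → α) (p : Fin n) : α ×ₗ Fin n := toLex (A p, p)

theorem lexKey_lt {A : Fin n → α} {p p' : Fin n} :
    lexKey A p < lexKey A p' ↔ A p < A p' ∨ (A p = A p' ∧ p < p') := Prod.Lex.toLex_lt_toLex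

theorem lexKey_injective {α : Type*} (A : Fin n → α) : Function.Injective (lexKey A) := fun _ _ h =>
  congrArg (fun x => (ofLex x).2) h

/-- Under the injective order `lexKey` ranks are unique, so any program that finds a middle of the
right rank has found the pivot of the specification. -/
theorem medianOfMiddles_eq_some {A : Fin n → α} {runOf : Fin n → ℕ} {S : Finset (Fin n)}
    {μ : Fin n} (h1 : μ ∈ middles runOf S)
    (h2 : ((middles runOf S).filter fun p => lexKey A p < lexKey A μ).card
      = (middles runOf S).card / 2) :
    medianOfMiddles A runOf S = some μ := by
  simp only [lexKey_lt] at h2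
  unfold medianOfMiddles
  have hsome : ((List.finRange n).find? fun p => decide (p ∈ middles runOf S ∧
      ((middles runOf S).filter fun p' => A p' < A p ∨ (A p' = A p ∧ p' < p)).card
        = (middles runOf S).card / 2)).isSome := by
    rw [List.find?_isSome]
    exact ⟨μ, List.mem_finRange μ, decide_eq_true ⟨h1, h2⟩⟩
  obtain ⟨ν, hν⟩ := Option.isSome_iff_exists.1 hsome
  rw [hν]
  have hf := List.find?_some hν
  simp only [decide_eq_true_eq] at hf
  obtain ⟨n1, n2⟩ := hf
  refine congrArg some (lexKey_injective A (eq_of_card_lt_eq (lexKey A) _ n1 h1 ?_))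
  simp only [lexKey_lt]
  exact n2.trans h2.symm

theorem exists_median (A : Fin n → α) (runOf : Fin n → ℕ) {S : Finset (Fin n)}
    (hS : S.Nonempty) :
    ∃ μ ∈ middles runOf S, ((middles runOf S).filter fun p => lexKey A p < lexKey A μ).card
      = (middles runOf S).card / 2 := by
  have : 0 < (middles runOf S).card := by
    rw [card_middles, Finset.card_pos]
    exact hS.image _
  exact exists_card_lt_eq (lexKey A) _ (lexKey_injective A).injOn _ (by omega)

/-- What a partitioning step does to the sub-instance `S`: `L` and `R` are the two smaller unsorted
sub-instances, and `Bs` lists the newly identified blocks between them. -/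
structure IsPartitioning (A : Fin n → α) (runOf : Fin n → ℕ) (S L R : Finset (Fin n))
    (Bs : List (Finset (Fin n))) : Prop where
  pairwise : (L :: (Bs ++ [R])).Pairwise (Below A)
  mem_iff : ∀ p, p ∈ S ↔ ∃ T ∈ L :: (Bs ++ [R]), p ∈ T
  nonempty : ∃ B ∈ Bs, B.Nonempty
  length_le : Bs.length ≤ 3
  sorted : ∀ B ∈ Bs, ∀ p ∈ B, ∀ p' ∈ B, p ≤ p' → A p ≤ A p'
  -- This and the next field are all that is used of the choice of the pivot: at least half of the
  -- runs have at least half of their elements outside `R`, and likewise for `L`.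
  lower : ∃ H ⊆ runsMeeting runOf S, (runsMeeting runOf S).card ≤ 2 * H.card ∧
    ∀ r ∈ H, (runPart runOf S r).card ≤ 2 * (runPart runOf S r \ R).card
  upper : ∃ H ⊆ runsMeeting runOf S, (runsMeeting runOf S).card ≤ 2 * H.card ∧
    ∀ r ∈ H, (runPart runOf S r).card ≤ 2 * (runPart runOf S r \ L).card

/-- The cells that a partitioning step makes. -/
def partitionCells (L R : Finset (Fin n)) (Bs : List (Finset (Fin n))) : List (Cell n) :=
  ((⟨false, L⟩ : Cell n) :: (Bs.map (Cell.mk true) ++ [⟨false, R⟩])).filter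
    fun c => decide c.elts.Nonempty

/-- The newly identified blocks for the pivot `μ`. -/
def newBlocks (A : Fin n → α) (runOf : Fin n → ℕ) (S : Finset (Fin n)) (μ : Fin n) :
    List (Finset (Fin n)) :=
  if ∃ p ∈ S, A p = A μ ∧ runOf p ≠ runOf μ then
    [(S \ (lowerPart A runOf S μ ∪ upperPart A runOf S μ)).filter fun p => A p < A μ,
      (S \ (lowerPart A runOf S μ ∪ upperPart A runOf S μ)).filter fun p => A p = A μ,
      (S \ (lowerPart A runOf S μ ∪ upperPart A runOf S μ)).filter fun p => A μ < A p]
  else [S \ (lowerPart A runOf S μ ∪ upperPart A runOf S μ)]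

theorem splitCell_eq {A : Fin n → α} {runOf : Fin n → ℕ} {S : Finset (Fin n)} {μ : Fin n}
    (h : medianOfMiddles A runOf S = some μ) :
    splitCell A runOf S = partitionCells (lowerPart A runOf S μ) (upperPart A runOf S μ)
      (newBlocks A runOf S μ) := by
  unfold splitCell partitionCells newBlocks
  rw [h]
  by_cases hm : ∃ p ∈ S, A p = A μ ∧ runOf p ≠ runOf μ
  · simp only [hm, if_true, List.map_cons, List.map_nil]
  · simp only [hm, if_false, List.map_cons, List.map_nil]

theorem mem_lowerPart {A : Fin n → α} {runOf : Fin n → ℕ} {S : Finset (Fin n)} {μ p : Fin n} :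
    p ∈ lowerPart A runOf S μ ↔
      p ∈ S ∧ ∃ p' ∈ S, runOf p' ≠ runOf μ ∧ A p' < A μ ∧ A p ≤ A p' := by simp [lowerPart]

theorem mem_upperPart {A : Fin n → α} {runOf : Fin n → ℕ} {S : Finset (Fin n)} {μ p : Fin n} :
    p ∈ upperPart A runOf S μ ↔
      p ∈ S ∧ ∃ p' ∈ S, runOf p' ≠ runOf μ ∧ A μ < A p' ∧ A p' ≤ A p := by simp [upperPart]

/-- If the middle of a run is at most the pivot, then so is the lower half of that run, which is
therefore outside the upper part; at least half of the runs are of this kind, since the pivot is the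
median of the middles. The other side is symmetric. The new blocks are sorted by position because
their elements come from the run of the pivot or have the value of the pivot. -/
theorem isPartitioning_split {A : Fin n → α} {runOf : Fin n → ℕ} (hrun : RunsSorted A runOf)
    {S : Finset (Fin n)} {μ : Fin n} (h1 : μ ∈ middles runOf S)
    (h2 : ((middles runOf S).filter fun p => lexKey A p < lexKey A μ).card
      = (middles runOf S).card / 2) :
    IsPartitioning A runOf S (lowerPart A runOf S μ) (upperPart A runOf S μ)
      (newBlocks A runOf S μ) := by
  set L := lowerPart A runOf S μ with hL
  set R := upperPart A runOf S μ with hR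
  have hμS : μ ∈ S := (Finset.mem_filter.1 h1).1
  have hLlt : ∀ p ∈ L, A p < A μ := fun p hp => by
    obtain ⟨_, p', _, _, h3, h4⟩ := mem_lowerPart.1 hp
    exact h4.trans_lt h3
  have hRlt : ∀ p ∈ R, A μ < A p := fun p hp => by
    obtain ⟨_, p', _, _, h3, h4⟩ := mem_upperPart.1 hp
    exact h3.trans_le h4
  set B := S \ (L ∪ R) with hB
  have memB : ∀ p, p ∈ B ↔ p ∈ S ∧ p ∉ L ∧ p ∉ R := fun p => by simp [hB]
  have hLB : ∀ p ∈ L, ∀ p' ∈ B, A p < A p' := fun p hp p' hp' => by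
    by_contra hle
    obtain ⟨_, q, h3, h4, h5, h6⟩ := mem_lowerPart.1 hp
    exact ((memB p').1 hp').2.1
      (mem_lowerPart.2 ⟨((memB p').1 hp').1, q, h3, h4, h5, (not_lt.1 hle).trans h6⟩)
  have hBR : ∀ p' ∈ B, ∀ p ∈ R, A p' < A p := fun p' hp' p hp => by
    by_contra hle
    obtain ⟨_, q, h3, h4, h5, h6⟩ := mem_upperPart.1 hp
    exact ((memB p').1 hp').2.2
      (mem_upperPart.2 ⟨((memB p').1 hp').1, q, h3, h4, h5, h6.trans (not_lt.1 hle)⟩)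
  -- In another run such an element would itself be a candidate for `maxₗ` or `minᵣ`.
  have hBrun : ∀ p ∈ B, A p ≠ A μ → runOf p = runOf μ := fun p hp hne => by
    by_contra hr
    obtain ⟨hpS, hpL, hpR⟩ := (memB p).1 hp
    rcases lt_or_gt_of_ne hne with h | h
    · exact hpL (mem_lowerPart.2 ⟨hpS, p, hpS, hr, h, le_rfl⟩)
    · exact hpR (mem_upperPart.2 ⟨hpS, p, hpS, hr, h, le_rfl⟩)
  have hμB : μ ∈ B := (memB μ).2 ⟨hμS, fun h => lt_irrefl _ (hLlt μ h), fun h => lt_irrefl _ (hRlt μ h)⟩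
  have hcover : ∀ p, p ∈ S ↔ p ∈ L ∨ p ∈ B ∨ p ∈ R := fun p => by
    rw [memB]
    constructor
    · intro hp; tauto
    · rintro (h | h | h)
      · exact (mem_lowerPart.1 h).1
      · exact h.1
      · exact (mem_upperPart.1 h).1
  obtain ⟨-, t2, t3⟩ := card_filter_trichotomy (lexKey A) (middles runOf S)
    (lexKey_injective A).injOn h1
  obtain ⟨t1, -, -⟩ := card_filter_trichotomy (lexKey A) (middles runOf S)
    (lexKey_injective A).injOn h1
  have hlexle : ∀ p q, lexKey A p ≤ lexKey A q → A p ≤ A q := fun p q h => by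
    rcases h.lt_or_eq with h | h
    · rcases lexKey_lt.1 h with h | h
      exacts [h.le, h.1.le]
    · rw [lexKey_injective A h]
  have hmid : ∀ p ∈ middles runOf S, p ∈ S ∧ ((runPart runOf S (runOf p)).filter fun p' => p' < p).card
      = (runPart runOf S (runOf p)).card / 2 := fun p hp => Finset.mem_filter.1 hp
  have hpw : ∀ l : List (Finset (Fin n)), l.Pairwise (Below A) →
      (∀ T ∈ l, T ⊆ B) → (L :: (l ++ [R])).Pairwise (Below A) := by
    intro l hl hT
    rw [List.pairwise_cons, List.pairwise_append]
    refine ⟨?_, hl, by simp, ?_⟩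
    · intro T hTm p hp p' hp'
      rcases List.mem_append.1 hTm with h | h
      · exact hLB p hp p' (hT T h hp')
      · rw [List.mem_singleton.1 h] at hp'
        exact (hLlt p hp).trans (hRlt p' hp')
    · intro T hTm T' hT' p hp p' hp'
      rw [List.mem_singleton.1 hT'] at hp'
      exact hBR p (hT T hTm hp) p' hp'
  refine ⟨?_, ?_, ?_, ?_, ?_, ?_, ?_⟩
  · apply hpw
    · unfold newBlocks
      split_ifs
      · simp only [List.pairwise_cons, List.mem_cons, List.not_mem_nil, or_false,
          forall_eq_or_imp, forall_eq, Below, Finset.mem_filter]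
        refine ⟨⟨fun p hp p' hp' => hp'.2 ▸ hp.2, fun p hp p' hp' => hp.2.trans hp'.2⟩,
          fun p hp p' hp' => hp.2 ▸ hp'.2, by simp, by simp⟩
      · simp
    · unfold newBlocks
      split_ifs
      · simp only [List.mem_cons, List.not_mem_nil, or_false, forall_eq_or_imp, forall_eq]
        exact ⟨Finset.filter_subset _ _, Finset.filter_subset _ _, Finset.filter_subset _ _⟩
      · simp only [List.mem_singleton, forall_eq]
        exact subset_rfl
  · intro p
    rw [hcover p]
    have : (∃ T ∈ newBlocks A runOf S μ, p ∈ T) ↔ p ∈ B := by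
      unfold newBlocks
      split_ifs
      · simp only [List.mem_cons, List.not_mem_nil, or_false, exists_eq_or_imp, exists_eq_left,
          Finset.mem_filter, ← hB, ← hL, ← hR]
        constructor
        · rintro (h | h | h) <;> exact h.1
        · intro h
          rcases lt_trichotomy (A p) (A μ) with h' | h' | h'
          exacts [Or.inl ⟨h, h'⟩, Or.inr (Or.inl ⟨h, h'⟩), Or.inr (Or.inr ⟨h, h'⟩)]
      · simp [← hB, ← hL, ← hR]
    simp only [List.mem_cons, List.mem_append, List.not_mem_nil, or_false, or_and_right, exists_or, this, exists_eq_left]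
  · unfold newBlocks
    split_ifs
    · exact ⟨_, List.mem_cons_of_mem _ List.mem_cons_self, μ, Finset.mem_filter.2 ⟨hμB, rfl⟩⟩
    · exact ⟨_, List.mem_cons_self, μ, hμB⟩
  · unfold newBlocks
    split_ifs <;> simp
  · unfold newBlocks
    split_ifs with hm
    · simp only [List.mem_cons, List.not_mem_nil, or_false, forall_eq_or_imp, forall_eq,
        Finset.mem_filter]
      refine ⟨fun p hp p' hp' hle => ?_, fun p hp p' hp' hle => ?_, fun p hp p' hp' hle => ?_⟩
      · exact hrun p p' ((hBrun p hp.1 hp.2.ne).trans (hBrun p' hp'.1 hp'.2.ne).symm) hle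
      · exact (hp.2.trans hp'.2.symm).le
      · exact hrun p p' ((hBrun p hp.1 hp.2.ne').trans (hBrun p' hp'.1 hp'.2.ne').symm) hle
    · simp only [List.mem_cons, List.not_mem_nil, or_false, forall_eq]
      have hall : ∀ p ∈ B, runOf p = runOf μ := fun p hp => by
        by_cases hne : A p = A μ
        · by_contra hr
          exact hm ⟨p, ((memB p).1 hp).1, hne, hr⟩
        · exact hBrun p hp hne
      intro p hp p' hp' hle
      exact hrun p p' ((hall p hp).trans (hall p' hp').symm) hle
  · refine ⟨((middles runOf S).filter fun y => lexKey A y ≤ lexKey A μ).image runOf, ?_, ?_, ?_⟩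
    · rw [← image_runOf_middles]
      exact Finset.image_subset_image (Finset.filter_subset _ _)
    · rw [Finset.card_image_of_injOn ((runOf_injOn_middles runOf S).mono
        (by exact_mod_cast Finset.filter_subset _ _)), t2, h2, card_middles]
      omega
    · intro r hr
      obtain ⟨m, hm, rfl⟩ := Finset.mem_image.1 hr
      obtain ⟨hmm, hmle⟩ := Finset.mem_filter.1 hm
      obtain ⟨hmS, hmc⟩ := hmid m hmm
      -- The middle and the elements before it: `⌊t / 2⌋ + 1` of the `t` elements of the run.
      have hsub : insert m ((runPart runOf S (runOf m)).filter fun p' => p' < m)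
          ⊆ runPart runOf S (runOf m) \ R := by
        intro p hp
        have hp' : p ∈ runPart runOf S (runOf m) ∧ p ≤ m := by
          rcases Finset.mem_insert.1 hp with rfl | hp
          · exact ⟨mem_runPart.2 ⟨hmS, rfl⟩, le_rfl⟩
          · exact ⟨(Finset.mem_filter.1 hp).1, (Finset.mem_filter.1 hp).2.le⟩
        refine Finset.mem_sdiff.2 ⟨hp'.1, fun hpR => ?_⟩
        exact absurd ((hrun p m (mem_runPart.1 hp'.1).2 hp'.2).trans (hlexle _ _ hmle))
          (not_le.2 (hRlt p hpR))
      have := Finset.card_le_card hsub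
      rw [Finset.card_insert_of_notMem (by simp), hmc] at this
      omega
  · refine ⟨((middles runOf S).filter fun y => lexKey A μ ≤ lexKey A y).image runOf, ?_, ?_, ?_⟩
    · rw [← image_runOf_middles]
      exact Finset.image_subset_image (Finset.filter_subset _ _)
    · rw [Finset.card_image_of_injOn ((runOf_injOn_middles runOf S).mono
        (by exact_mod_cast Finset.filter_subset _ _)), t3, ← card_middles]
      omega
    · intro r hr
      obtain ⟨m, hm, rfl⟩ := Finset.mem_image.1 hr
      obtain ⟨hmm, hmle⟩ := Finset.mem_filter.1 hm
      obtain ⟨hmS, hmc⟩ := hmid m hmm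
      -- The middle and the elements after it: `t - ⌊t / 2⌋` of the `t` elements of the run.
      have hsub : (runPart runOf S (runOf m)).filter (fun p' => ¬ p' < m)
          ⊆ runPart runOf S (runOf m) \ L := by
        intro p hp
        obtain ⟨hp1, hp2⟩ := Finset.mem_filter.1 hp
        refine Finset.mem_sdiff.2 ⟨hp1, fun hpL => ?_⟩
        exact absurd ((hlexle _ _ hmle).trans
          (hrun m p (mem_runPart.1 hp1).2.symm (not_lt.1 hp2))) (not_le.2 (hLlt p hpL))
      have := Finset.card_le_card hsub
      have := Finset.card_filter_add_card_filter_not (s := runPart runOf S (runOf m))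
        (fun p' => p' < m)
      omega

end Partitioning

/-! ### Programs for the stages of a partitioning step -/

section SplitProgram

variable {n : ℕ}

theorem exists_cutLT (T : Finset (Fin n)) (y : Fin n) :
    ∃ t : CompTree (Fin n) (Finset (Fin n)), ∀ (α : Type u) [LinearOrder α] (A : Fin n → α),
      (∀ p ∈ T, ∀ p' ∈ T, p ≤ p' → A p ≤ A p') →
      t.result A = T.filter (fun p => A p < A y) ∧
      (t.cost A : ℝ) ≤ 4 + (blockWeight (T.filter fun p => A p < A y).card +
        blockWeight (T \ T.filter fun p => A p < A y).card - blockWeight T.card) := by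
  obtain ⟨t, ht⟩ := exists_cut.{u} T y fun o => decide (o ≠ .lt)
  refine ⟨t, fun α _ A hA => ?_⟩
  obtain ⟨h1, h2⟩ := ht α A (by
    intro p hp p' hp' hle
    simp only [decide_eq_true_eq, ne_eq, cmp_eq_lt_iff, not_lt]
    exact fun h => h.trans (hA p hp p' hp' hle))
  have e1 : (T.filter fun p => decide (cmp (A p) (A y) ≠ .lt) = false)
      = T.filter fun p => A p < A y := by
    refine Finset.filter_congr fun p _ => ?_
    simp
  have e2 : (T.filter fun p => decide (cmp (A p) (A y) ≠ .lt) = true)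
      = T \ T.filter fun p => A p < A y := by
    rw [← Finset.filter_not]
    refine Finset.filter_congr fun p _ => ?_
    simp
  rw [e1] at h1 h2
  rw [e2] at h2
  exact ⟨h1, h2⟩

theorem exists_cutLE (T : Finset (Fin n)) (y : Fin n) :
    ∃ t : CompTree (Fin n) (Finset (Fin n)), ∀ (α : Type u) [LinearOrder α] (A : Fin n → α),
      (∀ p ∈ T, ∀ p' ∈ T, p ≤ p' → A p ≤ A p') →
      t.result A = T.filter (fun p => A p ≤ A y) ∧
      (t.cost A : ℝ) ≤ 4 + (blockWeight (T.filter fun p => A p ≤ A y).card +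
        blockWeight (T \ T.filter fun p => A p ≤ A y).card - blockWeight T.card) := by
  obtain ⟨t, ht⟩ := exists_cut.{u} T y fun o => decide (o = .gt)
  refine ⟨t, fun α _ A hA => ?_⟩
  obtain ⟨h1, h2⟩ := ht α A (by
    intro p hp p' hp' hle
    simp only [decide_eq_true_eq, cmp_eq_gt_iff]
    exact fun h => h.trans_le (hA p hp p' hp' hle))
  have e1 : (T.filter fun p => decide (cmp (A p) (A y) = .gt) = false)
      = T.filter fun p => A p ≤ A y := by
    refine Finset.filter_congr fun p _ => ?_
    simp
  have e2 : (T.filter fun p => decide (cmp (A p) (A y) = .gt) = true)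
      = T \ T.filter fun p => A p ≤ A y := by
    rw [← Finset.filter_not]
    refine Finset.filter_congr fun p _ => ?_
    simp
  rw [e1] at h1 h2
  rw [e2] at h2
  exact ⟨h1, h2⟩

theorem exists_argmax (C : Finset (Fin n)) (p0 : Fin n) :
    ∃ t : CompTree (Fin n) (Fin n), ∀ (α : Type u) [LinearOrder α] (A : Fin n → α),
      t.cost A ≤ C.card ∧ (C.Nonempty → t.result A ∈ C ∧ ∀ p ∈ C, A p ≤ A (t.result A)) := by
  induction C using Finset.induction_on with
  | empty => exact ⟨.done p0, fun α _ A => by simp⟩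
  | insert a C ha ih =>
    obtain ⟨t, ht⟩ := ih
    by_cases hC : C.Nonempty
    · refine ⟨t.bind fun m => .comp m a fun o => if o = .lt then .done a else .done m, ?_⟩
      intro α _ A
      obtain ⟨h1, h2⟩ := ht α A
      obtain ⟨h3, h4⟩ := h2 hC
      rw [Finset.card_insert_of_notMem ha]
      simp only [CompTree.cost_bind, CompTree.result_bind, CompTree.cost, CompTree.result,
        CompTree.result_ite, CompTree.cost_ite, ite_self, cmp_eq_lt_iff]
      refine ⟨by omega, fun _ => ?_⟩
      split_ifs with h
      · refine ⟨Finset.mem_insert_self _ _, fun p hp => ?_⟩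
        rcases Finset.mem_insert.1 hp with rfl | hp
        exacts [le_rfl, (h4 p hp).trans h.le]
      · refine ⟨Finset.mem_insert_of_mem h3, fun p hp => ?_⟩
        rcases Finset.mem_insert.1 hp with rfl | hp
        exacts [not_lt.1 h, h4 p hp]
    · rw [Finset.not_nonempty_iff_eq_empty] at hC
      subst hC
      exact ⟨.done a, fun α _ A => by simp⟩

theorem exists_argmin (C : Finset (Fin n)) (p0 : Fin n) :
    ∃ t : CompTree (Fin n) (Fin n), ∀ (α : Type u) [LinearOrder α] (A : Fin n → α),
      t.cost A ≤ C.card ∧ (C.Nonempty → t.result A ∈ C ∧ ∀ p ∈ C, A (t.result A) ≤ A p) := by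
  induction C using Finset.induction_on with
  | empty => exact ⟨.done p0, fun α _ A => by simp⟩
  | insert a C ha ih =>
    obtain ⟨t, ht⟩ := ih
    by_cases hC : C.Nonempty
    · refine ⟨t.bind fun m => .comp a m fun o => if o = .lt then .done a else .done m, ?_⟩
      intro α _ A
      obtain ⟨h1, h2⟩ := ht α A
      obtain ⟨h3, h4⟩ := h2 hC
      rw [Finset.card_insert_of_notMem ha]
      simp only [CompTree.cost_bind, CompTree.result_bind, CompTree.cost, CompTree.result,
        CompTree.result_ite, CompTree.cost_ite, ite_self, cmp_eq_lt_iff]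
      refine ⟨by omega, fun _ => ?_⟩
      split_ifs with h
      · refine ⟨Finset.mem_insert_self _ _, fun p hp => ?_⟩
        rcases Finset.mem_insert.1 hp with rfl | hp
        exacts [le_rfl, h.le.trans (h4 p hp)]
      · refine ⟨Finset.mem_insert_of_mem h3, fun p hp => ?_⟩
        rcases Finset.mem_insert.1 hp with rfl | hp
        exacts [not_lt.1 h, h4 p hp]
    · rw [Finset.not_nonempty_iff_eq_empty] at hC
      subst hC
      exact ⟨.done a, fun α _ A => by simp⟩

/-- Selection needs distinct values, so its program is applied to `α ×ₗ Fin n`, and `breakTies`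
brings it back to comparisons of array elements. Here it matters that the program of `exists_select`
works for all types of the universe at once. -/
theorem exists_medianProgram (runOf : Fin n → ℕ) {S : Finset (Fin n)} (hS : S.Nonempty) :
    ∃ t : CompTree (Fin n) (Fin n), ∀ (α : Type u) [LinearOrder α] (A : Fin n → α),
      t.result A ∈ middles runOf S ∧
      ((middles runOf S).filter fun p => lexKey A p < lexKey A (t.result A)).card
        = (middles runOf S).card / 2 ∧
      t.cost A ≤ 120 * (runsMeeting runOf S).card := by
  obtain ⟨p0, -⟩ := id hS
  let _ : Inhabited (Fin n) := ⟨p0⟩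
  obtain ⟨t, ht⟩ := exists_select.{u} (middles runOf S) ((middles runOf S).card / 2)
  refine ⟨t.breakTies, fun α _ A => ?_⟩
  have hpos : 0 < (middles runOf S).card := by
    rw [card_middles, Finset.card_pos]
    exact hS.image _
  have := ht (α ×ₗ Fin n) (lexKey A) (lexKey_injective A).injOn (by omega)
  rw [(t.breakTies_spec A).1, (t.breakTies_spec A).2, ← card_middles]
  exact this

theorem RunsSorted.runPart {α : Type*} [LinearOrder α] {A : Fin n → α} {runOf : Fin n → ℕ}
    (h : RunsSorted A runOf) {S T : Finset (Fin n)} {r : ℕ} (hT : T ⊆ runPart runOf S r) :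
    ∀ p ∈ T, ∀ p' ∈ T, p ≤ p' → A p ≤ A p' := fun p hp p' hp' =>
  h p p' ((mem_runPart.1 (hT hp)).2.trans (mem_runPart.1 (hT hp')).2.symm)

/-- Partition the other runs by the pivot. -/
theorem exists_partitionOthers (runOf : Fin n → ℕ) (S : Finset (Fin n)) (μ : Fin n)
    (U : Finset ℕ) :
    ∃ t : CompTree (Fin n) (ℕ → Finset (Fin n) × Finset (Fin n)),
      ∀ (α : Type u) [LinearOrder α] (A : Fin n → α), RunsSorted A runOf →
      (∀ r ∈ U, t.result A r = ((runPart runOf S r).filter fun p => A p < A μ,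
        (runPart runOf S r).filter fun p => A p = A μ)) ∧
      (t.cost A : ℝ) ≤ ∑ r ∈ U, (8 + (blockWeight ((runPart runOf S r).filter fun p => A p < A μ).card
        + blockWeight ((runPart runOf S r).filter fun p => A p = A μ).card
        + blockWeight ((runPart runOf S r).filter fun p => A μ < A p).card
        - blockWeight (runPart runOf S r).card)) := by
  choose lt hlt using fun T => exists_cutLT.{u} (n := n) T μ
  choose le hle using fun T => exists_cutLE.{u} (n := n) T μ
  -- Two cuts per run, with the constant 4 each: the elements below the pivot first, then those
  -- equal to it among the rest. The weights of the intermediate piece cancel.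
  refine ⟨CompTree.collect (fun r => (lt (runPart runOf S r)).bind fun X =>
    (le (runPart runOf S r \ X)).bind fun Y => .done (X, Y)) U, ?_⟩
  intro α _ A hA
  have key : ∀ r, ((lt (runPart runOf S r)).bind fun X =>
      (le (runPart runOf S r \ X)).bind fun Y => CompTree.done (X, Y)).result A =
        ((runPart runOf S r).filter fun p => A p < A μ,
        (runPart runOf S r).filter fun p => A p = A μ) ∧
      (((lt (runPart runOf S r)).bind fun X =>
      (le (runPart runOf S r \ X)).bind fun Y => CompTree.done (X, Y)).cost A : ℝ) ≤
      8 + (blockWeight ((runPart runOf S r).filter fun p => A p < A μ).card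
        + blockWeight ((runPart runOf S r).filter fun p => A p = A μ).card
        + blockWeight ((runPart runOf S r).filter fun p => A μ < A p).card
        - blockWeight (runPart runOf S r).card) := by
    intro r
    set X := (runPart runOf S r).filter fun p => A p < A μ with hX
    obtain ⟨h1, h2⟩ := hlt (runPart runOf S r) α A (hA.runPart subset_rfl)
    obtain ⟨h3, h4⟩ := hle (runPart runOf S r \ X) α A (hA.runPart Finset.sdiff_subset)
    have e1 : (runPart runOf S r \ X).filter (fun p => A p ≤ A μ)
        = (runPart runOf S r).filter fun p => A p = A μ := by
      ext p
      simp only [hX, Finset.mem_filter, Finset.mem_sdiff, not_and, not_lt]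
      constructor
      · rintro ⟨⟨h, h'⟩, h''⟩
        exact ⟨h, le_antisymm h'' (h' h)⟩
      · rintro ⟨h, h'⟩
        exact ⟨⟨h, fun _ => h'.ge⟩, h'.le⟩
    have e2 : (runPart runOf S r \ X) \ (runPart runOf S r).filter (fun p => A p = A μ)
        = (runPart runOf S r).filter fun p => A μ < A p := by
      ext p
      simp only [hX, Finset.mem_filter, Finset.mem_sdiff, not_and, not_lt]
      constructor
      · rintro ⟨⟨h, h'⟩, h''⟩
        exact ⟨h, lt_of_le_of_ne (h' h) (Ne.symm (h'' h))⟩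
      · rintro ⟨h, h'⟩
        exact ⟨⟨h, fun _ => h'.le⟩, fun _ => h'.ne'⟩
    rw [e1] at h3 h4
    rw [e2] at h4
    simp only [CompTree.result_bind, CompTree.cost_bind, CompTree.result_done,
      CompTree.cost_done, h1, h3, ← hX, true_and]
    rw [← hX] at h2
    push_cast
    linarith
  refine ⟨fun r hr => (CompTree.result_collect _ _ _ hr).trans (key r).1, ?_⟩
  rw [CompTree.cost_collect]
  push_cast
  exact Finset.sum_le_sum fun r _ => (key r).2

/-- In a run other than that of the pivot, every element below the pivot is its own witness for
being at most `maxₗ`. So there the cut is at the pivot itself. -/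
theorem runPart_lowerPart_of_ne {α : Type*} [LinearOrder α] {A : Fin n → α} {runOf : Fin n → ℕ}
    {S : Finset (Fin n)} {μ : Fin n} {r : ℕ} (hr : r ≠ runOf μ) :
    runPart runOf (lowerPart A runOf S μ) r = (runPart runOf S r).filter fun p => A p < A μ := by
  ext p
  simp only [mem_runPart, mem_lowerPart, Finset.mem_filter]
  constructor
  · rintro ⟨⟨hp, p', h1, h2, h3, h4⟩, rfl⟩
    exact ⟨⟨hp, rfl⟩, h4.trans_lt h3⟩
  · rintro ⟨⟨hp, rfl⟩, h⟩
    exact ⟨⟨hp, p, hp, hr, h, le_rfl⟩, rfl⟩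

theorem runPart_upperPart_of_ne {α : Type*} [LinearOrder α] {A : Fin n → α} {runOf : Fin n → ℕ}
    {S : Finset (Fin n)} {μ : Fin n} {r : ℕ} (hr : r ≠ runOf μ) :
    runPart runOf (upperPart A runOf S μ) r = (runPart runOf S r).filter fun p => A μ < A p := by
  ext p
  simp only [mem_runPart, mem_upperPart, Finset.mem_filter]
  constructor
  · rintro ⟨⟨hp, p', h1, h2, h3, h4⟩, rfl⟩
    exact ⟨⟨hp, rfl⟩, h3.trans_le h4⟩
  · rintro ⟨⟨hp, rfl⟩, h⟩
    exact ⟨⟨hp, p, hp, hr, h, le_rfl⟩, rfl⟩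

theorem card_le_card_runsMeeting_of_injOn {runOf : Fin n → ℕ} {S C : Finset (Fin n)} (hC : C ⊆ S)
    (h : Set.InjOn runOf C) : C.card ≤ (runsMeeting runOf S).card := by
  rw [← Finset.card_image_of_injOn h]
  exact Finset.card_le_card (Finset.image_subset_image hC)

/-- Cut off the elements of the run of the pivot that are at most `maxₗ`. -/
theorem exists_cutOwnLower (runOf : Fin n → ℕ) (S : Finset (Fin n)) (μ : Fin n)
    (f : ℕ → Finset (Fin n)) :
    ∃ t : CompTree (Fin n) (Finset (Fin n)),
      ∀ (α : Type u) [LinearOrder α] (A : Fin n → α), RunsSorted A runOf →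
      (∀ r ∈ (runsMeeting runOf S).erase (runOf μ),
        f r = (runPart runOf S r).filter fun p => A p < A μ) →
      t.result A = runPart runOf (lowerPart A runOf S μ) (runOf μ) ∧
      (t.cost A : ℝ) ≤ (runsMeeting runOf S).card + 4 +
        (blockWeight (runPart runOf (lowerPart A runOf S μ) (runOf μ)).card +
        blockWeight (runPart runOf S (runOf μ) \
          runPart runOf (lowerPart A runOf S μ) (runOf μ)).card
        - blockWeight (runPart runOf S (runOf μ)).card) := by
  choose le hle using exists_cutLE.{u} (n := n)
  -- One candidate per other run: its last element below the pivot, known from positions without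
  -- comparisons. The greatest candidate is `maxₗ`.
  set C := S.filter fun p => runOf p ≠ runOf μ ∧ p ∈ f (runOf p) ∧ ∀ p' ∈ f (runOf p), p' ≤ p
    with hC
  obtain ⟨am, ham⟩ := exists_argmax.{u} C μ
  refine ⟨if C.Nonempty then am.bind fun y => le (runPart runOf S (runOf μ)) y else .done ∅, ?_⟩
  intro α _ A hA hf
  have hf' : ∀ p ∈ S, runOf p ≠ runOf μ →
      f (runOf p) = (runPart runOf S (runOf p)).filter fun p => A p < A μ := fun p hp hne =>
    hf _ (Finset.mem_erase.2 ⟨hne, mem_runsMeeting.2 ⟨p, hp, rfl⟩⟩)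
  have hCcard : C.card ≤ (runsMeeting runOf S).card := by
    refine card_le_card_runsMeeting_of_injOn (Finset.filter_subset _ _) ?_
    intro p hp p' hp' h
    simp only [hC, Finset.coe_filter, Set.mem_ofPred_eq] at hp hp'
    exact le_antisymm (hp'.2.2.2 p (h ▸ hp.2.2.1)) (hp.2.2.2 p' (h ▸ hp'.2.2.1))
  have hdom : ∀ p ∈ S, runOf p ≠ runOf μ → A p < A μ → ∃ c ∈ C, A p ≤ A c := by
    intro p hp hne hlt
    have hfp := hf' p hp hne
    have hmem : p ∈ f (runOf p) := by
      rw [hfp]; exact Finset.mem_filter.2 ⟨mem_runPart.2 ⟨hp, rfl⟩, hlt⟩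
    have hm := Finset.max'_mem (f (runOf p)) ⟨p, hmem⟩
    set m := (f (runOf p)).max' ⟨p, hmem⟩ with hmdef
    have hm2 := hm
    rw [hfp] at hm2
    obtain ⟨hmS, hmr⟩ := mem_runPart.1 (Finset.mem_filter.1 hm2).1
    refine ⟨m, Finset.mem_filter.2 ⟨hmS, by rw [hmr]; exact hne, by rw [hmr]; exact hm, ?_⟩, ?_⟩
    · rw [hmr]
      exact fun p' hp' => Finset.le_max' _ _ hp'
    · exact hA p m hmr.symm (Finset.le_max' _ _ hmem)
  have hCmem : ∀ c ∈ C, c ∈ S ∧ runOf c ≠ runOf μ ∧ A c < A μ := by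
    intro c hc
    obtain ⟨h1, h2, h3, -⟩ := Finset.mem_filter.1 hc
    rw [hf' c h1 h2] at h3
    exact ⟨h1, h2, (Finset.mem_filter.1 h3).2⟩
  obtain ⟨a1, a2⟩ := ham α A
  by_cases hne : C.Nonempty
  · obtain ⟨a3, a4⟩ := a2 hne
    set y := am.result A with hy
    obtain ⟨y1, y2, y3⟩ := hCmem y a3
    have e : runPart runOf (lowerPart A runOf S μ) (runOf μ)
        = (runPart runOf S (runOf μ)).filter fun p => A p ≤ A y := by
      ext p
      simp only [mem_runPart, mem_lowerPart, Finset.mem_filter]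
      constructor
      · rintro ⟨⟨hp, p', h1, h2, h3, h4⟩, h5⟩
        obtain ⟨c, hc, hle'⟩ := hdom p' h1 h2 h3
        exact ⟨⟨hp, h5⟩, (h4.trans hle').trans (a4 c hc)⟩
      · rintro ⟨⟨hp, h5⟩, h⟩
        exact ⟨⟨hp, y, y1, y2, y3, h⟩, h5⟩
    obtain ⟨h1, h2⟩ := hle (runPart runOf S (runOf μ)) y α A (hA.runPart subset_rfl)
    simp only [hne, if_true, CompTree.result_bind, CompTree.cost_bind, ← hy]
    rw [e]
    refine ⟨h1, ?_⟩
    have : (am.cost A : ℝ) ≤ (runsMeeting runOf S).card := by exact_mod_cast a1.trans hCcard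
    push_cast
    linarith
  · have e : runPart runOf (lowerPart A runOf S μ) (runOf μ) = ∅ := by
      rw [Finset.eq_empty_iff_forall_notMem]
      intro p hp
      obtain ⟨hp1, -⟩ := mem_runPart.1 hp
      obtain ⟨-, p', h1, h2, h3, -⟩ := mem_lowerPart.1 hp1
      obtain ⟨c, hc, -⟩ := hdom p' h1 h2 h3
      exact hne ⟨c, hc⟩
    simp only [hne, if_false, CompTree.result_done, CompTree.cost_done, e, Finset.card_empty,
      blockWeight_zero, Finset.sdiff_empty, true_and]
    have : (0 : ℝ) ≤ (runsMeeting runOf S).card := by positivity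
    push_cast
    linarith

/-- Cut off the elements of the run of the pivot that are at least `minᵣ`. -/
theorem exists_cutOwnUpper (runOf : Fin n → ℕ) (S : Finset (Fin n)) (μ : Fin n)
    (f : ℕ → Finset (Fin n)) (T : Finset (Fin n)) :
    ∃ t : CompTree (Fin n) (Finset (Fin n)),
      ∀ (α : Type u) [LinearOrder α] (A : Fin n → α), RunsSorted A runOf →
      (∀ r ∈ (runsMeeting runOf S).erase (runOf μ),
        f r = (runPart runOf S r).filter fun p => A μ < A p) →
      T ⊆ runPart runOf S (runOf μ) → runPart runOf (upperPart A runOf S μ) (runOf μ) ⊆ T →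
      t.result A = runPart runOf (upperPart A runOf S μ) (runOf μ) ∧
      (t.cost A : ℝ) ≤ (runsMeeting runOf S).card + 4 +
        (blockWeight (runPart runOf (upperPart A runOf S μ) (runOf μ)).card +
        blockWeight (T \ runPart runOf (upperPart A runOf S μ) (runOf μ)).card
        - blockWeight T.card) := by
  choose lt hlt using exists_cutLT.{u} (n := n)
  -- The candidates are now the first elements above the pivot in the other runs, and the least one
  -- is `minᵣ`.
  set C := S.filter fun p => runOf p ≠ runOf μ ∧ p ∈ f (runOf p) ∧ ∀ p' ∈ f (runOf p), p ≤ p'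
    with hC
  obtain ⟨am, ham⟩ := exists_argmin.{u} C μ
  refine ⟨if C.Nonempty then am.bind fun y => (lt T y).bind fun X => .done (T \ X)
    else .done ∅, ?_⟩
  intro α _ A hA hf hT hTs
  have hf' : ∀ p ∈ S, runOf p ≠ runOf μ →
      f (runOf p) = (runPart runOf S (runOf p)).filter fun p => A μ < A p := fun p hp hne =>
    hf _ (Finset.mem_erase.2 ⟨hne, mem_runsMeeting.2 ⟨p, hp, rfl⟩⟩)
  have hCcard : C.card ≤ (runsMeeting runOf S).card := by
    refine card_le_card_runsMeeting_of_injOn (Finset.filter_subset _ _) ?_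
    intro p hp p' hp' h
    simp only [hC, Finset.coe_filter, Set.mem_ofPred_eq] at hp hp'
    exact le_antisymm (hp.2.2.2 p' (h ▸ hp'.2.2.1)) (hp'.2.2.2 p (h ▸ hp.2.2.1))
  have hdom : ∀ p ∈ S, runOf p ≠ runOf μ → A μ < A p → ∃ c ∈ C, A c ≤ A p := by
    intro p hp hne hlt
    have hfp := hf' p hp hne
    have hmem : p ∈ f (runOf p) := by
      rw [hfp]; exact Finset.mem_filter.2 ⟨mem_runPart.2 ⟨hp, rfl⟩, hlt⟩
    have hm := Finset.min'_mem (f (runOf p)) ⟨p, hmem⟩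
    set m := (f (runOf p)).min' ⟨p, hmem⟩ with hmdef
    have hm2 := hm
    rw [hfp] at hm2
    obtain ⟨hmS, hmr⟩ := mem_runPart.1 (Finset.mem_filter.1 hm2).1
    refine ⟨m, Finset.mem_filter.2 ⟨hmS, by rw [hmr]; exact hne, by rw [hmr]; exact hm, ?_⟩, ?_⟩
    · rw [hmr]
      exact fun p' hp' => Finset.min'_le _ _ hp'
    · exact hA m p hmr (Finset.min'_le _ _ hmem)
  have hCmem : ∀ c ∈ C, c ∈ S ∧ runOf c ≠ runOf μ ∧ A μ < A c := by
    intro c hc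
    obtain ⟨h1, h2, h3, -⟩ := Finset.mem_filter.1 hc
    rw [hf' c h1 h2] at h3
    exact ⟨h1, h2, (Finset.mem_filter.1 h3).2⟩
  obtain ⟨a1, a2⟩ := ham α A
  by_cases hne : C.Nonempty
  · obtain ⟨a3, a4⟩ := a2 hne
    set y := am.result A with hy
    obtain ⟨y1, y2, y3⟩ := hCmem y a3
    have hup : ∀ p, p ∈ runPart runOf (upperPart A runOf S μ) (runOf μ) ↔
        p ∈ runPart runOf S (runOf μ) ∧ A y ≤ A p := by
      intro p
      simp only [mem_runPart, mem_upperPart]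
      constructor
      · rintro ⟨⟨hp, p', h1, h2, h3, h4⟩, h5⟩
        obtain ⟨c, hc, hle'⟩ := hdom p' h1 h2 h3
        exact ⟨⟨hp, h5⟩, (a4 c hc).trans (hle'.trans h4)⟩
      · rintro ⟨⟨hp, h5⟩, h⟩
        exact ⟨⟨hp, y, y1, y2, y3, h⟩, h5⟩
    have e : T \ T.filter (fun p => A p < A y)
        = runPart runOf (upperPart A runOf S μ) (runOf μ) := by
      ext p
      rw [← Finset.filter_not, Finset.mem_filter, not_lt]
      exact ⟨fun h => (hup p).2 ⟨hT h.1, h.2⟩, fun h => ⟨hTs h, ((hup p).1 h).2⟩⟩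
    have e' : T \ runPart runOf (upperPart A runOf S μ) (runOf μ)
        = T.filter (fun p => A p < A y) := by
      rw [← e, Finset.sdiff_sdiff_eq_self (Finset.filter_subset _ _)]
    obtain ⟨h1, h2⟩ := hlt T y α A (hA.runPart hT)
    simp only [hne, if_true, CompTree.result_bind, CompTree.cost_bind, ← hy, h1,
      CompTree.result_done, CompTree.cost_done]
    rw [e'] 
    refine ⟨e, ?_⟩
    rw [e] at h2
    have : (am.cost A : ℝ) ≤ (runsMeeting runOf S).card := by exact_mod_cast a1.trans hCcard
    push_cast
    linarith
  · have e : runPart runOf (upperPart A runOf S μ) (runOf μ) = ∅ := by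
      rw [Finset.eq_empty_iff_forall_notMem]
      intro p hp
      obtain ⟨hp1, -⟩ := mem_runPart.1 hp
      obtain ⟨-, p', h1, h2, h3, -⟩ := mem_upperPart.1 hp1
      obtain ⟨c, hc, -⟩ := hdom p' h1 h2 h3
      exact hne ⟨c, hc⟩
    simp only [hne, if_false, CompTree.result_done, CompTree.cost_done, e, Finset.card_empty,
      blockWeight_zero, Finset.sdiff_empty, true_and]
    have : (0 : ℝ) ≤ (runsMeeting runOf S).card := by positivity
    push_cast
    linarith

end SplitProgram

/-! ### The program for a whole partitioning step -/

section SplitProgram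

variable {n : ℕ}

/-- In an unsorted cell, too, the parts in the single runs are sorted blocks, and each of them
carries its weight. -/
noncomputable def cellWeight (runOf : Fin n → ℕ) (T : Finset (Fin n)) : ℝ :=
  ∑ r ∈ runsMeeting runOf T, blockWeight (runPart runOf T r).card

theorem runPart_eq_empty {runOf : Fin n → ℕ} {T : Finset (Fin n)} {r : ℕ}
    (h : r ∉ runsMeeting runOf T) : runPart runOf T r = ∅ := by
  rw [Finset.eq_empty_iff_forall_notMem]
  exact fun p hp => h (mem_runsMeeting.2 ⟨p, (mem_runPart.1 hp).1, (mem_runPart.1 hp).2⟩)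

theorem runsMeeting_mono (runOf : Fin n → ℕ) {T S : Finset (Fin n)} (h : T ⊆ S) :
    runsMeeting runOf T ⊆ runsMeeting runOf S := Finset.image_subset_image h

/-- Empty parts weigh nothing, so the sum may be taken over the runs of the larger set; cells made
from `S` can then be compared with `S` run by run. -/
theorem cellWeight_eq_sum (runOf : Fin n → ℕ) {T S : Finset (Fin n)} (h : T ⊆ S) :
    cellWeight runOf T = ∑ r ∈ runsMeeting runOf S, blockWeight (runPart runOf T r).card := by
  refine Finset.sum_subset (runsMeeting_mono runOf h) fun r _ hr => ?_
  rw [runPart_eq_empty hr, Finset.card_empty, blockWeight_zero]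

theorem cellWeight_empty (runOf : Fin n → ℕ) : cellWeight runOf ∅ = 0 := by
  simp [cellWeight, runsMeeting]

/-- Dropping empty cells does not affect a sum of quantities that vanish on them. -/
theorem sum_partitionCells (L R : Finset (Fin n)) (Bs : List (Finset (Fin n))) (g : Cell n → ℝ)
    (hg : ∀ b, g ⟨b, ∅⟩ = 0) :
    ((partitionCells L R Bs).map g).sum
      = g ⟨false, L⟩ + (Bs.map fun B => g ⟨true, B⟩).sum + g ⟨false, R⟩ := by
  have key : ∀ l : List (Cell n),
      ((l.filter fun c => decide c.elts.Nonempty).map g).sum = (l.map g).sum := by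
    intro l
    induction l with
    | nil => rfl
    | cons c l ih =>
      rw [List.filter_cons]
      split_ifs with h
      · simp [ih]
      · obtain ⟨b, T⟩ := c
        have : T = ∅ := by simpa using h
        subst this
        simp [ih, hg]
  unfold partitionCells
  rw [key]
  simp [add_assoc, Function.comp_def]

/-- The set with the prescribed parts in the runs. -/
def glue (runOf : Fin n → ℕ) (S : Finset (Fin n)) (f : ℕ → Finset (Fin n)) : Finset (Fin n) :=
  S.filter fun p => p ∈ f (runOf p)

theorem glue_eq {runOf : Fin n → ℕ} {S T : Finset (Fin n)} {f : ℕ → Finset (Fin n)} (hT : T ⊆ S)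
    (h : ∀ r ∈ runsMeeting runOf S, f r = runPart runOf T r) : glue runOf S f = T := by
  ext p
  simp only [glue, Finset.mem_filter]
  constructor
  · rintro ⟨hp, hf⟩
    rw [h _ (mem_runsMeeting.2 ⟨p, hp, rfl⟩)] at hf
    exact (mem_runPart.1 hf).1
  · intro hp
    refine ⟨hT hp, ?_⟩
    rw [h _ (mem_runsMeeting.2 ⟨p, hT hp, rfl⟩)]
    exact mem_runPart.2 ⟨hp, rfl⟩

-- With `k` runs: `120 k` for the median, `8 (k - 1)` for two cuts in each other run, `2 (k + 4)`
-- for finding `maxₗ` and `minᵣ` and cutting the own run there, and `8` for two more cuts in the own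
-- run if the pivot value is repeated. This is at most `130 k + 8 ≤ 138 k`; the remaining costs
-- telescope to the growth of `cellWeight`.
set_option maxHeartbeats 2000000 in
theorem exists_splitProgram (runOf : Fin n → ℕ) (S : Finset (Fin n)) :
    ∃ t : CompTree (Fin n) (List (Cell n)), ∀ (α : Type u) [LinearOrder α] (A : Fin n → α),
      RunsSorted A runOf → S.Nonempty → t.result A = splitCell A runOf S ∧
      (t.cost A : ℝ) ≤ 138 * (runsMeeting runOf S).card +
        (((splitCell A runOf S).map fun c => cellWeight runOf c.elts).sum - cellWeight runOf S) := by
  classical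
  by_cases hS : S.Nonempty
  swap
  · exact ⟨.done [], fun _ _ _ _ h => absurd h hS⟩
  obtain ⟨med, hmed⟩ := exists_medianProgram.{u} runOf hS
  choose oth hoth using exists_partitionOthers.{u} runOf S
  choose lowp hlow using exists_cutOwnLower.{u} runOf S
  choose upp hup using exists_cutOwnUpper.{u} runOf S
  choose lt hlt using exists_cutLT.{u} (n := n)
  choose le hle using exists_cutLE.{u} (n := n)
  refine ⟨med.bind fun μ => (oth μ ((runsMeeting runOf S).erase (runOf μ))).bind fun f =>
    (lowp μ fun r => (f r).1).bind fun low =>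
    (upp μ (fun r => (runPart runOf S r \ (f r).1) \ (f r).2)
      (runPart runOf S (runOf μ) \ low)).bind fun up =>
    -- Whether the pivot value occurs in another run is already known from the parts equal to the
    -- pivot.
    if ∃ r ∈ (runsMeeting runOf S).erase (runOf μ), (f r).2.Nonempty then
      (lt ((runPart runOf S (runOf μ) \ low) \ up) μ).bind fun m1 =>
      (le (((runPart runOf S (runOf μ) \ low) \ up) \ m1) μ).bind fun m2 =>
      .done (partitionCells
        (glue runOf S fun r => if r = runOf μ then low else (f r).1)
        (glue runOf S fun r => if r = runOf μ then up else
          (runPart runOf S r \ (f r).1) \ (f r).2)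
        [m1, glue runOf S fun r => if r = runOf μ then m2 else (f r).2,
          (((runPart runOf S (runOf μ) \ low) \ up) \ m1) \ m2])
    else .done (partitionCells
        (glue runOf S fun r => if r = runOf μ then low else (f r).1)
        (glue runOf S fun r => if r = runOf μ then up else
          (runPart runOf S r \ (f r).1) \ (f r).2)
        [(runPart runOf S (runOf μ) \ low) \ up]), ?_⟩
  intro α _ A hA _
  obtain ⟨m1, m2, m3⟩ := hmed α A
  set μ := med.result A with hμ
  have hμS : μ ∈ S := (Finset.mem_filter.1 m1).1
  rw [splitCell_eq (medianOfMiddles_eq_some m1 m2)]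
  have hpart := isPartitioning_split hA m1 m2
  set U := (runsMeeting runOf S).erase (runOf μ) with hU
  have hown : runOf μ ∈ runsMeeting runOf S := mem_runsMeeting.2 ⟨μ, hμS, rfl⟩
  have hsumU : ∀ g : ℕ → ℝ, ∑ r ∈ runsMeeting runOf S, g r = g (runOf μ) + ∑ r ∈ U, g r :=
    fun g => (Finset.add_sum_erase _ g hown).symm
  have hcardU : (U.card : ℝ) + 1 = (runsMeeting runOf S).card := by
    exact_mod_cast Finset.card_erase_add_one hown
  obtain ⟨o1, o2⟩ := hoth μ U α A hA
  set f := (oth μ U).result A with hf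
  have hf1 : ∀ r ∈ U, (f r).1 = (runPart runOf S r).filter fun p => A p < A μ := fun r hr => by
    rw [o1 r hr]
  have hf2 : ∀ r ∈ U, (f r).2 = (runPart runOf S r).filter fun p => A p = A μ := fun r hr => by
    rw [o1 r hr]
  have hf3 : ∀ r ∈ U, (runPart runOf S r \ (f r).1) \ (f r).2
      = (runPart runOf S r).filter fun p => A μ < A p := fun r hr => by
    rw [hf1 r hr, hf2 r hr]
    ext p
    simp only [Finset.mem_sdiff, Finset.mem_filter, not_and, not_lt]
    constructor
    · rintro ⟨⟨h, h'⟩, h''⟩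
      exact ⟨h, lt_of_le_of_ne (h' h) (Ne.symm (h'' h))⟩
    · rintro ⟨h, h'⟩
      exact ⟨⟨h, fun _ => h'.le⟩, fun _ => h'.ne'⟩
  have hUne : ∀ r ∈ U, r ≠ runOf μ := fun r hr => Finset.ne_of_mem_erase hr
  obtain ⟨l1, l2⟩ := hlow μ (fun r => (f r).1) α A hA hf1
  set low := (lowp μ fun r => (f r).1).result A with hlowdef
  have hLS : lowerPart A runOf S μ ⊆ S := Finset.filter_subset _ _
  have hRS : upperPart A runOf S μ ⊆ S := Finset.filter_subset _ _
  have hLR : ∀ p ∈ lowerPart A runOf S μ, p ∉ upperPart A runOf S μ := fun p hp hp' => by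
    obtain ⟨-, q, -, -, h3, h4⟩ := mem_lowerPart.1 hp
    obtain ⟨-, q', -, -, h3', h4'⟩ := mem_upperPart.1 hp'
    exact absurd ((h4.trans_lt h3).trans (h3'.trans_le h4')) (lt_irrefl _)
  obtain ⟨u1, u2⟩ := hup μ (fun r => (runPart runOf S r \ (f r).1) \ (f r).2)
    (runPart runOf S (runOf μ) \ low) α A hA hf3 Finset.sdiff_subset (by
      intro p hp
      obtain ⟨hp1, hp2⟩ := mem_runPart.1 hp
      rw [l1]
      exact Finset.mem_sdiff.2 ⟨mem_runPart.2 ⟨hRS hp1, hp2⟩,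
        fun h => hLR p (mem_runPart.1 h).1 hp1⟩)
  set up := (upp μ (fun r => (runPart runOf S r \ (f r).1) \ (f r).2)
    (runPart runOf S (runOf μ) \ low)).result A with hupdef
  set mid := (runPart runOf S (runOf μ) \ low) \ up with hmid
  have hgL : glue runOf S (fun r => if r = runOf μ then low else (f r).1)
      = lowerPart A runOf S μ := by
    refine glue_eq hLS fun r hr => ?_
    by_cases h : r = runOf μ
    · rw [if_pos h, h, l1]
    · rw [if_neg h, runPart_lowerPart_of_ne h, hf1 r (Finset.mem_erase.2 ⟨h, hr⟩)]
  have hgR : glue runOf S (fun r => if r = runOf μ then up else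
      (runPart runOf S r \ (f r).1) \ (f r).2) = upperPart A runOf S μ := by
    refine glue_eq hRS fun r hr => ?_
    by_cases h : r = runOf μ
    · rw [if_pos h, h, u1]
    · rw [if_neg h, runPart_upperPart_of_ne h, hf3 r (Finset.mem_erase.2 ⟨h, hr⟩)]
  have hmemmid : ∀ p, p ∈ mid ↔ runOf p = runOf μ ∧
      p ∈ S \ (lowerPart A runOf S μ ∪ upperPart A runOf S μ) := by
    intro p
    simp only [hmid, l1, u1, Finset.mem_sdiff, mem_runPart, Finset.mem_union]
    tauto
  have hmidsub : mid ⊆ runPart runOf S (runOf μ) := Finset.sdiff_subset.trans Finset.sdiff_subset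
  -- Newly identified elements of other runs have the value of the pivot, so the blocks beside the
  -- pivot blocks are made of the own run only.
  have hother : ∀ p ∈ S \ (lowerPart A runOf S μ ∪ upperPart A runOf S μ), A p ≠ A μ →
      runOf p = runOf μ := by
    intro p hp hne
    simp only [Finset.mem_sdiff, Finset.mem_union, not_or] at hp
    by_contra hr
    rcases lt_or_gt_of_ne hne with h | h
    · exact hp.2.1 (mem_lowerPart.2 ⟨hp.1, p, hp.1, hr, h, le_rfl⟩)
    · exact hp.2.2 (mem_upperPart.2 ⟨hp.1, p, hp.1, hr, h, le_rfl⟩)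
  have hownpart : ∀ T ⊆ mid, runPart runOf T (runOf μ) = T := fun T hT => by
    ext p
    rw [mem_runPart]
    exact ⟨fun h => h.1, fun h => ⟨h, ((hmemmid p).1 (hT h)).1⟩⟩
  have hotherpart : ∀ T ⊆ mid, ∀ r ∈ U, runPart runOf T r = ∅ := fun T hT r hr => by
    rw [Finset.eq_empty_iff_forall_notMem]
    intro p hp
    obtain ⟨h1, h2⟩ := mem_runPart.1 hp
    exact hUne r hr (h2 ▸ ((hmemmid p).1 (hT h1)).1)
  have hmidS : mid ⊆ S := fun p hp => (mem_runPart.1 (hmidsub hp)).1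
  have hwmid : ∀ T ⊆ mid, cellWeight runOf T = blockWeight T.card := fun T hT => by
    rw [cellWeight_eq_sum runOf (hT.trans hmidS), hsumU, hownpart T hT,
      Finset.sum_congr rfl fun r hr => by rw [hotherpart T hT r hr, Finset.card_empty,
        blockWeight_zero]]
    simp
  have hwL : cellWeight runOf (lowerPart A runOf S μ) = blockWeight low.card +
      ∑ r ∈ U, blockWeight ((runPart runOf S r).filter fun p => A p < A μ).card := by
    rw [cellWeight_eq_sum runOf hLS, hsumU, l1]
    exact congrArg _ (Finset.sum_congr rfl fun r hr => by rw [runPart_lowerPart_of_ne (hUne r hr)])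
  have hwR : cellWeight runOf (upperPart A runOf S μ) = blockWeight up.card +
      ∑ r ∈ U, blockWeight ((runPart runOf S r).filter fun p => A μ < A p).card := by
    rw [cellWeight_eq_sum runOf hRS, hsumU, u1]
    exact congrArg _ (Finset.sum_congr rfl fun r hr => by rw [runPart_upperPart_of_ne (hUne r hr)])
  have hwS : cellWeight runOf S = blockWeight (runPart runOf S (runOf μ)).card +
      ∑ r ∈ U, blockWeight (runPart runOf S r).card := by
    rw [cellWeight, hsumU]
  rw [Finset.sum_add_distrib, Finset.sum_sub_distrib, Finset.sum_add_distrib,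
    Finset.sum_add_distrib, Finset.sum_const, nsmul_eq_mul] at o2
  rw [← l1] at l2
  rw [← u1, ← hmid] at u2
  have m3' : (med.cost A : ℝ) ≤ 120 * (runsMeeting runOf S).card := by exact_mod_cast m3
  have hk : (1 : ℝ) ≤ (runsMeeting runOf S).card := by
    have : 0 ≤ (U.card : ℝ) := by positivity
    linarith
  have hmult : (∃ r ∈ U, (f r).2.Nonempty) ↔ ∃ p ∈ S, A p = A μ ∧ runOf p ≠ runOf μ := by
    constructor
    · rintro ⟨r, hr, p, hp⟩
      rw [hf2 r hr] at hp
      obtain ⟨h1, h2⟩ := Finset.mem_filter.1 hp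
      obtain ⟨h3, h4⟩ := mem_runPart.1 h1
      exact ⟨p, h3, h2, h4 ▸ hUne r hr⟩
    · rintro ⟨p, h1, h2, h3⟩
      have hr : runOf p ∈ U := Finset.mem_erase.2 ⟨h3, mem_runsMeeting.2 ⟨p, h1, rfl⟩⟩
      refine ⟨_, hr, p, ?_⟩
      rw [hf2 _ hr]
      exact Finset.mem_filter.2 ⟨mem_runPart.2 ⟨h1, rfl⟩, h2⟩
  rw [sum_partitionCells _ _ _ _ fun _ => cellWeight_empty runOf]
  simp only [CompTree.result_bind, CompTree.cost_bind, ← hμ, ← hU, ← hf, ← hlowdef, ← hupdef,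
    ← hmid, hgL, hgR, CompTree.result_ite, CompTree.cost_ite, CompTree.result_done,
    CompTree.cost_done, hwL, hwR, hwS]
  by_cases hm : ∃ r ∈ U, (f r).2.Nonempty
  · rw [if_pos hm, if_pos hm]
    obtain ⟨a1, a2⟩ := hlt mid μ α A (hA.runPart hmidsub)
    set b1 := mid.filter fun p => A p < A μ with hb1
    simp only [a1]
    obtain ⟨c1, c2⟩ := hle (mid \ b1) μ α A (hA.runPart (Finset.sdiff_subset.trans hmidsub))
    set b2 := (mid \ b1).filter fun p => A p ≤ A μ with hb2
    simp only [c1]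
    set B := S \ (lowerPart A runOf S μ ∪ upperPart A runOf S μ) with hB
    have e1 : B.filter (fun p => A p < A μ) = b1 := by
      ext p
      simp only [hb1, Finset.mem_filter, hmemmid p]
      exact ⟨fun h => ⟨⟨hother p h.1 h.2.ne, h.1⟩, h.2⟩, fun h => ⟨h.1.2, h.2⟩⟩
    have e3 : B.filter (fun p => A μ < A p) = (mid \ b1) \ b2 := by
      ext p
      simp only [hb2, hb1, Finset.mem_sdiff, Finset.mem_filter, hmemmid p, not_and, not_lt, not_le]
      constructor
      · rintro ⟨h1, h2⟩
        exact ⟨⟨⟨hother p h1 h2.ne', h1⟩, fun _ => h2.le⟩, fun _ => h2⟩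
      · rintro ⟨⟨h1, h2⟩, h3⟩
        exact ⟨h1.2, h3 ⟨h1, h2⟩⟩
    have hb2mem : ∀ p, p ∈ b2 ↔ p ∈ mid ∧ A p = A μ := by
      intro p
      simp only [hb2, hb1, Finset.mem_sdiff, Finset.mem_filter, not_and, not_lt]
      constructor
      · rintro ⟨⟨h1, h2⟩, h3⟩
        exact ⟨h1, le_antisymm h3 (h2 h1)⟩
      · rintro ⟨h1, h2⟩
        exact ⟨⟨h1, fun _ => h2.ge⟩, h2.le⟩
    have hBS : B.filter (fun p => A p = A μ) ⊆ S :=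
      (Finset.filter_subset _ _).trans Finset.sdiff_subset
    have hq1 : runPart runOf (B.filter fun p => A p = A μ) (runOf μ) = b2 := by
      ext p
      rw [mem_runPart, hb2mem, hmemmid, Finset.mem_filter]
      tauto
    have hq2 : ∀ r, runPart runOf (B.filter fun p => A p = A μ) r
        = (runPart runOf S r).filter fun p => A p = A μ := by
      intro r
      ext p
      simp only [mem_runPart, Finset.mem_filter, hB, Finset.mem_sdiff, Finset.mem_union, not_or]
      constructor
      · rintro ⟨⟨⟨h1, -⟩, h2⟩, h3⟩
        exact ⟨⟨h1, h3⟩, h2⟩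
      · rintro ⟨⟨h1, h3⟩, h2⟩
        refine ⟨⟨⟨h1, fun h => ?_, fun h => ?_⟩, h2⟩, h3⟩
        · obtain ⟨-, q, -, -, h4, h5⟩ := mem_lowerPart.1 h
          exact absurd (h5.trans_lt h4) (by rw [h2]; exact lt_irrefl _)
        · obtain ⟨-, q, -, -, h4, h5⟩ := mem_upperPart.1 h
          exact absurd (h4.trans_le h5) (by rw [h2]; exact lt_irrefl _)
    have e2 : glue runOf S (fun r => if r = runOf μ then b2 else (f r).2)
        = B.filter fun p => A p = A μ := by
      refine glue_eq hBS fun r hr => ?_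
      by_cases h : r = runOf μ
      · rw [if_pos h, h, hq1]
      · rw [if_neg h, hf2 r (Finset.mem_erase.2 ⟨h, hr⟩), hq2]
    have hnew : newBlocks A runOf S μ = [b1, B.filter fun p => A p = A μ, (mid \ b1) \ b2] := by
      rw [newBlocks, if_pos (hmult.1 hm), ← hB, e1, e3]
    have hwq : cellWeight runOf (B.filter fun p => A p = A μ) = blockWeight b2.card +
        ∑ r ∈ U, blockWeight ((runPart runOf S r).filter fun p => A p = A μ).card := by
      rw [cellWeight_eq_sum runOf hBS, hsumU, hq1]
      exact congrArg _ (Finset.sum_congr rfl fun r hr => by rw [hq2])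
    rw [e2, hnew]
    refine ⟨rfl, ?_⟩
    simp only [List.map_cons, List.map_nil, List.sum_cons, List.sum_nil, hwq]
    rw [hwmid b1 (Finset.filter_subset _ _),
      hwmid _ (Finset.sdiff_subset.trans Finset.sdiff_subset)]
    push_cast
    linarith
  · rw [if_neg hm, if_neg hm]
    have hnot : ¬ ∃ p ∈ S, A p = A μ ∧ runOf p ≠ runOf μ := fun h => hm (hmult.2 h)
    have hnew : newBlocks A runOf S μ = [mid] := by
      rw [newBlocks, if_neg hnot]
      congr 1
      ext p
      rw [hmemmid]
      refine ⟨fun h => ⟨?_, h⟩, fun h => h.2⟩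
      by_cases hne : A p = A μ
      · by_contra hr
        exact hnot ⟨p, (Finset.mem_sdiff.1 h).1, hne, hr⟩
      · exact hother p h hne
    have hz : ∑ r ∈ U, blockWeight ((runPart runOf S r).filter fun p => A p = A μ).card = 0 := by
      refine Finset.sum_eq_zero fun r hr => ?_
      rw [← hf2 r hr, Finset.not_nonempty_iff_eq_empty.1 fun h => hm ⟨r, hr, h⟩,
        Finset.card_empty, blockWeight_zero]
    rw [hnew]
    refine ⟨rfl, ?_⟩
    simp only [List.map_cons, List.map_nil, List.sum_cons, List.sum_nil]
    rw [hwmid mid subset_rfl]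
    push_cast
    linarith

end SplitProgram

/-! ### The invariant of the list of cells -/

section Invariant

variable {n : ℕ} {α : Type*} [LinearOrder α]

theorem exists_isPartitioning {A : Fin n → α} {runOf : Fin n → ℕ} (hrun : RunsSorted A runOf)
    {S : Finset (Fin n)} (hS : S.Nonempty) :
    ∃ L R Bs, splitCell A runOf S = partitionCells L R Bs ∧ IsPartitioning A runOf S L R Bs := by
  obtain ⟨μ, h1, h2⟩ := exists_median A runOf hS
  exact ⟨_, _, _, splitCell_eq (medianOfMiddles_eq_some h1 h2), isPartitioning_split hrun h1 h2⟩

theorem Below.mono {A : Fin n → α} {S S' T T' : Finset (Fin n)} (h : Below A S T) (hS : S' ⊆ S)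
    (hT : T' ⊆ T) : Below A S' T' := fun p hp p' hp' => h p (hS hp) p' (hT hp')

theorem Below.not_symm {A : Fin n → α} {S T : Finset (Fin n)} (h : Below A S T)
    (hS : S.Nonempty) (hT : T.Nonempty) : ¬ Below A T S := fun h' => by
  obtain ⟨p, hp⟩ := hS
  obtain ⟨p', hp'⟩ := hT
  exact lt_asymm (h p hp p' hp') (h' p' hp' p hp)

/-- What holds for the cells of every state. -/
structure CellsInv (A : Fin n → α) (cells : List (Cell n)) : Prop where
  nonempty : ∀ c ∈ cells, c.elts.Nonempty
  pairwise : cells.Pairwise fun c c' => Below A c.elts c'.elts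
  cover : ∀ p, ∃ c ∈ cells, p ∈ c.elts
  sorted : ∀ c ∈ cells, c.known = true → ∀ p ∈ c.elts, ∀ p' ∈ c.elts, p ≤ p' → A p ≤ A p'
  -- Without this, the place of a value among the identified blocks would not determine the unsorted
  -- cell into which it falls.
  separated : ∀ c ∈ cells, ∀ c' ∈ cells, c.known = false → c'.known = false →
    Below A c.elts c'.elts → ∃ m ∈ cells, m.known = true ∧ Below A c.elts m.elts ∧
      Below A m.elts c'.elts

/-- The list `l` of cells is a refinement of the cell `c`. -/
structure RefinesCell (A : Fin n → α) (c : Cell n) (l : List (Cell n)) : Prop where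
  known : c.known = true → l = [c]
  subset : ∀ d ∈ l, d.elts ⊆ c.elts
  nonempty : ∀ d ∈ l, d.elts.Nonempty
  pairwise : l.Pairwise fun d d' => Below A d.elts d'.elts
  cover : ∀ p ∈ c.elts, ∃ d ∈ l, p ∈ d.elts
  sorted : ∀ d ∈ l, d.known = true → ∀ p ∈ d.elts, ∀ p' ∈ d.elts, p ≤ p' → A p ≤ A p'
  separated : ∀ d ∈ l, ∀ d' ∈ l, d.known = false → d'.known = false →
    Below A d.elts d'.elts → ∃ m ∈ l, m.known = true ∧ Below A d.elts m.elts ∧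
      Below A m.elts d'.elts

theorem CellsInv.below_or {A : Fin n → α} {cells : List (Cell n)} (h : CellsInv A cells)
    {c c' : Cell n} (hc : c ∈ cells) (hc' : c' ∈ cells) :
    c = c' ∨ Below A c.elts c'.elts ∨ Below A c'.elts c.elts := by
  obtain ⟨i, hi, rfl⟩ := List.getElem_of_mem hc
  obtain ⟨j, hj, rfl⟩ := List.getElem_of_mem hc'
  have hp := List.pairwise_iff_getElem.1 h.pairwise
  rcases lt_trichotomy i j with hij | rfl | hij
  · exact Or.inr (Or.inl (hp i j hi hj hij))
  · exact Or.inl rfl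
  · exact Or.inr (Or.inr (hp j i hj hi hij))

theorem CellsInv.eq_of_mem {A : Fin n → α} {cells : List (Cell n)} (h : CellsInv A cells)
    {c c' : Cell n} (hc : c ∈ cells) (hc' : c' ∈ cells) {p p' : Fin n} (hp : p ∈ c.elts)
    (hp' : p' ∈ c'.elts) (hpp : A p = A p') : c = c' := by
  rcases h.below_or hc hc' with h1 | h1 | h1
  · exact h1
  · exact absurd (h1 p hp p' hp') (by rw [hpp]; exact lt_irrefl _)
  · exact absurd (h1 p' hp' p hp) (by rw [hpp]; exact lt_irrefl _)

theorem RefinesCell.self {A : Fin n → α} {cells : List (Cell n)} (h : CellsInv A cells)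
    {c : Cell n} (hc : c ∈ cells) : RefinesCell A c [c] where
  known _ := rfl
  subset d hd := by rw [List.mem_singleton.1 hd]
  nonempty d hd := by rw [List.mem_singleton.1 hd]; exact h.nonempty c hc
  pairwise := by simp
  cover p hp := ⟨c, List.mem_singleton_self c, hp⟩
  sorted d hd := by rw [List.mem_singleton.1 hd]; exact h.sorted c hc
  separated d hd d' hd' _ _ hb := by
    rw [List.mem_singleton.1 hd, List.mem_singleton.1 hd'] at hb
    exact absurd hb (hb.not_symm (h.nonempty c hc) (h.nonempty c hc))

theorem mem_partitionCells {L R : Finset (Fin n)} {Bs : List (Finset (Fin n))} {c : Cell n} :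
    c ∈ partitionCells L R Bs ↔ c.elts.Nonempty ∧
      (c = ⟨false, L⟩ ∨ (c.known = true ∧ c.elts ∈ Bs) ∨ c = ⟨false, R⟩) := by
  simp only [partitionCells, List.mem_filter, List.mem_cons, List.mem_append, List.mem_map,
    List.not_mem_nil, or_false, decide_eq_true_eq, and_comm]
  have : (∃ a, Cell.mk true a = c ∧ a ∈ Bs) ↔ c.elts ∈ Bs ∧ c.known = true := by
    obtain ⟨b, T⟩ := c
    simp only [Cell.mk.injEq]
    constructor
    · rintro ⟨a, ⟨rfl, rfl⟩, h⟩; exact ⟨h, rfl⟩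
    · rintro ⟨h, rfl⟩; exact ⟨T, ⟨rfl, rfl⟩, h⟩
  rw [this]
  tauto

/-- One of the new blocks is nonempty, and it separates the two smaller sub-instances. -/
theorem IsPartitioning.refinesCell {A : Fin n → α} {runOf : Fin n → ℕ} {S L R : Finset (Fin n)}
    {Bs : List (Finset (Fin n))} (h : IsPartitioning A runOf S L R Bs) :
    RefinesCell A ⟨false, S⟩ (partitionCells L R Bs) where
  known h := by cases h
  subset d hd := by
    obtain ⟨-, hd⟩ := mem_partitionCells.1 hd
    intro p hp
    refine (h.mem_iff p).2 ⟨d.elts, ?_, hp⟩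
    simp only [List.mem_cons, List.mem_append, List.not_mem_nil, or_false]
    rcases hd with rfl | ⟨-, hd⟩ | rfl
    exacts [Or.inl rfl, Or.inr (Or.inl hd), Or.inr (Or.inr rfl)]
  nonempty d hd := (mem_partitionCells.1 hd).1
  pairwise := by
    refine List.Pairwise.filter _ ?_
    have := h.pairwise
    simp only [List.pairwise_cons, List.pairwise_append, List.pairwise_map, List.mem_append,
      List.mem_map, List.mem_singleton] at this ⊢
    refine ⟨?_, this.2.1, by simp, ?_⟩
    · rintro c (⟨B, hB, rfl⟩ | rfl)
      exacts [this.1 B (Or.inl hB), this.1 R (Or.inr rfl)]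
    · rintro c ⟨B, hB, rfl⟩ c' rfl
      exact this.2.2.2 B hB R rfl
  cover p hp := by
    obtain ⟨T, hT, hpT⟩ := (h.mem_iff p).1 hp
    simp only [List.mem_cons, List.mem_append, List.not_mem_nil, or_false] at hT
    rcases hT with rfl | hT | rfl
    · exact ⟨⟨false, T⟩, mem_partitionCells.2 ⟨⟨p, hpT⟩, Or.inl rfl⟩, hpT⟩
    · exact ⟨⟨true, T⟩, mem_partitionCells.2 ⟨⟨p, hpT⟩, Or.inr (Or.inl ⟨rfl, hT⟩)⟩, hpT⟩
    · exact ⟨⟨false, T⟩, mem_partitionCells.2 ⟨⟨p, hpT⟩, Or.inr (Or.inr rfl)⟩, hpT⟩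
  sorted d hd hk := by
    obtain ⟨-, rfl | ⟨-, hd⟩ | rfl⟩ := mem_partitionCells.1 hd
    · cases hk
    · exact h.sorted _ hd
    · cases hk
  separated d hd d' hd' hk hk' hb := by
    have hne := (mem_partitionCells.1 hd).1
    have hne' := (mem_partitionCells.1 hd').1
    obtain ⟨B, hB, hBne⟩ := h.nonempty
    have := h.pairwise
    simp only [List.pairwise_cons, List.pairwise_append, List.mem_append,
      List.mem_singleton] at this
    have hLB := this.1 B (Or.inl hB)
    have hBR := this.2.2.2 B hB R rfl
    have hLR := this.1 R (Or.inr rfl)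
    have hm : (⟨true, B⟩ : Cell n) ∈ partitionCells L R Bs :=
      mem_partitionCells.2 ⟨hBne, Or.inr (Or.inl ⟨rfl, hB⟩)⟩
    obtain ⟨-, rfl | ⟨hd, -⟩ | rfl⟩ := mem_partitionCells.1 hd
    · obtain ⟨-, rfl | ⟨hd', -⟩ | rfl⟩ := mem_partitionCells.1 hd'
      · exact absurd hb (hb.not_symm hne hne)
      · rw [hd'] at hk'; cases hk'
      · exact ⟨_, hm, rfl, hLB, hBR⟩
    · rw [hd] at hk; cases hk
    · obtain ⟨-, rfl | ⟨hd', -⟩ | rfl⟩ := mem_partitionCells.1 hd'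
      · exact absurd hb (hLR.not_symm hne' hne)
      · rw [hd'] at hk'; cases hk'
      · exact absurd hb (hb.not_symm hne hne)

/-- Refinement is local: parts of different cells inherit their order, and identified cells stay as
they are, so that they still separate what they separated. -/
theorem CellsInv.flatMap {A : Fin n → α} {cells : List (Cell n)} (h : CellsInv A cells)
    {g : Cell n → List (Cell n)} (hg : ∀ c ∈ cells, RefinesCell A c (g c)) :
    CellsInv A (cells.flatMap g) where
  nonempty d hd := by
    obtain ⟨c, hc, hd⟩ := List.mem_flatMap.1 hd
    exact (hg c hc).nonempty d hd
  pairwise := by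
    rw [List.pairwise_flatMap]
    refine ⟨fun c hc => (hg c hc).pairwise, h.pairwise.imp_of_mem ?_⟩
    intro c c' hc hc' hb d hd d' hd'
    exact hb.mono ((hg c hc).subset d hd) ((hg c' hc').subset d' hd')
  cover p := by
    obtain ⟨c, hc, hp⟩ := h.cover p
    obtain ⟨d, hd, hpd⟩ := (hg c hc).cover p hp
    exact ⟨d, List.mem_flatMap.2 ⟨c, hc, hd⟩, hpd⟩
  sorted d hd := by
    obtain ⟨c, hc, hd⟩ := List.mem_flatMap.1 hd
    exact (hg c hc).sorted d hd
  separated d hd d' hd' hk hk' hb := by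
    obtain ⟨c, hc, hd⟩ := List.mem_flatMap.1 hd
    obtain ⟨c', hc', hd'⟩ := List.mem_flatMap.1 hd'
    have hck : ∀ e ∈ cells, ∀ x ∈ g e, x.known = false → e.known = false := fun e he x hx hxk => by
      by_contra hek
      rw [(hg e he).known (by simpa using hek), List.mem_singleton] at hx
      exact hek (hx ▸ hxk)
    rcases h.below_or hc hc' with rfl | h1 | h1
    · obtain ⟨m, hm, h2⟩ := (hg c hc).separated d hd d' hd' hk hk' hb
      exact ⟨m, List.mem_flatMap.2 ⟨c, hc, hm⟩, h2⟩
    · obtain ⟨m, hm, h2, h3, h4⟩ := h.separated c hc c' hc' (hck c hc d hd hk)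
        (hck c' hc' d' hd' hk') h1
      refine ⟨m, List.mem_flatMap.2 ⟨m, hm, ?_⟩, h2, h3.mono ((hg c hc).subset d hd) subset_rfl,
        h4.mono subset_rfl ((hg c' hc').subset d' hd')⟩
      rw [(hg m hm).known h2]
      exact List.mem_singleton_self m
    · exact absurd hb ((h1.mono ((hg c' hc').subset d' hd') ((hg c hc).subset d hd)).not_symm
        ((hg c' hc').nonempty d' hd') ((hg c hc).nonempty d hd))

theorem MustSplit.known_eq_false {A : Fin n → α} {cells : List (Cell n)} {q : Query n α}
    {c : Cell n} (h : MustSplit A cells q c) : c.known = false := by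
  cases q <;> exact h.1

theorem CellsInv.refinesCell_step {A : Fin n → α} {runOf : Fin n → ℕ} (hrun : RunsSorted A runOf)
    {cells : List (Cell n)} (h : CellsInv A cells) (q : Query n α) {c : Cell n} (hc : c ∈ cells) :
    RefinesCell A c (if MustSplit A cells q c then splitCell A runOf c.elts else [c]) := by
  split_ifs with hm
  · obtain ⟨L, R, Bs, h1, h2⟩ := exists_isPartitioning hrun (h.nonempty c hc)
    rw [h1]
    have := h2.refinesCell
    obtain ⟨b, T⟩ := c
    obtain rfl : b = false := hm.known_eq_false
    exact this
  · exact .self h hc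

theorem CellsInv.refineOnce {A : Fin n → α} {runOf : Fin n → ℕ} (hrun : RunsSorted A runOf)
    {cells : List (Cell n)} (h : CellsInv A cells) (q : Query n α) :
    CellsInv A (refineOnce A runOf q cells) :=
  h.flatMap fun _ hc => h.refinesCell_step hrun q hc

theorem CellsInv.iterate {A : Fin n → α} {runOf : Fin n → ℕ} (hrun : RunsSorted A runOf)
    {cells : List (Cell n)} (h : CellsInv A cells) (q : Query n α) (k : ℕ) :
    CellsInv A ((_root_.refineOnce A runOf q)^[k] cells) := by
  induction k generalizing cells with
  | zero => exact h
  | succ k ih => exact ih (h.refineOnce hrun q)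

theorem cellsInv_initial (A : Fin n → α) : CellsInv A (fsInitial A).cells := by
  by_cases hn : n = 0
  · subst hn
    exact ⟨by simp [fsInitial], by simp [fsInitial], fun p => p.elim0, by simp [fsInitial],
      by simp [fsInitial]⟩
  · have hne : (Finset.univ : Finset (Fin n)).Nonempty := ⟨⟨0, by omega⟩, Finset.mem_univ _⟩
    simp only [fsInitial, hn, if_false]
    refine ⟨by simpa using hne, by simp, fun p => ⟨_, List.mem_singleton_self _, Finset.mem_univ p⟩,
      by simp, ?_⟩
    intro c hc c' hc' _ _ hb
    rw [List.mem_singleton.1 hc, List.mem_singleton.1 hc'] at hb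
    exact absurd hb (hb.not_symm hne hne)

end Invariant

/-! ### The potential that pays for partitioning steps -/

section Potential

variable {n : ℕ} {α : Type*} [LinearOrder α]

/-- A run with half of its elements outside `Y` has some element outside `Y`, and so it meets `X` or
a new block. At least half of the runs are of this kind. -/
theorem IsPartitioning.card_half_le_lower {A : Fin n → α} {runOf : Fin n → ℕ}
    {S L R : Finset (Fin n)} {Bs : List (Finset (Fin n))} (h : IsPartitioning A runOf S L R Bs)
    {X Y : Finset (Fin n)} (hXY : (X = L ∧ Y = R) ∨ (X = R ∧ Y = L)) :
    (runsMeeting runOf S).card ≤ 2 * ((runsMeeting runOf X).card +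
      (Bs.map fun B => (runsMeeting runOf B).card).sum) := by
  have hH : ∃ H ⊆ runsMeeting runOf S, (runsMeeting runOf S).card ≤ 2 * H.card ∧
      ∀ r ∈ H, (runPart runOf S r).card ≤ 2 * (runPart runOf S r \ Y).card := by
    rcases hXY with ⟨-, rfl⟩ | ⟨-, rfl⟩
    exacts [h.lower, h.upper]
  obtain ⟨H, hHS, hc, hr⟩ := hH
  have hsub : H ⊆ runsMeeting runOf X ∪ (Bs.toFinset.biUnion fun B => runsMeeting runOf B) := by
    intro r hrH
    obtain ⟨p, hp, hpr⟩ := mem_runsMeeting.1 (hHS hrH)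
    have hpos : 0 < (runPart runOf S r).card := Finset.card_pos.2 ⟨p, mem_runPart.2 ⟨hp, hpr⟩⟩
    have := hr r hrH
    obtain ⟨x, hx⟩ := Finset.card_pos.1 (by omega : 0 < (runPart runOf S r \ Y).card)
    obtain ⟨hx1, hx2⟩ := Finset.mem_sdiff.1 hx
    obtain ⟨hxS, hxr⟩ := mem_runPart.1 hx1
    obtain ⟨T, hT, hxT⟩ := (h.mem_iff x).1 hxS
    simp only [List.mem_cons, List.mem_append, List.not_mem_nil, or_false] at hT
    simp only [Finset.mem_union, Finset.mem_biUnion, List.mem_toFinset]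
    have hT' : T = X ∨ T ∈ Bs := by
      rcases hXY with ⟨rfl, rfl⟩ | ⟨rfl, rfl⟩ <;> rcases hT with rfl | hT | rfl
      exacts [Or.inl rfl, Or.inr hT, absurd hxT hx2, absurd hxT hx2, Or.inr hT, Or.inl rfl]
    rcases hT' with rfl | hT'
    exacts [Or.inl (mem_runsMeeting.2 ⟨x, hxT, hxr⟩),
      Or.inr ⟨T, hT', mem_runsMeeting.2 ⟨x, hxT, hxr⟩⟩]
  have h1 := (Finset.card_le_card hsub).trans (Finset.card_union_le _ _)
  have h2 : (Bs.toFinset.biUnion fun B => runsMeeting runOf B).card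
      ≤ (Bs.map fun B => (runsMeeting runOf B).card).sum := by
    clear * -
    induction Bs with
    | nil => simp
    | cons B Bs ih =>
      rw [List.toFinset_cons, Finset.biUnion_insert, List.map_cons, List.sum_cons]
      exact (Finset.card_union_le _ _).trans (Nat.add_le_add_left ih _)
  omega

theorem IsPartitioning.card_le_sum {A : Fin n → α} {runOf : Fin n → ℕ}
    {S L R : Finset (Fin n)} {Bs : List (Finset (Fin n))} (h : IsPartitioning A runOf S L R Bs) :
    (runsMeeting runOf S).card ≤ (runsMeeting runOf L).card + (runsMeeting runOf R).card +
      (Bs.map fun B => (runsMeeting runOf B).card).sum := by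
  have hsub : runsMeeting runOf S ⊆ (runsMeeting runOf L ∪ runsMeeting runOf R) ∪
      (Bs.toFinset.biUnion fun B => runsMeeting runOf B) := by
    intro r hr
    obtain ⟨x, hxS, hxr⟩ := mem_runsMeeting.1 hr
    obtain ⟨T, hT, hxT⟩ := (h.mem_iff x).1 hxS
    simp only [List.mem_cons, List.mem_append, List.not_mem_nil, or_false] at hT
    simp only [Finset.mem_union, Finset.mem_biUnion, List.mem_toFinset]
    have hm : r ∈ runsMeeting runOf T := mem_runsMeeting.2 ⟨x, hxT, hxr⟩
    rcases hT with rfl | hT | rfl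
    exacts [Or.inl (Or.inl hm), Or.inr ⟨T, hT, hm⟩, Or.inl (Or.inr hm)]
  have h1 := (Finset.card_le_card hsub).trans (Finset.card_union_le _ _)
  have h3 := Finset.card_union_le (runsMeeting runOf L) (runsMeeting runOf R)
  have h2 : (Bs.toFinset.biUnion fun B => runsMeeting runOf B).card
      ≤ (Bs.map fun B => (runsMeeting runOf B).card).sum := by
    clear * -
    induction Bs with
    | nil => simp
    | cons B Bs ih =>
      rw [List.toFinset_cons, Finset.biUnion_insert, List.map_cons, List.sum_cons]
      exact (Finset.card_union_le _ _).trans (Nat.add_le_add_left ih _)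
  omega

theorem IsPartitioning.subset {A : Fin n → α} {runOf : Fin n → ℕ}
    {S L R : Finset (Fin n)} {Bs : List (Finset (Fin n))} (h : IsPartitioning A runOf S L R Bs) :
    L ⊆ S ∧ R ⊆ S ∧ ∀ B ∈ Bs, B ⊆ S :=
  ⟨fun p hp => (h.mem_iff p).2 ⟨L, by simp, hp⟩, fun p hp => (h.mem_iff p).2 ⟨R, by simp, hp⟩,
    fun B hB p hp => (h.mem_iff p).2 ⟨B, by simp [hB], hp⟩⟩

/-- The excess `k log ρ - k log k` of a cell that meets `k` of `ρ` runs. -/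
noncomputable def runEntropy (ρ k : ℕ) : ℝ := k * Real.logb 2 ρ - xlogx k

theorem xlogx_le {k m : ℕ} (h : k ≤ m) : xlogx k ≤ k * Real.logb 2 m := by
  rcases Nat.eq_zero_or_pos k with rfl | hk
  · simp [xlogx]
  · refine mul_le_mul_of_nonneg_left ?_ (by positivity)
    exact Real.logb_le_logb_of_le (by norm_num) (by exact_mod_cast hk) (by exact_mod_cast h)

theorem runEntropy_nonneg {ρ k : ℕ} (h : k ≤ ρ) : 0 ≤ runEntropy ρ k := by
  have := xlogx_le h
  unfold runEntropy
  linarith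

/-- Because `2 ≤ (4 / 3) ^ 3`. -/
theorem logb_four_thirds : (1 : ℝ) / 3 ≤ Real.logb 2 (4 / 3) := by
  rw [Real.le_logb_iff_rpow_le (by norm_num) (by norm_num)]
  have : ((2 : ℝ) ^ (1 / 3 : ℝ)) ^ 3 ≤ (4 / 3) ^ 3 := by
    rw [← Real.rpow_natCast, ← Real.rpow_mul (by norm_num)]
    norm_num
  exact le_of_pow_le_pow_left₀ (by norm_num) (by norm_num) this

/-- Either many runs are split, or many blocks are identified, or the entropy grows. -/
theorem IsPartitioning.charge {A : Fin n → α} {runOf : Fin n → ℕ}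
    {S L R : Finset (Fin n)} {Bs : List (Finset (Fin n))} (h : IsPartitioning A runOf S L R Bs)
    {ρ : ℕ} (hρ : (runsMeeting runOf S).card ≤ ρ) (hS : S.Nonempty) :
    ((runsMeeting runOf S).card : ℝ) ≤ 8 *
      ((((runsMeeting runOf L).card + (runsMeeting runOf R).card +
        (Bs.map fun B => ((runsMeeting runOf B).card : ℝ)).sum - (runsMeeting runOf S).card)) +
        (Bs.map fun B => ((runsMeeting runOf B).card : ℝ)).sum +
        (runEntropy ρ (runsMeeting runOf L).card + runEntropy ρ (runsMeeting runOf R).card +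
          (Bs.map fun B => runEntropy ρ (runsMeeting runOf B).card).sum
          - runEntropy ρ (runsMeeting runOf S).card)) := by
  obtain ⟨hLS, hRS, hBS⟩ := h.subset
  have c1 := h.card_half_le_lower (Or.inl ⟨rfl, rfl⟩)
  have c2 := h.card_half_le_lower (Or.inr ⟨rfl, rfl⟩)
  have c3 := h.card_le_sum
  have hkL := Finset.card_le_card (runsMeeting_mono runOf hLS)
  have hkR := Finset.card_le_card (runsMeeting_mono runOf hRS)
  have hk0 : 0 < (runsMeeting runOf S).card := Finset.card_pos.2 (hS.image _)
  set k := (runsMeeting runOf S).card with hk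
  set kL := (runsMeeting runOf L).card
  set kR := (runsMeeting runOf R).card
  have hcast : ((Bs.map fun B => (runsMeeting runOf B).card).sum : ℝ)
      = (Bs.map fun B => ((runsMeeting runOf B).card : ℝ)).sum := by
    rw [Nat.cast_list_sum, List.map_map]; rfl
  set b : ℝ := (Bs.map fun B => ((runsMeeting runOf B).card : ℝ)).sum with hb
  have hb0 : 0 ≤ b := by rw [← hcast]; positivity
  have hE : b * (Real.logb 2 ρ - Real.logb 2 k)
      ≤ (Bs.map fun B => runEntropy ρ (runsMeeting runOf B).card).sum := by
    rw [hb, ← List.sum_map_mul_right]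
    refine List.sum_le_sum fun B hB => ?_
    have := xlogx_le (Finset.card_le_card (runsMeeting_mono runOf (hBS B hB)))
    unfold runEntropy
    rw [mul_sub]
    linarith
  have r1 : (k : ℝ) ≤ 2 * (kL + b) := by rw [← hcast]; exact_mod_cast c1
  have r2 : (k : ℝ) ≤ 2 * (kR + b) := by rw [← hcast]; exact_mod_cast c2
  have r3 : (k : ℝ) ≤ kL + kR + b := by rw [← hcast]; exact_mod_cast c3
  have hL := xlogx_le hkL
  have hR := xlogx_le hkR
  have hlog : 0 ≤ Real.logb 2 ρ - Real.logb 2 k := sub_nonneg.2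
    (Real.logb_le_logb_of_le (by norm_num) (by exact_mod_cast hk0) (by exact_mod_cast hρ))
  -- Since `k ≤ kL + kR + b`, the contribution of `log ρ - log k` to the growth is nonnegative. So
  -- `ρ` may be replaced by `k`, and the new blocks may be left out.
  have hΔ : ((kL : ℝ) * Real.logb 2 k - xlogx kL) + (kR * Real.logb 2 k - xlogx kR)
      ≤ runEntropy ρ kL + runEntropy ρ kR +
        (Bs.map fun B => runEntropy ρ (runsMeeting runOf B).card).sum - runEntropy ρ k := by
    have hp := mul_nonneg (sub_nonneg.2 r3) hlog
    have hx : xlogx k = k * Real.logb 2 k := rfl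
    unfold runEntropy at hE ⊢
    rw [hx]
    nlinarith
  have hk0' : (0 : ℝ) < k := by exact_mod_cast hk0
  -- The three summands are nonnegative, so it is enough that one of them is at least `k / 8`. If
  -- the first two are not, then `3 k / 8 ≤ kL ≤ 3 k / 4`, and the lower part alone gains `kL log (k
  -- / kL) ≥ (3 k / 8) * (1 / 3)`.
  by_cases hc1 : (k : ℝ) ≤ 8 * b
  · linarith
  by_cases hc2 : (k : ℝ) ≤ 8 * (kL + kR + b - k)
  · linarith
  push Not at hc1 hc2
  have hkL1 : (3 / 8 : ℝ) * k ≤ kL := by linarith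
  have hkL2 : (kL : ℝ) ≤ 3 / 4 * k := by linarith
  have hkLpos : (0 : ℝ) < kL := by linarith
  have hlogs : Real.logb 2 (4 / 3) ≤ Real.logb 2 k - Real.logb 2 kL := by
    rw [← Real.logb_div hk0'.ne' hkLpos.ne']
    refine Real.logb_le_logb_of_le (by norm_num) (by norm_num) ?_
    rw [le_div_iff₀ hkLpos]
    linarith
  have h13 := logb_four_thirds.trans hlogs
  have hfin : (k : ℝ) / 8 ≤ kL * Real.logb 2 k - xlogx kL := by
    unfold xlogx
    rw [← mul_sub]
    calc (k : ℝ) / 8 = (3 / 8 * k) * (1 / 3) := by ring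
      _ ≤ _ := mul_le_mul hkL1 h13 (by norm_num) hkLpos.le
  linarith

/-- The potential of a cell. -/
noncomputable def cellPotential (runOf : Fin n → ℕ) (ρ : ℕ) (c : Cell n) : ℝ :=
  -- `1200 = 8 * 150`: the factor of `IsPartitioning.charge` times the cost per run allowed to a
  -- step.
  cellWeight runOf c.elts + 1200 * ((runsMeeting runOf c.elts).card +
    (if c.known = true then ((runsMeeting runOf c.elts).card : ℝ) else 0) +
    runEntropy ρ (runsMeeting runOf c.elts).card)

noncomputable def potential (runOf : Fin n → ℕ) (ρ : ℕ) (cells : List (Cell n)) : ℝ :=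
  (cells.map (cellPotential runOf ρ)).sum

/-- Of the `150` per run, `138` pay for the partitioning step; the rest pays for finding the place
of a `rank` query again afterwards. -/
theorem cost_le_potential_split {A : Fin n → α} {runOf : Fin n → ℕ} (hrun : RunsSorted A runOf)
    {S : Finset (Fin n)} {ρ : ℕ} (hρ : (runsMeeting runOf S).card ≤ ρ) (hS : S.Nonempty) :
    150 * ((runsMeeting runOf S).card : ℝ) +
      (((splitCell A runOf S).map fun c => cellWeight runOf c.elts).sum - cellWeight runOf S)
    ≤ potential runOf ρ (splitCell A runOf S) - cellPotential runOf ρ ⟨false, S⟩ := by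
  obtain ⟨L, R, Bs, h1, h2⟩ := exists_isPartitioning hrun hS
  have hc := h2.charge hρ hS
  have h0 : (runsMeeting runOf (∅ : Finset (Fin n))).card = 0 := by simp [runsMeeting]
  rw [potential, h1, sum_partitionCells _ _ _ _ fun _ => cellWeight_empty runOf,
    sum_partitionCells _ _ _ _ fun b => by
      simp [cellPotential, cellWeight_empty, h0, runEntropy, xlogx]]
  have hB : (Bs.map fun B => cellPotential runOf ρ ⟨true, B⟩).sum
      = (Bs.map fun B => cellWeight runOf B).sum + 1200 *
        ((Bs.map fun B => ((runsMeeting runOf B).card : ℝ)).sum +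
        (Bs.map fun B => ((runsMeeting runOf B).card : ℝ)).sum +
        (Bs.map fun B => runEntropy ρ (runsMeeting runOf B).card).sum) := by
    clear * -
    induction Bs with
    | nil => simp
    | cons B Bs ih =>
      rw [List.map_cons, List.sum_cons, ih]
      simp only [List.map_cons, List.sum_cons, cellPotential, if_true]
      ring
  rw [hB]
  simp only [cellPotential, Bool.false_eq_true, if_false]
  linarith

end Potential

/-! ### Which cell a query splits -/

section Refinement

variable {n : ℕ} {α : Type*} [LinearOrder α]

/-- The positions in a list of cells. -/
def allElts (l : List (Cell n)) : Finset (Fin n) :=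
  Finset.univ.filter fun p => ∃ c ∈ l, p ∈ c.elts

theorem mem_allElts {l : List (Cell n)} {p : Fin n} : p ∈ allElts l ↔ ∃ c ∈ l, p ∈ c.elts := by
  simp [allElts]

theorem card_allElts {A : Fin n → α} {l : List (Cell n)}
    (h : l.Pairwise fun c c' => Below A c.elts c'.elts) :
    (allElts l).card = (l.map fun c => c.elts.card).sum := by
  induction l with
  | nil => simp [allElts]
  | cons c l ih =>
    rw [List.pairwise_cons] at h
    have : allElts (c :: l) = c.elts ∪ allElts l := by
      ext p; simp [mem_allElts]
    rw [this, Finset.card_union_of_disjoint, ih h.2]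
    · simp
    · refine Finset.disjoint_left.2 fun p hp hp' => ?_
      obtain ⟨d, hd, hpd⟩ := mem_allElts.1 hp'
      exact lt_irrefl _ (h.1 d hd p hp p hpd)

theorem CellsInv.allElts_eq {A : Fin n → α} {cells : List (Cell n)} (h : CellsInv A cells) :
    allElts cells = Finset.univ :=
  Finset.eq_univ_iff_forall.2 fun p => mem_allElts.2 (h.cover p)

theorem CellsInv.sum_card {A : Fin n → α} {cells : List (Cell n)} (h : CellsInv A cells) :
    (cells.map fun c => c.elts.card).sum = n := by
  rw [← card_allElts h.pairwise, h.allElts_eq, Finset.card_univ, Fintype.card_fin]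

theorem refineOnce_eq_self {A : Fin n → α} {runOf : Fin n → ℕ} {q : Query n α}
    {cells : List (Cell n)} (h : ∀ c ∈ cells, ¬ MustSplit A cells q c) :
    refineOnce A runOf q cells = cells := by
  unfold refineOnce
  rw [List.flatMap_congr fun c hc => if_neg (h c hc)]
  simp

theorem refineOnce_eq_append {A : Fin n → α} {runOf : Fin n → ℕ} {q : Query n α}
    {b rest : List (Cell n)} {c : Cell n} (hb : ∀ d ∈ b, ¬ MustSplit A (b ++ c :: rest) q d)
    (hc : MustSplit A (b ++ c :: rest) q c)
    (hr : ∀ d ∈ rest, ¬ MustSplit A (b ++ c :: rest) q d) :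
    refineOnce A runOf q (b ++ c :: rest) = b ++ (splitCell A runOf c.elts ++ rest) := by
  unfold refineOnce
  rw [List.flatMap_append, List.flatMap_cons, if_pos hc,
    List.flatMap_congr fun d hd => if_neg (hb d hd),
    List.flatMap_congr fun d hd => if_neg (hr d hd)]
  simp

/-- The positions in unsorted cells. -/
def unsortedElts (l : List (Cell n)) : Finset (Fin n) :=
  Finset.univ.filter fun p => ∃ c ∈ l, c.known = false ∧ p ∈ c.elts

/-- The elements of a nonempty new block cease to be unsorted, and identified elements stay
identified. -/
theorem card_unsortedElts_refineOnce_lt {A : Fin n → α} {runOf : Fin n → ℕ}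
    (hrun : RunsSorted A runOf) {q : Query n α} {cells : List (Cell n)} (h : CellsInv A cells)
    {c : Cell n} (hc : c ∈ cells) (hm : MustSplit A cells q c) :
    (unsortedElts (refineOnce A runOf q cells)).card < (unsortedElts cells).card := by
  obtain ⟨L, R, Bs, h1, h2⟩ := exists_isPartitioning hrun (h.nonempty c hc)
  obtain ⟨B, hB, p, hp⟩ := h2.nonempty
  have hBm : (⟨true, B⟩ : Cell n) ∈ refineOnce A runOf q cells := by
    refine List.mem_flatMap.2 ⟨c, hc, ?_⟩
    rw [if_pos hm, h1]
    exact mem_partitionCells.2 ⟨⟨p, hp⟩, Or.inr (Or.inl ⟨rfl, hB⟩)⟩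
  refine Finset.card_lt_card (Finset.ssubset_iff_of_subset (fun x hx => ?_) |>.2 ⟨p, ?_, ?_⟩)
  · obtain ⟨d, hd, hk, hxd⟩ := (Finset.mem_filter.1 hx).2
    obtain ⟨e, he, hde⟩ := List.mem_flatMap.1 hd
    have hr := h.refinesCell_step hrun q he
    refine Finset.mem_filter.2 ⟨Finset.mem_univ _, e, he, ?_, hr.subset d hde hxd⟩
    by_contra hek
    rw [hr.known (by simpa using hek), List.mem_singleton] at hde
    exact hek (hde ▸ hk)
  · exact Finset.mem_filter.2 ⟨Finset.mem_univ _, c, hc, hm.known_eq_false, h2.subset.2.2 B hB hp⟩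
  · intro hx
    obtain ⟨d, hd, hk, hxd⟩ := (Finset.mem_filter.1 hx).2
    have := (h.refineOnce hrun q).eq_of_mem hd hBm hxd hp rfl
    rw [this] at hk
    cases hk

/-- A round either identifies an element or changes nothing, and in the second case no cell has to
be split and later rounds change nothing either. -/
theorem not_mustSplit_iterate {A : Fin n → α} {runOf : Fin n → ℕ}
    (hrun : RunsSorted A runOf) (q : Query n α) {cells : List (Cell n)} (h : CellsInv A cells)
    (m : ℕ) (hm : (unsortedElts cells).card ≤ m) :
    ∀ c ∈ (refineOnce A runOf q)^[m] cells,
      ¬ MustSplit A ((refineOnce A runOf q)^[m] cells) q c := by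
  induction m generalizing cells with
  | zero =>
    intro c hc hs
    obtain ⟨p, hp⟩ := h.nonempty c hc
    have : p ∈ unsortedElts cells :=
      Finset.mem_filter.2 ⟨Finset.mem_univ _, c, hc, hs.known_eq_false, hp⟩
    have := Finset.card_pos.2 ⟨p, this⟩
    omega
  | succ m ih =>
    by_cases hex : ∃ c ∈ cells, MustSplit A cells q c
    · obtain ⟨c, hc, hs⟩ := hex
      have := card_unsortedElts_refineOnce_lt hrun h hc hs
      exact ih (h.refineOnce hrun q) (by omega)
    · push Not at hex
      rw [Function.iterate_fixed (refineOnce_eq_self hex)]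
      exact hex

theorem not_mustSplit_fsServe {A : Fin n → α} {s : FSState n} (hrun : RunsSorted A s.runOf)
    (h : CellsInv A s.cells) (q : Query n α) :
    ∀ c ∈ (fsServe A s q).cells, ¬ MustSplit A (fsServe A s q).cells q c :=
  not_mustSplit_iterate hrun q h n ((Finset.card_le_univ _).trans (by simp))

/-! #### Where a `rank` query falls -/

theorem IsPred.eq {A : Fin n → α} {x : α} {p p' : Fin n} (h : IsPred A x p) (h' : IsPred A x p') :
    A p = A p' := le_antisymm (h'.2 p h.1) (h.2 p' h'.1)

/-- The number of identified blocks whose elements are all smaller than `x`. -/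
def lowCount (A : Fin n → α) (x : α) (cells : List (Cell n)) : ℕ :=
  cells.countP fun c => c.known && decide (∀ p ∈ c.elts, A p < x)

/-- Cut a list of cells after the `t`-th identified block. -/
def cutAt : ℕ → List (Cell n) → List (Cell n) × List (Cell n)
  -- An unsorted cell directly after the `t`-th identified block heads the second list: it is the
  -- one into which the query value may fall.
  | 0, l => ([], l)
  | _ + 1, [] => ([], [])
  | t + 1, c :: l =>
    if c.known = true then (c :: (cutAt t l).1, (cutAt t l).2)
    else (c :: (cutAt (t + 1) l).1, (cutAt (t + 1) l).2)

/-- The cells `b` are below `x`, and the next identified block after them is not. -/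
structure Located (A : Fin n → α) (x : α) (b a : List (Cell n)) : Prop where
  low : ∀ c ∈ b, c.known = true → ∀ p ∈ c.elts, A p < x
  high : ∀ c ∈ a, c.known = true → ∃ p ∈ c.elts, x ≤ A p
  last : ∀ c ∈ b, c.known = false → ∃ m ∈ b, m.known = true ∧ Below A c.elts m.elts

theorem cutAt_append (t : ℕ) (l : List (Cell n)) : (cutAt t l).1 ++ (cutAt t l).2 = l := by
  induction l generalizing t with
  | nil => cases t <;> rfl
  | cons c l ih =>
    cases t with
    | zero => rfl
    | succ t =>
      unfold cutAt
      split_ifs <;> simp [ih]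

/-- The identified blocks below `x` come first among all identified blocks, and `lowCount` counts
them. The cut is placed directly after the last one, so every unsorted cell before the cut is
followed by an identified one before the cut. -/
theorem located_cutAt {A : Fin n → α} {x : α} {l : List (Cell n)}
    (hne : ∀ c ∈ l, c.elts.Nonempty) (hp : l.Pairwise fun c c' => Below A c.elts c'.elts) :
    Located A x (cutAt (lowCount A x l) l).1 (cutAt (lowCount A x l) l).2 := by
  induction l with
  | nil => exact ⟨by simp [lowCount, cutAt], by simp [lowCount, cutAt], by simp [lowCount, cutAt]⟩
  | cons c l ih =>
    have hp' := List.pairwise_cons.1 hp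
    have ih := ih (fun d hd => hne d (List.mem_cons_of_mem _ hd)) hp'.2
    by_cases h0 : lowCount A x (c :: l) = 0
    · rw [h0]
      refine ⟨by simp [cutAt], ?_, by simp [cutAt]⟩
      intro d hd hk
      have := List.countP_eq_zero.1 h0 d hd
      simpa [hk] using this
    · have hpos := Nat.pos_of_ne_zero h0
      obtain ⟨d, hd, hdl⟩ := List.countP_pos_iff.1 hpos
      simp only [Bool.and_eq_true, decide_eq_true_eq] at hdl
      by_cases hk : c.known = true
      · have hlow : ∀ p ∈ c.elts, A p < x := by
          rcases List.mem_cons.1 hd with rfl | hd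
          · exact hdl.2
          · obtain ⟨y, hy⟩ := hne d (List.mem_cons_of_mem _ hd)
            exact fun p hp => (hp'.1 d hd p hp y hy).trans (hdl.2 y hy)
        have hcount : lowCount A x (c :: l) = lowCount A x l + 1 := by
          unfold lowCount
          rw [List.countP_cons_of_pos]
          simpa [hk] using hlow
        rw [hcount]
        simp only [cutAt, hk, if_true]
        refine ⟨?_, ih.high, ?_⟩
        · intro e he hek
          rcases List.mem_cons.1 he with rfl | he
          exacts [hlow, ih.low e he hek]
        · intro e he hek
          rcases List.mem_cons.1 he with rfl | he
          · rw [hk] at hek; cases hek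
          · obtain ⟨m, hm, h⟩ := ih.last e he hek
            exact ⟨m, List.mem_cons_of_mem _ hm, h⟩
      · have hcount : lowCount A x (c :: l) = lowCount A x l := by
          unfold lowCount
          rw [List.countP_cons_of_neg]
          simp [hk]
        have hdl' : d ∈ l := by
          rcases List.mem_cons.1 hd with rfl | hd
          exacts [absurd hdl.1 hk, hd]
        rw [hcount] at h0 ⊢
        obtain ⟨t, ht⟩ := Nat.exists_eq_succ_of_ne_zero h0
        rw [ht] at ih ⊢
        simp only [cutAt, hk]
        have hdb : d ∈ (cutAt (t + 1) l).1 := by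
          rw [← cutAt_append (t + 1) l] at hdl'
          rcases List.mem_append.1 hdl' with h | h
          · exact h
          · obtain ⟨p, hp, hle⟩ := ih.high d h hdl.1
            exact absurd (hdl.2 p hp) (not_lt.2 hle)
        refine ⟨?_, ih.high, ?_⟩
        · intro e he hek
          rcases List.mem_cons.1 he with rfl | he
          exacts [absurd hek hk, ih.low e he hek]
        · intro e he hek
          rcases List.mem_cons.1 he with rfl | he
          · refine ⟨d, List.mem_cons_of_mem _ hdb, hdl.1, hp'.1 d ?_⟩
            rw [← cutAt_append (t + 1) l]
            exact List.mem_append_left _ hdb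
          · obtain ⟨m, hm, h⟩ := ih.last e he hek
            exact ⟨m, List.mem_cons_of_mem _ hm, h⟩

theorem Located.lt {A : Fin n → α} {x : α} {b a : List (Cell n)} (h : Located A x b a)
    (hne : ∀ c ∈ b, c.elts.Nonempty) {c : Cell n} (hc : c ∈ b) : ∀ p ∈ c.elts, A p < x := by
  intro p hp
  by_cases hk : c.known = true
  · exact h.low c hc hk p hp
  · obtain ⟨m, hm, hmk, hb⟩ := h.last c hc (by simpa using hk)
    obtain ⟨y, hy⟩ := hne m hm
    exact (hb p hp y hy).trans (h.low m hm hmk y hy)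

theorem Located.gt {A : Fin n → α} {x : α} {b a : List (Cell n)} (h : Located A x b a)
    (hcov : ¬ Covered A (b ++ a) x) {c : Cell n} (hc : c ∈ a) (hk : c.known = true) :
    ∀ p ∈ c.elts, x < A p := by
  intro p hp
  by_contra hle
  exact hcov ⟨c, List.mem_append_right _ hc, hk, ⟨p, hp, not_lt.1 hle⟩, h.high c hc hk⟩

/-- All cells after the first one in the upper part are above `x`. -/
theorem Located.gt_of_tail {A : Fin n → α} {x : α} {b rest : List (Cell n)} {c : Cell n}
    (h : Located A x b (c :: rest)) (hinv : CellsInv A (b ++ c :: rest))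
    (hcov : ¬ Covered A (b ++ c :: rest) x) {d : Cell n} (hd : d ∈ rest) :
    ∀ p ∈ d.elts, x < A p := by
  have hpw := List.pairwise_append.1 hinv.pairwise
  have hcr := List.pairwise_cons.1 hpw.2.1
  have hcm : c ∈ b ++ c :: rest := by simp
  have hdm : d ∈ b ++ c :: rest := by simp [hd]
  obtain ⟨y, hy⟩ := hinv.nonempty c hcm
  intro p hp
  by_cases hk : d.known = true
  · exact h.gt hcov (List.mem_cons_of_mem _ hd) hk p hp
  by_cases hck : c.known = true
  · exact (h.gt hcov List.mem_cons_self hck y hy).trans (hcr.1 d hd y hy p hp)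
  -- Two unsorted cells have an identified block between them; it comes after the cut and, as `x` is
  -- not covered, it is above `x`.
  · obtain ⟨m, hm, hmk, hcm', hmd⟩ := hinv.separated c hcm d hdm (by simpa using hck)
      (by simpa using hk) (hcr.1 d hd)
    have hmr : m ∈ c :: rest := by
      rcases List.mem_append.1 hm with hmb | hmb
      · exact absurd (hpw.2.2 m hmb c List.mem_cons_self)
          (hcm'.not_symm ⟨y, hy⟩ (hinv.nonempty m hm))
      · exact hmb
    obtain ⟨z, hz⟩ := hinv.nonempty m hm
    exact (h.gt hcov hmr hmk z hz).trans (hmd z hz p hp)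

/-- An identified block above `d` is still below `x`. So it holds better predecessors of `x` than
`d`, and nothing in `d` exceeds `x`. -/
theorem Located.not_mustSplit_low {A : Fin n → α} {x : α} {b a : List (Cell n)}
    (h : Located A x b a) (hinv : CellsInv A (b ++ a)) {d : Cell n} (hd : d ∈ b) :
    ¬ MustSplit A (b ++ a) (.rank x) d := by
  rintro ⟨hk, -, p, hp, hps⟩
  obtain ⟨m, hm, hmk, hb⟩ := h.last d hd hk
  obtain ⟨y, hy⟩ := hinv.nonempty m (List.mem_append_left _ hm)
  have h1 := hb p hp y hy
  have h2 := h.low m hm hmk y hy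
  rcases hps with hps | hps
  · exact absurd (hps.2 y h2.le) (not_le.2 h1)
  · exact absurd (hps.1.trans h1) (not_lt.2 h2.le)

/-- If `x` is not covered, then `d` is above `x`, and between them lies the first cell, if
identified, or else an identified block that separates it from `d`. So the successor of `x` is not
in `d`. -/
theorem Located.not_mustSplit_tail {A : Fin n → α} {x : α} {b rest : List (Cell n)} {c : Cell n}
    (h : Located A x b (c :: rest)) (hinv : CellsInv A (b ++ c :: rest)) {d : Cell n}
    (hd : d ∈ rest) : ¬ MustSplit A (b ++ c :: rest) (.rank x) d := by
  rintro ⟨hk, hcov, p, hp, hps⟩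
  have hpw := List.pairwise_append.1 hinv.pairwise
  have hcr := List.pairwise_cons.1 hpw.2.1
  have hx := h.gt_of_tail hinv hcov hd p hp
  have hcm : c ∈ b ++ c :: rest := by simp
  have hdm : d ∈ b ++ c :: rest := by simp [hd]
  rcases hps with hps | hps
  · exact absurd hps.1 (not_le.2 hx)
  · obtain ⟨m, hm, hmx, hmd⟩ : ∃ m ∈ b ++ c :: rest, (∀ y ∈ m.elts, x < A y) ∧
        Below A m.elts d.elts := by
      by_cases hck : c.known = true
      · exact ⟨c, hcm, h.gt hcov List.mem_cons_self hck, hcr.1 d hd⟩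
      · obtain ⟨m, hm, hmk, hcm', hmd⟩ := hinv.separated c hcm d hdm (by simpa using hck) hk
          (hcr.1 d hd)
        have hmr : m ∈ c :: rest := by
          rcases List.mem_append.1 hm with hmb | hmb
          · exact absurd (hpw.2.2 m hmb c List.mem_cons_self)
              (hcm'.not_symm (hinv.nonempty c hcm) (hinv.nonempty m hm))
          · exact hmb
        exact ⟨m, hm, h.gt hcov hmr hmk, hmd⟩
    obtain ⟨y, hy⟩ := hinv.nonempty m hm
    exact absurd (hps.2 y (hmx y hy)) (not_le.2 (hmd y hy p hp))

/-- The cells before `c` are below `x`, and those after it are above `x`. So the greatest element `≤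
x` of `c`, or the minimum of `c` if there is none, is a global neighbour of `x`. -/
theorem Located.mustSplit_head {A : Fin n → α} {x : α} {b rest : List (Cell n)} {c : Cell n}
    (h : Located A x b (c :: rest)) (hinv : CellsInv A (b ++ c :: rest))
    (hcov : ¬ Covered A (b ++ c :: rest) x) (hk : c.known = false) :
    MustSplit A (b ++ c :: rest) (.rank x) c := by
  refine ⟨hk, hcov, ?_⟩
  have hpw := List.pairwise_append.1 hinv.pairwise
  have hcm : c ∈ b ++ c :: rest := by simp
  by_cases hex : (c.elts.filter fun p => A p ≤ x).Nonempty
  · obtain ⟨p, hp, hmax⟩ := Finset.exists_max_image _ A hex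
    obtain ⟨hpc, hpx⟩ := Finset.mem_filter.1 hp
    refine ⟨p, hpc, Or.inl ⟨hpx, fun p' hp' => ?_⟩⟩
    obtain ⟨d, hd, hpd⟩ := hinv.cover p'
    rcases List.mem_append.1 hd with hd | hd
    · exact (hpw.2.2 d hd c List.mem_cons_self p' hpd p hpc).le
    · rcases List.mem_cons.1 hd with rfl | hd
      · exact hmax p' (Finset.mem_filter.2 ⟨hpd, hp'⟩)
      · exact absurd hp' (not_le.2 (h.gt_of_tail hinv hcov hd p' hpd))
  · have hall : ∀ p ∈ c.elts, x < A p := fun p hp => by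
      by_contra hle
      exact hex ⟨p, Finset.mem_filter.2 ⟨hp, not_lt.1 hle⟩⟩
    obtain ⟨p, hp, hmin⟩ := Finset.exists_min_image _ A (hinv.nonempty c hcm)
    refine ⟨p, hp, Or.inr ⟨hall p hp, fun p' hp' => ?_⟩⟩
    obtain ⟨d, hd, hpd⟩ := hinv.cover p'
    rcases List.mem_append.1 hd with hd | hd
    · exact absurd (h.lt (fun e he => hinv.nonempty e (List.mem_append_left _ he)) hd p' hpd)
        (not_lt.2 hp'.le)
    · rcases List.mem_cons.1 hd with rfl | hd
      · exact hmin p' hpd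
      · exact ((List.pairwise_cons.1 hpw.2.1).1 d hd p hp p' hpd).le

theorem Located.refineOnce_of_known {A : Fin n → α} {x : α} {runOf : Fin n → ℕ}
    {b a : List (Cell n)} (h : Located A x b a) (hinv : CellsInv A (b ++ a))
    (hs : Covered A (b ++ a) x ∨ ∀ c ∈ a.head?, c.known = true) :
    refineOnce A runOf (.rank x) (b ++ a) = b ++ a := by
  refine refineOnce_eq_self fun d hd => ?_
  rcases hs with hs | hs
  · exact fun hm => hm.2.1 hs
  rcases List.mem_append.1 hd with hd | hd
  · exact h.not_mustSplit_low hinv hd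
  · cases a with
    | nil => simp at hd
    | cons c rest =>
      rcases List.mem_cons.1 hd with rfl | hd
      · intro hm
        have := hs d (by simp)
        rw [hm.1] at this
        cases this
      · exact h.not_mustSplit_tail hinv hd

theorem Located.refineOnce_of_unsorted {A : Fin n → α} {x : α} {runOf : Fin n → ℕ}
    {b rest : List (Cell n)} {c : Cell n} (h : Located A x b (c :: rest))
    (hinv : CellsInv A (b ++ c :: rest)) (hcov : ¬ Covered A (b ++ c :: rest) x)
    (hk : c.known = false) :
    refineOnce A runOf (.rank x) (b ++ c :: rest) = b ++ (splitCell A runOf c.elts ++ rest) :=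
  refineOnce_eq_append (fun _ hd => h.not_mustSplit_low hinv hd) (h.mustSplit_head hinv hcov hk)
    fun _ hd => h.not_mustSplit_tail hinv hd

/-! #### Where a `select` query falls -/

/-- Cut a list of cells before the cell that contains the element of index `i`. -/
def cutSize : ℕ → List (Cell n) → List (Cell n) × List (Cell n)
  | _, [] => ([], [])
  | i, c :: l =>
    if i < c.elts.card then ([], c :: l)
    else (c :: (cutSize (i - c.elts.card) l).1, (cutSize (i - c.elts.card) l).2)

theorem cutSize_spec (i : ℕ) (l : List (Cell n)) (h : i < (l.map fun c => c.elts.card).sum) :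
    ∃ c rest, (cutSize i l).2 = c :: rest ∧ l = (cutSize i l).1 ++ c :: rest ∧
      ((cutSize i l).1.map fun c => c.elts.card).sum ≤ i ∧
      i < ((cutSize i l).1.map fun c => c.elts.card).sum + c.elts.card := by
  induction l generalizing i with
  | nil => simp at h
  | cons c l ih =>
    by_cases hi : i < c.elts.card
    · simp only [cutSize, hi, if_true]
      exact ⟨c, l, rfl, rfl, by simp, by simpa using hi⟩
    · rw [List.map_cons, List.sum_cons] at h
      obtain ⟨d, rest, h1, h2, h3, h4⟩ := ih (i - c.elts.card) (by omega)
      simp only [cutSize, hi, if_false]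
      refine ⟨d, rest, h1, by rw [List.cons_append, ← h2], ?_, ?_⟩
      · rw [List.map_cons, List.sum_cons]; omega
      · rw [List.map_cons, List.sum_cons]; omega

theorem exists_isSelected (A : Fin n → α) (i : Fin n) : ∃ p, IsSelected A i (A p) := by
  obtain ⟨p, -, hp⟩ := exists_card_lt_eq (lexKey A) Finset.univ (lexKey_injective A).injOn i.val
    (by simp)
  refine ⟨p, ?_, ?_⟩
  · rw [← hp]
    refine Finset.card_le_card fun y hy => ?_
    rw [Finset.mem_filter] at hy ⊢
    exact ⟨hy.1, lexKey_lt.2 (Or.inl hy.2)⟩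
  · rw [← hp]
    refine Finset.card_lt_card (Finset.ssubset_iff_of_subset (fun y hy => ?_) |>.2 ⟨p, ?_, ?_⟩)
    · rw [Finset.mem_filter] at hy ⊢
      rcases lexKey_lt.1 hy.2 with h | h
      exacts [⟨hy.1, h.le⟩, ⟨hy.1, h.1.le⟩]
    · simp
    · simp

/-- By counting: for a value in an earlier cell too few elements are at most this value, and for one
in a later cell too many are smaller. Hence the sizes alone tell the cell of a `select` query. -/
theorem IsSelected.mem_cell {A : Fin n → α} {b rest : List (Cell n)} {c : Cell n} {i : Fin n}
    (hinv : CellsInv A (b ++ c :: rest)) (h1 : (b.map fun c => c.elts.card).sum ≤ i.val)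
    (h2 : i.val < (b.map fun c => c.elts.card).sum + c.elts.card) {p : Fin n}
    (hp : IsSelected A i (A p)) : p ∈ c.elts := by
  have hpw := List.pairwise_append.1 hinv.pairwise
  have hcr := List.pairwise_cons.1 hpw.2.1
  obtain ⟨d, hd, hpd⟩ := hinv.cover p
  rcases List.mem_append.1 hd with hdb | hdb
  · exfalso
    have hle : numLE A (A p) ≤ (allElts b).card := by
      refine Finset.card_le_card fun y hy => ?_
      have hy := (Finset.mem_filter.1 hy).2
      obtain ⟨e, he, hye⟩ := hinv.cover y
      rcases List.mem_append.1 he with he | he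
      · exact mem_allElts.2 ⟨e, he, hye⟩
      · exact absurd hy (not_le.2 (hpw.2.2 d hdb e he p hpd y hye))
    rw [card_allElts hpw.1] at hle
    have := hp.2
    omega
  · rcases List.mem_cons.1 hdb with rfl | hdr
    · exact hpd
    · exfalso
      have hpw' : (b ++ [c]).Pairwise fun c c' => Below A c.elts c'.elts := by
        refine hinv.pairwise.sublist ?_
        exact (List.Sublist.refl b).append (by simp)
      have hle : (allElts (b ++ [c])).card ≤ numLT A (A p) := by
        refine Finset.card_le_card fun y hy => ?_
        obtain ⟨e, he, hye⟩ := mem_allElts.1 hy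
        refine Finset.mem_filter.2 ⟨Finset.mem_univ _, ?_⟩
        rcases List.mem_append.1 he with he | he
        · exact hpw.2.2 e he d hdb y hye p hpd
        · rw [List.mem_singleton.1 he] at hye
          exact hcr.1 d hdr y hye p hpd
      rw [card_allElts hpw', List.map_append, List.sum_append] at hle
      simp only [List.map_cons, List.map_nil, List.sum_cons, List.sum_nil] at hle
      have := hp.1
      omega

theorem mustSplit_select_iff {A : Fin n → α} {b rest : List (Cell n)} {c : Cell n} {i : Fin n}
    (hinv : CellsInv A (b ++ c :: rest)) (h1 : (b.map fun c => c.elts.card).sum ≤ i.val)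
    (h2 : i.val < (b.map fun c => c.elts.card).sum + c.elts.card) {d : Cell n}
    (hd : d ∈ b ++ c :: rest) :
    MustSplit A (b ++ c :: rest) (.select i) d ↔ d = c ∧ c.known = false := by
  have hcm : c ∈ b ++ c :: rest := by simp
  constructor
  · rintro ⟨hk, p, hp, hs⟩
    obtain rfl := hinv.eq_of_mem hd hcm hp (hs.mem_cell hinv h1 h2) rfl
    exact ⟨rfl, hk⟩
  · rintro ⟨rfl, hk⟩
    obtain ⟨p, hp⟩ := exists_isSelected A i
    exact ⟨hk, p, hp.mem_cell hinv h1 h2, hp⟩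

theorem refineOnce_select {A : Fin n → α} {runOf : Fin n → ℕ} {b rest : List (Cell n)}
    {c : Cell n} {i : Fin n} (hinv : CellsInv A (b ++ c :: rest))
    (h1 : (b.map fun c => c.elts.card).sum ≤ i.val)
    (h2 : i.val < (b.map fun c => c.elts.card).sum + c.elts.card) :
    refineOnce A runOf (.select i) (b ++ c :: rest) =
      if c.known = true then b ++ c :: rest else b ++ (splitCell A runOf c.elts ++ rest) := by
  have hcm : c ∈ b ++ c :: rest := by simp
  have hpw := List.pairwise_append.1 hinv.pairwise
  have hcr := List.pairwise_cons.1 hpw.2.1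
  have hself : ¬ Below A c.elts c.elts := fun h =>
    h.not_symm (hinv.nonempty c hcm) (hinv.nonempty c hcm) h
  split_ifs with hk
  · refine refineOnce_eq_self fun d hd hm => ?_
    have := ((mustSplit_select_iff hinv h1 h2 hd).1 hm).2
    rw [hk] at this
    cases this
  · refine refineOnce_eq_append (fun d hd hm => ?_)
      ((mustSplit_select_iff hinv h1 h2 hcm).2 ⟨rfl, by simpa using hk⟩) fun d hd hm => ?_
    · have := ((mustSplit_select_iff hinv h1 h2 (List.mem_append_left _ hd)).1 hm).1
      exact hself (hpw.2.2 c (this ▸ hd) c List.mem_cons_self)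
    · have := ((mustSplit_select_iff hinv h1 h2 (by simp [hd])).1 hm).1
      exact hself (hcr.1 c (this ▸ hd))

end Refinement

/-! ### Serving a `select` query -/

section SelectProgram

variable {n : ℕ}

theorem potential_replace (runOf : Fin n → ℕ) (ρ : ℕ) (b ch rest : List (Cell n)) (c : Cell n) :
    potential runOf ρ (b ++ (ch ++ rest)) - potential runOf ρ (b ++ c :: rest)
      = potential runOf ρ ch - cellPotential runOf ρ c := by
  simp only [potential, List.map_append, List.sum_append, List.map_cons, List.sum_cons]
  ring

/-- The cell to be split is known from the sizes, so the only comparisons are those of the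
partitioning steps, and the potential pays for them. -/
theorem exists_selectLoop (runOf : Fin n → ℕ) (i : Fin n) (fuel : ℕ) (cells : List (Cell n)) :
    ∃ t : CompTree (Fin n) (List (Cell n)), ∀ (α : Type u) [LinearOrder α] (A : Fin n → α) (ρ : ℕ),
      RunsSorted A runOf → CellsInv A cells → (runsMeeting runOf Finset.univ).card ≤ ρ →
      t.result A = (refineOnce A runOf (.select i))^[fuel] cells ∧
      (t.cost A : ℝ) ≤ potential runOf ρ ((refineOnce A runOf (.select i))^[fuel] cells)
        - potential runOf ρ cells := by
  induction fuel generalizing cells with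
  | zero => exact ⟨.done cells, fun α _ A ρ _ _ _ => by simp⟩
  | succ fuel ih =>
    choose loop hloop using ih
    choose split hsplit using exists_splitProgram.{u} runOf
    by_cases hi : i.val < (cells.map fun c => c.elts.card).sum
    swap
    -- No array is compatible with such a list of cells, as the sizes would add up to `n`.
    · exact ⟨.done cells, fun α _ A ρ _ h _ => absurd (by rw [h.sum_card]; exact i.isLt) hi⟩
    obtain ⟨c, rest, -, hcells, h1, h2⟩ := cutSize_spec i.val cells hi
    set b := (cutSize i.val cells).1
    by_cases hk : c.known = true
    · refine ⟨.done cells, fun α _ A ρ hrun hinv _ => ?_⟩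
      have hfix : refineOnce A runOf (.select i) cells = cells := by
        rw [hcells] at hinv ⊢
        rw [refineOnce_select hinv h1 h2, if_pos hk]
      rw [Function.iterate_fixed hfix]
      simp
    · refine ⟨(split c.elts).bind fun ch => loop (b ++ (ch ++ rest)), fun α _ A ρ hrun hinv hρ => ?_⟩
      have hstep : refineOnce A runOf (.select i) cells
          = b ++ (splitCell A runOf c.elts ++ rest) := by
        rw [hcells] at hinv ⊢
        rw [refineOnce_select hinv h1 h2, if_neg hk]
      have hcne : c.elts.Nonempty := hinv.nonempty c
        (hcells ▸ List.mem_append_right _ List.mem_cons_self)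
      have hcρ : (runsMeeting runOf c.elts).card ≤ ρ :=
        (Finset.card_le_card (runsMeeting_mono runOf (Finset.subset_univ _))).trans hρ
      obtain ⟨s1, s2⟩ := hsplit c.elts α A hrun hcne
      have hpot := cost_le_potential_split hrun hcρ hcne
      obtain ⟨l1, l2⟩ := hloop (b ++ (splitCell A runOf c.elts ++ rest)) α A ρ hrun
        (by rw [← hstep]; exact hinv.refineOnce hrun _) hρ
      simp only [CompTree.result_bind, CompTree.cost_bind, s1, Function.iterate_succ_apply, hstep]
      refine ⟨l1, ?_⟩
      have hrep := potential_replace runOf ρ b (splitCell A runOf c.elts) rest c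
      rw [← hcells] at hrep
      have hce : (⟨false, c.elts⟩ : Cell n) = c := by
        obtain ⟨_ | _, T⟩ := c
        exacts [rfl, absurd rfl hk]
      rw [hce] at hpot
      have : (0 : ℝ) ≤ (runsMeeting runOf c.elts).card := Nat.cast_nonneg _
      push_cast
      linarith

theorem blockMeeting_eq {α : Type*} [LinearOrder α] {A : Fin n → α} {cells : List (Cell n)}
    (hinv : CellsInv A cells) {c : Cell n} (hc : c ∈ cells) (hk : c.known = true)
    {T : Finset (Fin n)} {p : Fin n} (hpc : p ∈ c.elts) (hpT : p ∈ T)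
    (hT : ∀ p' ∈ T, A p' = A p) : blockMeeting cells T = c.elts := by
  have hsome : (cells.find? fun c => c.known && decide (∃ p ∈ T, p ∈ c.elts)).isSome := by
    rw [List.find?_isSome]
    exact ⟨c, hc, by simpa [hk] using ⟨p, hpT, hpc⟩⟩
  obtain ⟨d, hd⟩ := Option.isSome_iff_exists.1 hsome
  have hf := List.find?_some hd
  simp only [Bool.and_eq_true, decide_eq_true_eq] at hf
  obtain ⟨-, p', hp', hpd⟩ := hf
  have : d = c := hinv.eq_of_mem (List.mem_of_find?_eq_some hd) hc hpd hpc (hT p' hp')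
  unfold blockMeeting
  rw [hd, this]

theorem IsSelected.eq {α : Type*} [LinearOrder α] {A : Fin n → α} {i : Fin n} {v w : α}
    (hv : IsSelected A i v) (hw : IsSelected A i w) : v = w := by
  wlog h : v < w generalizing v w
  · rcases lt_trichotomy v w with h' | h' | h'
    exacts [absurd h' h, h', (this hw hv h').symm]
  have : numLE A v ≤ numLT A w := Finset.card_le_card fun y hy => by
    rw [Finset.mem_filter] at hy ⊢
    exact ⟨hy.1, hy.2.trans_lt h⟩
  have := hv.2
  have := hw.1
  omega

/-- In a sorted block, the element with `j` predecessors in the order of positions. -/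
theorem isSelected_getElem {α : Type*} [LinearOrder α] {A : Fin n → α} {b rest : List (Cell n)}
    {c : Cell n} {i : Fin n} (hinv : CellsInv A (b ++ c :: rest)) (hk : c.known = true)
    (h1 : (b.map fun c => c.elts.card).sum ≤ i.val)
    (h2 : i.val < (b.map fun c => c.elts.card).sum + c.elts.card) (p0 : Fin n) :
    IsSelected A i (A ((c.elts.sort (· ≤ ·)).getD (i.val - (b.map fun c => c.elts.card).sum) p0)) := by
  set B := (b.map fun c => c.elts.card).sum with hB
  have hcm : c ∈ b ++ c :: rest := by simp
  have hpw := List.pairwise_append.1 hinv.pairwise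
  have hcr := List.pairwise_cons.1 hpw.2.1
  have hcB : (allElts b).card = B := card_allElts hpw.1
  have hj : i.val - B < c.elts.card := by omega
  obtain ⟨q, hq, hqc⟩ := exists_card_lt_eq (id : Fin n → Fin n) c.elts
    Function.injective_id.injOn (i.val - B) hj
  have hget : (c.elts.sort (· ≤ ·)).getD (i.val - B) p0 = q := by
    have hp : (c.elts.sort (· ≤ ·)).Pairwise fun a b => decide (b < q) = true →
        decide (a < q) = true := by
      refine List.Pairwise.imp ?_ (Finset.pairwise_sort c.elts (· ≤ ·))
      intro a b hab hb
      simp only [decide_eq_true_eq] at hb ⊢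
      exact hab.trans_lt hb
    have hcount : (c.elts.sort (· ≤ ·)).countP (fun a => decide (a < q)) = i.val - B := by
      rw [List.countP_eq_length_filter, ← List.toFinset_card_of_nodup
        ((Finset.sort_nodup c.elts (· ≤ ·)).filter _), List.toFinset_filter, Finset.sort_toFinset]
      simpa using hqc
    obtain ⟨-, hidx⟩ := List.take_countP_eq_filter _ _ hp
    obtain ⟨m, hm, hmq⟩ := List.getElem_of_mem ((Finset.mem_sort (· ≤ ·)).2 hq)
    have hlen : (c.elts.sort (· ≤ ·)).length = c.elts.card := Finset.length_sort _
    rw [List.getD_eq_getElem _ _ (by omega)]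
    rw [hcount] at hidx
    have hge : i.val - B ≤ m := by
      have := hidx m hm
      rw [hmq] at this
      simpa using this
    have hle : (c.elts.sort (· ≤ ·))[i.val - B]'(by omega) ≤ q := by
      rcases hge.lt_or_eq with h | h
      · have := List.pairwise_iff_getElem.1 (Finset.pairwise_sort c.elts (· ≤ ·)) (i.val - B) m
          (by omega) hm h
        rwa [hmq] at this
      · simp only [h, hmq, le_refl]
    have := hidx (i.val - B) (by omega)
    simp only [lt_irrefl, decide_false, decide_eq_false_iff_not, not_lt] at this
    exact le_antisymm hle this
  rw [hget]
  have hs := hinv.sorted c hcm hk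
  constructor
  · have hsub : (Finset.univ.filter fun p => A p < A q)
        ⊆ allElts b ∪ c.elts.filter fun y => id y < id q := by
      intro y hy
      have hy := (Finset.mem_filter.1 hy).2
      obtain ⟨d, hd, hyd⟩ := hinv.cover y
      rcases List.mem_append.1 hd with hd | hd
      · exact Finset.mem_union_left _ (mem_allElts.2 ⟨d, hd, hyd⟩)
      · rcases List.mem_cons.1 hd with rfl | hd
        · refine Finset.mem_union_right _ (Finset.mem_filter.2 ⟨hyd, ?_⟩)
          by_contra hle
          exact absurd (hs q hq y hyd (not_lt.1 hle)) (not_le.2 hy)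
        · exact absurd (hcr.1 d hd q hq y hyd) (not_lt.2 hy.le)
    have := (Finset.card_le_card hsub).trans (Finset.card_union_le _ _)
    rw [hcB, hqc] at this
    have e : numLT A (A q) = (Finset.univ.filter fun p => A p < A q).card := rfl
    omega
  · have hsub : allElts b ∪ insert q (c.elts.filter fun y => id y < id q)
        ⊆ Finset.univ.filter fun p => A p ≤ A q := by
      intro y hy
      refine Finset.mem_filter.2 ⟨Finset.mem_univ _, ?_⟩
      rcases Finset.mem_union.1 hy with hy | hy
      · obtain ⟨d, hd, hyd⟩ := mem_allElts.1 hy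
        exact (hpw.2.2 d hd c List.mem_cons_self y hyd q hq).le
      · rcases Finset.mem_insert.1 hy with rfl | hy
        · exact le_rfl
        · obtain ⟨hy1, hy2⟩ := Finset.mem_filter.1 hy
          exact hs y hy1 q hq hy2.le
    have := Finset.card_le_card hsub
    rw [Finset.card_union_of_disjoint, Finset.card_insert_of_notMem (by simp), hcB, hqc] at this
    · have e : numLE A (A q) = (Finset.univ.filter fun p => A p ≤ A q).card := rfl
      omega
    · refine Finset.disjoint_left.2 fun y hy hy' => ?_
      obtain ⟨d, hd, hyd⟩ := mem_allElts.1 hy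
      have hyc : y ∈ c.elts := by
        rcases Finset.mem_insert.1 hy' with rfl | hy'
        exacts [hq, (Finset.mem_filter.1 hy').1]
      exact lt_irrefl _ (hpw.2.2 d hd c List.mem_cons_self y hyd y hyc)

/-- In an identified block the order of positions is an order of values, so the selected element is
read off without comparisons. -/
theorem exists_serveSelect (s : FSState n) (i : Fin n) :
    ∃ t : CompTree (Fin n) (Answer n × FSState n),
      ∀ (α : Type u) [LinearOrder α] (A : Fin n → α) (ρ : ℕ),
      RunsSorted A s.runOf → CellsInv A s.cells → (runsMeeting s.runOf Finset.univ).card ≤ ρ →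
      CorrectAnswer A (.select i) (t.result A).1 ∧ (t.result A).2 = fsServe A s (.select i) ∧
      (∃ c ∈ (fsServe A s (.select i)).cells, c.known = true ∧
        c.elts = (fsServe A s (.select i)).finger) ∧
      (t.cost A : ℝ) ≤ potential s.runOf ρ (fsServe A s (.select i)).cells
        - potential s.runOf ρ s.cells := by
  obtain ⟨loop, hloop⟩ := exists_selectLoop.{u} s.runOf i n s.cells
  let fin : List (Cell n) → Answer n × FSState n := fun cells =>
    match (cutSize i.val cells).2 with
    -- Never taken, because the sizes of the cells add up to `n`.
    | [] => (.elt i, s)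
    | c :: _ => (.elt ((c.elts.sort (· ≤ ·)).getD
        (i.val - ((cutSize i.val cells).1.map fun c => c.elts.card).sum) i),
        ⟨s.runOf, cells, c.elts⟩)
  refine ⟨loop.bind fun cells => .done (fin cells), fun α _ A ρ hrun hinv hρ => ?_⟩
  obtain ⟨l1, l2⟩ := hloop α A ρ hrun hinv hρ
  have hinv' : CellsInv A (fsServe A s (.select i)).cells := hinv.iterate hrun _ n
  have hns := not_mustSplit_fsServe hrun hinv (.select i)
  change _ = (fsServe A s (.select i)).cells at l1
  set cells := (fsServe A s (.select i)).cells with hcells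
  obtain ⟨c, rest, e1, e2, h1, h2⟩ := cutSize_spec i.val cells (by
    rw [hinv'.sum_card]; exact i.isLt)
  have hcm : c ∈ cells := by rw [e2]; simp
  have hk : c.known = true := by
    by_contra hk
    refine hns c hcm ?_
    have hinv2 := hinv'
    rw [e2] at hinv2 ⊢
    exact (mustSplit_select_iff hinv2 h1 h2 (by simp)).2 ⟨rfl, by simpa using hk⟩
  have hfin : fin cells = (.elt ((c.elts.sort (· ≤ ·)).getD
        (i.val - ((cutSize i.val cells).1.map fun c => c.elts.card).sum) i),
        ⟨s.runOf, cells, c.elts⟩) := by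
    simp only [fin, e1]
  have hinv2 := hinv'
  rw [e2] at hinv2
  have hsel := isSelected_getElem hinv2 hk h1 h2 i
  have hfinger : (fsServe A s (.select i)).finger = c.elts := by
    refine blockMeeting_eq hinv' hcm hk (hsel.mem_cell hinv2 h1 h2)
      (Finset.mem_filter.2 ⟨Finset.mem_univ _, hsel⟩) fun p' hp' => ?_
    exact (Finset.mem_filter.1 hp').2.eq hsel
  simp only [CompTree.result_bind, CompTree.cost_bind, CompTree.result_done, CompTree.cost_done,
    l1, hfin, add_zero]
  refine ⟨hsel, ?_, ⟨c, hcm, hk, hfinger.symm⟩, l2⟩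
  rw [← hfinger]
  rfl

end SelectProgram

/-! ### Locating a query value among the identified blocks -/

section Locate

variable {n : ℕ}

/-- The identified blocks. -/
def knownCells (cells : List (Cell n)) : List (Cell n) := cells.filter fun c => c.known

/-- In a sorted block the last position holds the greatest value. For an empty cell the result
`none` would be read as the query value itself. -/
def lastKey (c : Cell n) : Option (Fin n) :=
  if h : c.elts.Nonempty then some (c.elts.max' h) else none

def firstKey (c : Cell n) : Option (Fin n) :=
  if h : c.elts.Nonempty then some (c.elts.min' h) else none

theorem lowCount_eq_countP {α : Type*} [LinearOrder α] (A : Fin n → α) (x : α)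
    (cells : List (Cell n)) :
    lowCount A x cells = (knownCells cells).countP fun c => decide (∀ p ∈ c.elts, A p < x) := by
  rw [lowCount, knownCells, List.countP_filter]
  exact List.countP_congr fun c _ => by simp [and_comm]

/-- Find the place of the query value among the identified blocks, starting from the `h`-th one. -/
theorem exists_locate (cells : List (Cell n)) (h : ℕ) :
    ∃ t : CompTree (Option (Fin n)) (ℕ × Bool),
      ∀ (α : Type u) [LinearOrder α] (A : Fin n → α) (x : α), CellsInv A cells →
      h ≤ (knownCells cells).length →
      (t.result fun k => k.elim x A) = (lowCount A x cells, decide (Covered A cells x)) ∧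
      (t.cost fun k => k.elim x A) ≤ if (knownCells cells).length = 0 then 0 else
        2 * Nat.log 2 ((lowCount A x cells - h) + (h - lowCount A x cells)) + 5 := by
  set K := knownCells cells with hK
  refine ⟨(CompTree.fingerSearch K.length h fun i =>
    -- The test asks whether `x` is at most the greatest element of the block, which holds from the
    -- index `lowCount` on.
    (CompTree.ask none (lastKey (K.getD i ⟨true, ∅⟩))).bind fun o => .done (decide (o ≠ .gt))).bind
    fun t => if t < K.length then
      -- One comparison with the least element of the first block that is not below `x` decides
      -- whether `x` is covered.
      (CompTree.ask none (firstKey (K.getD t ⟨true, ∅⟩))).bind fun o => .done (t, decide (o ≠ .lt))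
      else .done (t, false), fun α _ A x hinv hh => ?_⟩
  have hKm : ∀ c ∈ K, c ∈ cells ∧ c.known = true := fun c hc => by
    simpa [hK, knownCells] using hc
  have hKp : K.Pairwise fun c c' => Below A c.elts c'.elts := hinv.pairwise.filter _
  have hlastkey : ∀ c ∈ K, (lastKey c).elim x A < x ↔ ∀ p ∈ c.elts, A p < x := by
    intro c hc
    have hne := hinv.nonempty c (hKm c hc).1
    simp only [lastKey, hne, dif_pos, Option.elim_some]
    constructor
    · exact fun h p hp => (hinv.sorted c (hKm c hc).1 (hKm c hc).2 p hp _ (Finset.max'_mem _ hne)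
        (Finset.le_max' _ _ hp)).trans_lt h
    · exact fun h => h _ (Finset.max'_mem _ hne)
  have hfirstkey : ∀ c ∈ K, (firstKey c).elim x A ≤ x ↔ ∃ p ∈ c.elts, A p ≤ x := by
    intro c hc
    have hne := hinv.nonempty c (hKm c hc).1
    simp only [firstKey, hne, dif_pos, Option.elim_some]
    constructor
    · exact fun h => ⟨_, Finset.min'_mem _ hne, h⟩
    · rintro ⟨p, hp, h⟩
      exact (hinv.sorted c (hKm c hc).1 (hKm c hc).2 _ (Finset.min'_mem _ hne) p hp
        (Finset.min'_le _ _ hp)).trans h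
  have hlc := lowCount_eq_countP A x cells
  rw [← hK] at hlc
  obtain ⟨-, hidx⟩ := List.take_countP_eq_filter (fun c : Cell n => decide (∀ p ∈ c.elts, A p < x)) K
    (by
      refine hKp.imp_of_mem fun {c d} hc hd hcd hlow => ?_
      simp only [decide_eq_true_eq] at hlow ⊢
      obtain ⟨y, hy⟩ := hinv.nonempty d (hKm d hd).1
      exact fun p hp => (hcd p hp y hy).trans (hlow y hy))
  rw [← hlc] at hidx
  set t := lowCount A x cells with ht
  have htK : t ≤ K.length := by rw [hlc]; exact List.countP_le_length
  obtain ⟨f1, f2⟩ := CompTree.fingerSearch_spec (fun k : Option (Fin n) => k.elim x A) K.length h t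
    (fun i => (CompTree.ask none (lastKey (K.getD i ⟨true, ∅⟩))).bind
      fun o => .done (decide (o ≠ .gt))) htK hh (by
      intro i hi
      refine ⟨?_, by simp⟩
      simp only [CompTree.result_bind, CompTree.result_ask, CompTree.result_done, Option.elim_none]
      rw [List.getD_eq_getElem _ _ hi]
      refine decide_eq_decide.2 ?_
      have h1 := hidx i hi
      rw [decide_eq_decide] at h1
      rw [ne_eq, cmp_eq_gt_iff, hlastkey _ (List.getElem_mem hi), h1, not_lt])
  -- Blocks after the first one that is not below `x` lie entirely above `x`, so no other block can
  -- cover `x`.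
  have hcov : Covered A cells x ↔ ∃ ht : t < K.length, ∃ p ∈ (K[t]'ht).elts, A p ≤ x := by
    constructor
    · rintro ⟨c, hc, hk, ⟨p, hp, hpx⟩, p', hp', hpx'⟩
      have hcK : c ∈ K := by simpa [hK, knownCells] using ⟨hc, hk⟩
      obtain ⟨j, hj, rfl⟩ := List.getElem_of_mem hcK
      have hjt : t ≤ j := by
        have h1 := hidx j hj
        rw [decide_eq_decide] at h1
        by_contra hlt
        exact absurd (h1.2 (by omega) p' hp') (not_lt.2 hpx')
      refine ⟨by omega, ?_⟩
      rcases hjt.lt_or_eq with hlt | rfl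
      · exfalso
        have hb := List.pairwise_iff_getElem.1 hKp t j (by omega) hj hlt
        have h1 := hidx t (by omega)
        rw [decide_eq_decide] at h1
        exact absurd (h1.1 fun y hy => (hb y hy p hp).trans_le hpx) (lt_irrefl _)
      · exact ⟨p, hp, hpx⟩
    · rintro ⟨htl, p, hp, hpx⟩
      have hm := hKm _ (List.getElem_mem htl)
      refine ⟨_, hm.1, hm.2, ⟨p, hp, hpx⟩, ?_⟩
      by_contra hno
      push Not at hno
      have h1 := hidx t htl
      rw [decide_eq_decide] at h1
      exact absurd (h1.1 hno) (lt_irrefl _)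
  simp only [CompTree.result_bind, CompTree.cost_bind, f1, CompTree.result_ite, CompTree.cost_ite,
    CompTree.result_ask, CompTree.cost_ask, CompTree.result_done, CompTree.cost_done,
    Option.elim_none]
  constructor
  · by_cases htl : t < K.length
    · rw [if_pos htl, List.getD_eq_getElem _ _ htl]
      refine Prod.ext rfl (decide_eq_decide.2 ?_)
      rw [ne_eq, cmp_eq_lt_iff, not_lt, hfirstkey _ (List.getElem_mem htl), hcov]
      exact ⟨fun h => ⟨htl, h⟩, fun h => h.2⟩
    · rw [if_neg htl]
      refine Prod.ext rfl (decide_eq_false ?_).symm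
      rw [hcov]
      exact fun h => htl h.1
  · split_ifs at f2 ⊢ <;> omega

end Locate

/-! ### The partitioning loop of a `rank` query, and the search inside a block -/

section RankProgram

variable {n : ℕ}

theorem lowCount_append {α : Type*} [LinearOrder α] (A : Fin n → α) (x : α)
    (l l' : List (Cell n)) : lowCount A x (l ++ l') = lowCount A x l + lowCount A x l' :=
  List.countP_append

theorem Located.lowCount_eq_zero {α : Type*} [LinearOrder α] {A : Fin n → α} {x : α}
    {b a : List (Cell n)} (h : Located A x b a) : lowCount A x a = 0 := by
  refine List.countP_eq_zero.2 fun c hc => ?_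
  simp only [Bool.and_eq_true, decide_eq_true_eq, not_and]
  intro hk hlow
  obtain ⟨p, hp, hle⟩ := h.high c hc hk
  exact absurd (hlow p hp) (not_lt.2 hle)

theorem lowCount_splitCell_le {α : Type*} [LinearOrder α] {A : Fin n → α} {runOf : Fin n → ℕ}
    (hrun : RunsSorted A runOf) {S : Finset (Fin n)} (hS : S.Nonempty) (x : α) :
    lowCount A x (splitCell A runOf S) ≤ 3 := by
  obtain ⟨L, R, Bs, h1, h2⟩ := exists_isPartitioning hrun hS
  rw [h1]
  calc lowCount A x (partitionCells L R Bs)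
      ≤ (partitionCells L R Bs).countP fun c => c.known :=
        List.countP_mono_left fun c _ hc => by
          simp only [Bool.and_eq_true] at hc
          exact hc.1
    _ ≤ ((⟨false, L⟩ : Cell n) :: (Bs.map (Cell.mk true) ++ [(⟨false, R⟩ : Cell n)])).countP
          fun c => c.known := by
        unfold partitionCells
        exact List.Sublist.countP_le List.filter_sublist
    _ ≤ Bs.length := by
        rw [List.countP_cons_of_neg (by simp), List.countP_append]
        simpa using List.countP_le_length.trans (by simp)
    _ ≤ 3 := h2.length_le

/-- The cost of finding a place among the identified blocks from the place `h`. -/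
noncomputable def locateCost {α : Type*} [LinearOrder α] (A : Fin n → α) (x : α)
    (cells : List (Cell n)) (h : ℕ) : ℕ :=
  if (knownCells cells).length = 0 then 0 else
    2 * Nat.log 2 ((lowCount A x cells - h) + (h - lowCount A x cells)) + 5

/-- Only the first location starts from the given place `h`. A partitioning step splits the cell at
`x` and puts at most three new blocks below `x`, so locating again from the old place costs a
constant. -/
theorem exists_rankLoop (runOf : Fin n → ℕ) (fuel : ℕ) (cells : List (Cell n)) (h : ℕ) :
    ∃ t : CompTree (Option (Fin n)) (List (Cell n) × ℕ × Bool),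
      ∀ (α : Type u) [LinearOrder α] (A : Fin n → α) (x : α) (ρ : ℕ),
      RunsSorted A runOf → CellsInv A cells → (runsMeeting runOf Finset.univ).card ≤ ρ →
      h ≤ (knownCells cells).length →
      (t.result fun k => k.elim x A) = ((refineOnce A runOf (.rank x))^[fuel] cells,
        lowCount A x ((refineOnce A runOf (.rank x))^[fuel] cells),
        decide (Covered A ((refineOnce A runOf (.rank x))^[fuel] cells) x)) ∧
      ((t.cost fun k => k.elim x A : ℕ) : ℝ) ≤ locateCost A x cells h +
        (potential runOf ρ ((refineOnce A runOf (.rank x))^[fuel] cells)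
        - potential runOf ρ cells) := by
  induction fuel generalizing cells h with
  | zero =>
    obtain ⟨loc, hloc⟩ := exists_locate.{u} cells h
    refine ⟨loc.bind fun r => .done (cells, r), fun α _ A x ρ _ hinv _ hh => ?_⟩
    obtain ⟨h1, h2⟩ := hloc α A x hinv hh
    simp only [CompTree.result_bind, CompTree.cost_bind, CompTree.result_done, CompTree.cost_done,
      h1, Function.iterate_zero, id_eq, sub_self, add_zero]
    exact ⟨rfl, by exact_mod_cast h2⟩
  | succ fuel ih =>
    choose loop hloop using ih
    choose split hsplit using exists_splitProgram.{u} runOf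
    obtain ⟨loc, hloc⟩ := exists_locate.{u} cells h
    refine ⟨loc.bind fun r => match (cutAt r.1 cells).2, r.2 with
      -- Only the first cell after the cut can require a partitioning step, and only if `x` is not
      -- covered.
      | c :: rest, false => if c.known = true then .done (cells, r) else
        ((split c.elts).mapKeys some).bind fun ch => loop ((cutAt r.1 cells).1 ++ (ch ++ rest)) r.1
      | _, _ => .done (cells, r), fun α _ A x ρ hrun hinv hρ hh => ?_⟩
    obtain ⟨h1, h2⟩ := hloc α A x hinv hh
    have h2' : ((loc.cost fun k => k.elim x A : ℕ) : ℝ) ≤ locateCost A x cells h := by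
      exact_mod_cast h2
    simp only [CompTree.result_bind, CompTree.cost_bind, h1]
    have hloc := located_cutAt (A := A) (x := x) hinv.nonempty hinv.pairwise
    have happ := cutAt_append (lowCount A x cells) cells
    set t := lowCount A x cells with ht
    set b := (cutAt t cells).1 with hb
    set a := (cutAt t cells).2 with ha
    have hfixed : (Covered A (b ++ a) x ∨ ∀ c ∈ a.head?, c.known = true) →
        (refineOnce A runOf (.rank x))^[fuel + 1] cells = cells := fun hs => by
      refine Function.iterate_fixed ?_ _
      have hinv' := hinv
      rw [← happ] at hinv' ⊢
      exact hloc.refineOnce_of_known hinv' hs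
    by_cases hcov : Covered A cells x
    · rw [hfixed (Or.inl (by rwa [happ]))]
      simp only [hcov, decide_true]
      refine ⟨?_, ?_⟩
      · split
        · next heq => cases heq
        · simp [ht]
      · split
        · next heq => cases heq
        · simpa using h2'
    simp only [hcov, decide_false]
    cases hac : a with
    | nil =>
      rw [hfixed (Or.inr (by rw [hac]; simp))]
      simp only [CompTree.result_done, CompTree.cost_done, add_zero, sub_self, hcov, decide_false,
        ← ht, true_and]
      exact h2'
    | cons c rest =>
      by_cases hk : c.known = true
      · rw [hfixed (Or.inr (by rw [hac]; simpa using hk))]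
        simp only [hk, if_true, CompTree.result_done, CompTree.cost_done, add_zero, sub_self, hcov,
          decide_false, ← ht, true_and]
        exact h2'
      · rw [hac] at happ hloc
        have hstep : refineOnce A runOf (.rank x) cells
            = b ++ (splitCell A runOf c.elts ++ rest) := by
          have hinv' := hinv
          rw [← happ] at hinv' hcov ⊢
          exact hloc.refineOnce_of_unsorted hinv' hcov (by simpa using hk)
        have hcm : c ∈ cells := happ ▸ List.mem_append_right _ List.mem_cons_self
        have hcne := hinv.nonempty c hcm
        have hcρ : (runsMeeting runOf c.elts).card ≤ ρ :=
          (Finset.card_le_card (runsMeeting_mono runOf (Finset.subset_univ _))).trans hρ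
        obtain ⟨s1, s2⟩ := hsplit c.elts α A hrun hcne
        have hpot := cost_le_potential_split hrun hcρ hcne
        have hce : (⟨false, c.elts⟩ : Cell n) = c := by
          obtain ⟨_ | _, T⟩ := c
          exacts [rfl, absurd rfl hk]
        rw [hce] at hpot
        have hrep := potential_replace runOf ρ b (splitCell A runOf c.elts) rest c
        rw [happ] at hrep
        have hz := hloc.lowCount_eq_zero
        have hrz : lowCount A x rest = 0 := by
          have : lowCount A x (c :: rest) = lowCount A x [c] + lowCount A x rest :=
            lowCount_append A x [c] rest
          omega
        have htb : lowCount A x b = t := by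
          have := lowCount_append A x b (c :: rest)
          rw [happ, hz] at this
          omega
        set cells1 := b ++ (splitCell A runOf c.elts ++ rest) with hcells1
        have ht1 : lowCount A x cells1 = t + lowCount A x (splitCell A runOf c.elts) := by
          rw [hcells1, lowCount_append, lowCount_append, htb, hrz, add_zero]
        have h3 := lowCount_splitCell_le hrun hcne x
        have hK1 : t ≤ (knownCells cells1).length := by
          have := lowCount_eq_countP A x cells1
          have h4 : lowCount A x cells1 ≤ (knownCells cells1).length :=
            this ▸ List.countP_le_length
          omega
        obtain ⟨l1, l2⟩ := hloop cells1 t α A x ρ hrun (hstep ▸ hinv.refineOnce hrun _) hρ hK1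
        -- The cost is at most `2 * Nat.log 2 3 + 5 = 7`, and `12 = 150 - 138` is available.
        have hlc : (locateCost A x cells1 t : ℝ) ≤ 12 := by
          have : locateCost A x cells1 t ≤ 7 := by
            unfold locateCost
            split_ifs
            · omega
            · have : Nat.log 2 (lowCount A x cells1 - t + (t - lowCount A x cells1))
                  ≤ Nat.log 2 3 := Nat.log_mono_right (by omega)
              have h5 : Nat.log 2 3 = 1 := by decide
              omega
          have : (locateCost A x cells1 t : ℝ) ≤ 7 := by exact_mod_cast this
          linarith
        have hs1 : ((split c.elts).mapKeys some).result (fun k : Option (Fin n) => k.elim x A)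
            = splitCell A runOf c.elts := by
          rw [CompTree.result_mapKeys]; exact s1
        have hs2 : ((split c.elts).mapKeys some).cost (fun k : Option (Fin n) => k.elim x A)
            = (split c.elts).cost A := by
          rw [CompTree.cost_mapKeys]; rfl
        simp only [hk, CompTree.result_bind, CompTree.cost_bind, hs1, hs2,
          Function.iterate_succ_apply, hstep, ← hcells1, Bool.false_eq_true, if_false]
        refine ⟨l1, ?_⟩
        have hk1 : (1 : ℝ) ≤ (runsMeeting runOf c.elts).card := by
          exact_mod_cast Finset.card_pos.2 (hcne.image _)
        push_cast
        linarith

/-- Count the elements of a block that are smaller than the query value. -/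
theorem exists_blockSearch (T : Finset (Fin n)) :
    ∃ t : CompTree (Option (Fin n)) ℕ, ∀ (α : Type u) [LinearOrder α] (A : Fin n → α) (x : α),
      (∀ p ∈ T, ∀ p' ∈ T, p ≤ p' → A p ≤ A p') →
      (t.result fun k => k.elim x A) = (T.filter fun p => A p < x).card ∧
      (t.cost fun k => k.elim x A) ≤ if (T.filter fun p => A p < x).card = 0 then 1
        else 2 * Nat.log 2 T.card + 3 := by
  set l := T.sort (· ≤ ·) with hl
  refine ⟨CompTree.search l.length l.length fun i =>
    (CompTree.ask ((l.map some).getD i none) none).bind fun o => .done (decide (o ≠ .lt)),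
    fun α _ A x hA => ?_⟩
  have hcount : l.countP (fun p => decide (A p < x)) = (T.filter fun p => A p < x).card := by
    rw [List.countP_eq_length_filter, ← List.toFinset_card_of_nodup
      ((Finset.sort_nodup T (· ≤ ·)).filter _), List.toFinset_filter, Finset.sort_toFinset]
    simp
  obtain ⟨-, hidx⟩ := List.take_countP_eq_filter (fun p => decide (A p < x)) l (by
    refine List.Pairwise.imp_of_mem ?_ (Finset.pairwise_sort T (· ≤ ·))
    intro a b ha hb hab hbx
    simp only [decide_eq_true_eq] at hbx ⊢
    exact (hA a ((Finset.mem_sort _).1 ha) b ((Finset.mem_sort _).1 hb) hab).trans_lt hbx)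
  rw [hcount] at hidx
  have hlen : l.length = T.card := Finset.length_sort _
  have hle : (T.filter fun p => A p < x).card ≤ T.card := Finset.card_filter_le _ _
  obtain ⟨s1, s2⟩ := CompTree.search_spec (fun k : Option (Fin n) => k.elim x A) l.length l.length
    (T.filter fun p => A p < x).card
    (fun i => (CompTree.ask ((l.map some).getD i none) none).bind
      fun o => .done (decide (o ≠ .lt))) le_rfl (by omega) (by
      intro i hi
      refine ⟨?_, by simp⟩
      simp only [CompTree.result_bind, CompTree.result_ask, CompTree.result_done, Option.elim_none]
      rw [List.getD_eq_getElem _ _ (by simpa using hi), List.getElem_map]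
      refine decide_eq_decide.2 ?_
      have h1 := hidx i hi
      rw [decide_eq_decide] at h1
      rw [Option.elim_some, ne_eq, cmp_eq_lt_iff, h1, not_lt])
  refine ⟨s1, s2.trans ?_⟩
  split_ifs
  · exact le_rfl
  · have := Nat.log_mono_right (b := 2) hle
    omega

end RankProgram

/-! ### Search distance and finger distance -/

section FingerDistance

variable {n : ℕ} {α : Type*} [LinearOrder α]

theorem countP_le_add_of_imp {β : Type*} {l : List β} {P Q R : β → Bool}
    (h : ∀ c ∈ l, P c = true → Q c = true ∨ R c = true) :
    l.countP P ≤ l.countP Q + l.countP R := by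
  induction l with
  | nil => simp
  | cons c l ih =>
    have ih := ih fun d hd => h d (List.mem_cons_of_mem _ hd)
    have hc := h c List.mem_cons_self
    simp only [List.countP_cons]
    split_ifs with h1 h2 h3 <;> first | omega | (exfalso; tauto)

theorem countP_le_one {β : Type*} {l : List β} {P : β → Bool}
    (h : l.Pairwise fun c c' => ¬ (P c = true ∧ P c' = true)) : l.countP P ≤ 1 := by
  induction h with
  | nil => simp
  | @cons c l hc _ ih =>
    by_cases hP : P c = true
    · rw [List.countP_cons_of_pos hP, List.countP_eq_zero.2 fun d hd hPd => hc d hd ⟨hP, hPd⟩]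
    · rwa [List.countP_cons_of_neg hP]

theorem countP_eq_of_getElem {β : Type*} {l : List β} {P : β → Bool} {h : ℕ} (hh : h ≤ l.length)
    (hP : ∀ (j : ℕ) (hj : j < l.length), P l[j] = true ↔ j < h) : l.countP P = h := by
  rw [← List.take_append_drop h l, List.countP_append, List.countP_eq_length.2,
    List.countP_eq_zero.2, List.length_take]
  · omega
  · intro c hc
    obtain ⟨j, hj, rfl⟩ := List.getElem_of_mem hc
    rw [List.length_drop] at hj
    rw [List.getElem_drop, hP _ (by omega)]
    omega
  · intro c hc
    obtain ⟨j, hj, rfl⟩ := List.getElem_of_mem hc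
    rw [List.length_take] at hj
    rw [List.getElem_take, hP _ (by omega)]
    omega

theorem answerElts_rank_eq {A : Fin n → α} {x : α} {p p' : Fin n}
    (hp : p ∈ answerElts A (.rank x)) (hp' : p' ∈ answerElts A (.rank x)) : A p = A p' := by
  simp only [answerElts, Finset.mem_filter, Finset.mem_univ, true_and] at hp hp'
  rcases hp with hp | ⟨hp, hall⟩ <;> rcases hp' with hp' | ⟨hp', hall'⟩
  · exact hp.eq hp'
  · exact absurd hp.1 (not_le.2 (hall' p))
  · exact absurd hp'.1 (not_le.2 (hall p'))
  · exact le_antisymm (hp.2 p' hp'.1) (hp'.2 p hp.1)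

theorem exists_mem_answerElts_rank (A : Fin n → α) (x : α) (p0 : Fin n) :
    ∃ p, p ∈ answerElts A (.rank x) := by
  simp only [answerElts, Finset.mem_filter, Finset.mem_univ, true_and]
  by_cases h : ∃ p, A p ≤ x
  · obtain ⟨p, hp, hmax⟩ := (Finset.univ.filter fun p => A p ≤ x).exists_max_image A
      (by obtain ⟨p, hp⟩ := h; exact ⟨p, by simpa using hp⟩)
    exact ⟨p, Or.inl ⟨by simpa using hp, fun p' hp' => hmax p' (by simpa using hp')⟩⟩
  · push Not at h
    obtain ⟨p, -, hmin⟩ := Finset.univ.exists_min_image A ⟨p0, Finset.mem_univ _⟩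
    exact ⟨p, Or.inr ⟨⟨h p, fun p' _ => hmin p' (Finset.mem_univ _)⟩, h⟩⟩

theorem CellsInv.below_trichotomy {A : Fin n → α} {cells : List (Cell n)} (hinv : CellsInv A cells)
    {c : Cell n} (hc : c ∈ cells) {T : Finset (Fin n)} {w : Fin n}
    (hT : ∀ p ∈ T, A p = A w) :
    (∃ p ∈ c.elts, A p = A w) ∨ Below A c.elts T ∨ Below A T c.elts := by
  obtain ⟨d, hd, hwd⟩ := hinv.cover w
  rcases hinv.below_or hc hd with rfl | h | h
  · exact Or.inl ⟨w, hwd, rfl⟩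
  · exact Or.inr (Or.inl fun p hp p' hp' => hT p' hp' ▸ h p hp w hwd)
  · exact Or.inr (Or.inr fun p hp p' hp' => hT p hp ▸ h w hwd p' hp')

theorem CellsInv.countP_meets_le_one {A : Fin n → α} {cells : List (Cell n)}
    (hinv : CellsInv A cells) (v : α) :
    (knownCells cells).countP (fun c => decide (∃ p ∈ c.elts, A p = v)) ≤ 1 := by
  refine countP_le_one ((hinv.pairwise.filter _).imp fun {c d} hcd h => ?_)
  simp only [decide_eq_true_eq] at h
  obtain ⟨⟨p, hp, h1⟩, p', hp', h2⟩ := h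
  exact (hcd p hp p' hp').ne (h1.trans h2.symm)

theorem fingerDistance_eq_countP (A : Fin n → α) (s : FSState n) (q : Query n α) :
    fingerDistance A s q = (knownCells s.cells).countP fun c =>
      decide ((Below A s.finger c.elts ∧ Below A c.elts (answerElts A q)) ∨
        (Below A (answerElts A q) c.elts ∧ Below A c.elts s.finger)) := by
  rw [fingerDistance, knownCells, List.countP_filter]
  exact List.countP_congr fun c _ => by simp [and_comm]

/-- The index of the finger among the identified blocks. -/
def fingerIndex (s : FSState n) : ℕ :=
  (knownCells s.cells).findIdx fun c => decide (c.elts = s.finger)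

/-- The blocks are listed in increasing order, so exactly those listed before the finger are below
it. -/
theorem countP_below_finger {A : Fin n → α} {s : FSState n} (hinv : CellsInv A s.cells)
    (hf : ∃ c ∈ s.cells, c.known = true ∧ c.elts = s.finger) :
    (knownCells s.cells).countP (fun c => decide (Below A c.elts s.finger)) = fingerIndex s := by
  have hlt : fingerIndex s < (knownCells s.cells).length := by
    obtain ⟨c, hc, hk, he⟩ := hf
    exact List.findIdx_lt_length_of_exists ⟨c, by simp [knownCells, hc, hk], by simpa using he⟩
  have he : ((knownCells s.cells)[fingerIndex s]).elts = s.finger := by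
    have := List.findIdx_getElem (w := hlt)
    exact of_decide_eq_true this
  have hp : (knownCells s.cells).Pairwise fun c c' => Below A c.elts c'.elts :=
    hinv.pairwise.filter _
  have hne : s.finger.Nonempty := by
    obtain ⟨c, hc, -, he⟩ := hf
    exact he ▸ hinv.nonempty c hc
  refine countP_eq_of_getElem hlt.le fun j hj => ?_
  rw [decide_eq_true_eq, ← he]
  rw [← he] at hne
  obtain ⟨y, hy⟩ := hne
  refine ⟨fun h => ?_, fun h => List.pairwise_iff_getElem.1 hp _ _ hj hlt h⟩
  by_contra hge
  rcases (not_lt.1 hge).lt_or_eq with h' | h'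
  · have hz : ((knownCells s.cells)[j]).elts.Nonempty :=
      hinv.nonempty _ (List.mem_of_mem_filter (List.getElem_mem hj))
    obtain ⟨z, hz⟩ := hz
    exact lt_asymm (h z hz y hy) (List.pairwise_iff_getElem.1 hp _ _ hlt hj h' y hy z hz)
  · subst h'
    exact lt_irrefl _ (h y hy y hy)

theorem fingerIndex_le (s : FSState n) : fingerIndex s ≤ (knownCells s.cells).length :=
  List.findIdx_le_length

/-- The finger distance controls the distance of the finger to the place of the query value. -/
theorem dist_fingerIndex_le {A : Fin n → α} {s : FSState n} (hinv : CellsInv A s.cells)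
    (hf : ∃ c ∈ s.cells, c.known = true ∧ c.elts = s.finger) (x : α) :
    (lowCount A x s.cells - fingerIndex s) + (fingerIndex s - lowCount A x s.cells)
      ≤ fingerDistance A s (.rank x) + 2 := by
  obtain ⟨f, hfc, hfk, hfe⟩ := hf
  obtain ⟨y, hy⟩ := hinv.nonempty f hfc
  obtain ⟨w, hw⟩ := exists_mem_answerElts_rank A x y
  have hT : ∀ p ∈ answerElts A (.rank x), A p = A w := fun p hp => answerElts_rank_eq hp hw
  have hw' : IsPred A x w ∨ (IsSucc A x w ∧ ∀ p', x < A p') := by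
    simpa [answerElts] using hw
  have hm : ∀ c ∈ knownCells s.cells, c ∈ s.cells ∧ c.known = true := fun c hc => by
    simpa [knownCells] using hc
  have hlow : ∀ c ∈ s.cells, (∀ p ∈ c.elts, A p < x) → (∃ p ∈ c.elts, A p = A w) ∨
      Below A c.elts (answerElts A (.rank x)) := by
    intro c hc hlt
    rcases hinv.below_trichotomy hc hT with h | h | h
    · exact Or.inl h
    · exact Or.inr h
    · exfalso
      obtain ⟨z, hz⟩ := hinv.nonempty c hc
      have h1 := h w hw z hz
      have h2 := hlt z hz
      rcases hw' with hw' | ⟨-, hw'⟩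
      · exact absurd (hw'.2 z h2.le) (not_le.2 h1)
      · exact absurd (hw' z) (not_lt.2 h2.le)
  have hhigh : ∀ c ∈ s.cells, (∃ p ∈ c.elts, x ≤ A p) → (∃ p ∈ c.elts, A p = A w) ∨
      Below A (answerElts A (.rank x)) c.elts := by
    rintro c hc ⟨z, hz, hle⟩
    rcases hinv.below_trichotomy hc hT with h | h | h
    · exact Or.inl h
    · exfalso
      have h1 := h z hz w hw
      rcases hw' with hw' | ⟨hw', hall⟩
      · exact absurd (hw'.1.trans hle) (not_le.2 h1)
      · exact absurd (hw'.2 z (hall z)) (not_le.2 h1)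
    · exact Or.inr h
  rw [lowCount_eq_countP, ← countP_below_finger hinv ⟨f, hfc, hfk, hfe⟩, fingerDistance_eq_countP]
  have h1 := hinv.countP_meets_le_one (A w)
  have h2 : (knownCells s.cells).countP (fun c => decide (∃ p ∈ c.elts, A p = A y)) ≤ 1 :=
    hinv.countP_meets_le_one (A y)
  set D : Cell n → Bool := fun c =>
      decide ((Below A s.finger c.elts ∧ Below A c.elts (answerElts A (.rank x))) ∨
        (Below A (answerElts A (.rank x)) c.elts ∧ Below A c.elts s.finger))
  set M : Cell n → Bool := fun c => decide (∃ p ∈ c.elts, A p = A w)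
  set M' : Cell n → Bool := fun c => decide (∃ p ∈ c.elts, A p = A y)
  set F : Cell n → Bool := fun c => decide (Below A c.elts s.finger)
  set Lw : Cell n → Bool := fun c => decide (∀ p ∈ c.elts, A p < x)
  -- A block below `x` is below the finger or strictly between finger and answer, unless it is the
  -- block of the finger or of the answer itself. These two exceptions are the summand 2.
  have h3 : (knownCells s.cells).countP Lw ≤ (knownCells s.cells).countP (fun c => M c || M' c)
      + (knownCells s.cells).countP (fun c => F c || D c) := by
    refine countP_le_add_of_imp fun c hc hl => ?_
    simp only [Lw, M, M', F, D, Bool.or_eq_true, decide_eq_true_eq] at hl ⊢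
    rcases hlow c (hm c hc).1 hl with h | h
    · exact Or.inl (Or.inl h)
    · rcases hinv.below_or (hm c hc).1 hfc with rfl | h' | h'
      · exact Or.inl (Or.inr ⟨y, hy, rfl⟩)
      · exact Or.inr (Or.inl (hfe ▸ h'))
      · exact Or.inr (Or.inr (Or.inl ⟨hfe ▸ h', h⟩))
  have h4 : (knownCells s.cells).countP F ≤ (knownCells s.cells).countP M
      + (knownCells s.cells).countP (fun c => Lw c || D c) := by
    refine countP_le_add_of_imp fun c hc hF => ?_
    simp only [Lw, M, F, D, Bool.or_eq_true, decide_eq_true_eq] at hF ⊢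
    by_cases hl : ∀ p ∈ c.elts, A p < x
    · exact Or.inr (Or.inl hl)
    · push Not at hl
      rcases hhigh c (hm c hc).1 hl with h | h
      · exact Or.inl h
      · exact Or.inr (Or.inr (Or.inr ⟨h, hF⟩))
  have hor : ∀ P Q : Cell n → Bool, (knownCells s.cells).countP (fun c => P c || Q c)
      ≤ (knownCells s.cells).countP P + (knownCells s.cells).countP Q := fun P Q =>
    countP_le_add_of_imp fun c _ h => by simpa using h
  have h5 := hor M M'
  have h6 := hor F D
  have h7 := hor Lw D
  omega

/-- For positive `d`, because `d + 2 ≤ 4 d`. -/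
theorem natLog_add_two_le (d : ℕ) : (Nat.log 2 (d + 2) : ℝ) ≤ lg d + 2 := by
  rcases Nat.eq_zero_or_pos d with rfl | hd
  · have h : Nat.log 2 (0 + 2) = 1 := by decide
    rw [h]
    have : (1 : ℝ) ≤ lg 0 := le_max_left _ _
    push_cast
    linarith
  · have h1 : Nat.log 2 (d + 2) ≤ Nat.log 2 (d * 2 * 2) := Nat.log_mono_right (by omega)
    rw [Nat.log_mul_base (by norm_num) (by omega), Nat.log_mul_base (by norm_num) (by omega)] at h1
    have h2 : (Nat.log 2 d : ℝ) ≤ Real.logb 2 d := natLog_le_logb d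
    have h3 : Real.logb 2 d ≤ lg d := le_max_right _ _
    have h4 : (Nat.log 2 (d + 2) : ℝ) ≤ Nat.log 2 d + 1 + 1 := by exact_mod_cast h1
    linarith

/-- `2 (lg d + 2) + 5 ≤ 11 lg d`, because `lg d ≥ 1`. -/
theorem locateCost_fingerIndex_le {A : Fin n → α} {s : FSState n} (hinv : CellsInv A s.cells)
    (hf : knownCells s.cells = [] ∨ ∃ c ∈ s.cells, c.known = true ∧ c.elts = s.finger) (x : α) :
    (locateCost A x s.cells (fingerIndex s) : ℝ) ≤
      if knownCells s.cells = [] then 0 else 11 * lg (fingerDistance A s (.rank x)) := by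
  unfold locateCost
  by_cases hK : knownCells s.cells = []
  · simp [hK]
  · rw [if_neg (by simpa using hK), if_neg hK]
    have h1 := dist_fingerIndex_le hinv (hf.resolve_left hK) x
    have h2 := Nat.log_mono_right (b := 2) h1
    have h3 := natLog_add_two_le (fingerDistance A s (.rank x))
    have h4 : (1 : ℝ) ≤ lg (fingerDistance A s (.rank x)) := le_max_left _ _
    have h5 : (Nat.log 2 (lowCount A x s.cells - fingerIndex s +
      (fingerIndex s - lowCount A x s.cells)) : ℝ)
      ≤ Nat.log 2 (fingerDistance A s (.rank x) + 2) := by exact_mod_cast h2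
    push_cast
    linarith

end FingerDistance

/-! ### Reading the answer to a `rank` query off the final cells -/

section RankServe

variable {n : ℕ} {α : Type*} [LinearOrder α]

theorem Located.gt_of_known_head {A : Fin n → α} {x : α} {b a : List (Cell n)}
    (h : Located A x b a) (hinv : CellsInv A (b ++ a)) (hcov : ¬ Covered A (b ++ a) x)
    (ha : ∀ c ∈ a.head?, c.known = true) {d : Cell n} (hd : d ∈ a) : ∀ p ∈ d.elts, x < A p := by
  cases a with
  | nil => simp at hd
  | cons c rest =>
    rcases List.mem_cons.1 hd with rfl | hd
    · exact h.gt hcov List.mem_cons_self (by simpa using ha)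
    · exact h.gt_of_tail hinv hcov hd

theorem numLT_eq_sum {A : Fin n → α} {x : α} {b a : List (Cell n)} (hinv : CellsInv A (b ++ a))
    (hb : ∀ c ∈ b, ∀ p ∈ c.elts, A p < x) (ha : ∀ c ∈ a, ∀ p ∈ c.elts, x < A p) :
    numLT A x = (b.map fun c => c.elts.card).sum := by
  rw [← card_allElts (List.pairwise_append.1 hinv.pairwise).1, numLT]
  congr 1
  ext p
  simp only [Finset.mem_filter, Finset.mem_univ, true_and, mem_allElts]
  refine ⟨fun hp => ?_, fun ⟨c, hc, hp⟩ => hb c hc p hp⟩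
  obtain ⟨c, hc, hpc⟩ := hinv.cover p
  rcases List.mem_append.1 hc with hc | hc
  · exact ⟨c, hc, hpc⟩
  · exact absurd hp (not_lt.2 (ha c hc p hpc).le)

/-- The block of the predecessor when the query value is between two blocks. -/
theorem blockMeeting_of_cut {A : Fin n → α} {x : α} {b a : List (Cell n)} (hinv : CellsInv A (b ++ a))
    (hb : ∀ c ∈ b, ∀ p ∈ c.elts, A p < x) (ha : ∀ c ∈ a, ∀ p ∈ c.elts, x < A p) {c : Cell n}
    (hk : c.known = true) (hc : b.getLast? = some c ∨ (b = [] ∧ a.head? = some c)) :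
    blockMeeting (b ++ a) (answerElts A (.rank x)) = c.elts := by
  have hcm : c ∈ b ++ a := by
    rcases hc with hc | ⟨-, hc⟩
    · exact List.mem_append_left _ (List.mem_of_getLast? hc)
    · exact List.mem_append_right _ (List.mem_of_head? hc)
  obtain ⟨p0, hp0⟩ := hinv.nonempty c hcm
  obtain ⟨w, hw⟩ := exists_mem_answerElts_rank A x p0
  have hw' : IsPred A x w ∨ (IsSucc A x w ∧ ∀ p', x < A p') := by
    simpa [answerElts] using hw
  refine blockMeeting_eq hinv hcm hk ?_ hw fun p' hp' => answerElts_rank_eq hp' hw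
  obtain ⟨d, hd, hwd⟩ := hinv.cover w
  rcases hc with hc | ⟨rfl, hc⟩
  · obtain ⟨b', rfl⟩ := List.getLast?_eq_some_iff.1 hc
    have hcx := hb c (by simp) p0 hp0
    have hwp : IsPred A x w := hw'.resolve_right fun h => absurd (h.2 p0) (not_lt.2 hcx.le)
    rcases List.mem_append.1 hd with hd | hd
    · rcases List.mem_append.1 hd with hd | hd
      · have := (List.pairwise_append.1 (List.pairwise_append.1 hinv.pairwise).1).2.2 d hd c
          (by simp) w hwd p0 hp0
        exact absurd (hwp.2 p0 hcx.le) (not_le.2 this)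
      · rw [List.mem_singleton] at hd
        exact hd ▸ hwd
    · exact absurd hwp.1 (not_le.2 (ha d hd w hwd))
  · cases a with
    | nil => simp at hc
    | cons e rest =>
      obtain rfl : e = c := by simpa using hc
      have hx := ha e (by simp) p0 hp0
      have hall : ∀ p, x < A p := fun p => by
        obtain ⟨d, hd, hpd⟩ := hinv.cover p
        exact ha d (by simpa using hd) p hpd
      have hws : IsSucc A x w := (hw'.resolve_left fun h => absurd h.1 (not_le.2 (hall w))).1
      rcases List.mem_cons.1 (by simpa using hd) with rfl | hd
      · exact hwd
      · have := (List.pairwise_cons.1 hinv.pairwise).1 d hd p0 hp0 w hwd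
        exact absurd (hws.2 p0 hx) (not_le.2 this)

/-- Two blocks in order cannot both have elements on either side of `x`, so `find?` returns this
one. -/
theorem CellsInv.searchedSize_eq {A : Fin n → α} {s : FSState n} (hinv : CellsInv A s.cells)
    {c : Cell n} (hc : c ∈ s.cells) (hk : c.known = true) {x : α} (h1 : ∃ p ∈ c.elts, A p < x)
    (h2 : ∃ p ∈ c.elts, x ≤ A p) : searchedSize A s x = c.elts.card := by
  have hsome : (s.cells.find? fun c => c.known &&
      decide ((∃ p ∈ c.elts, A p < x) ∧ ∃ p ∈ c.elts, x ≤ A p)).isSome := by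
    rw [List.find?_isSome]
    exact ⟨c, hc, by simpa [hk] using ⟨h1, h2⟩⟩
  obtain ⟨d, hd⟩ := Option.isSome_iff_exists.1 hsome
  have hf := List.find?_some hd
  simp only [Bool.and_eq_true, decide_eq_true_eq] at hf
  obtain ⟨-, ⟨p1, hp1, hd1⟩, p2, hp2, hd2⟩ := hf
  obtain ⟨p3, hp3, h3⟩ := h1
  obtain ⟨p4, hp4, h4⟩ := h2
  have : d = c := by
    rcases hinv.below_or (List.mem_of_find?_eq_some hd) hc with h | h | h
    · exact h
    · exact absurd (h p2 hp2 p3 hp3) (not_lt.2 (h3.le.trans hd2))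
    · exact absurd (h p4 hp4 p1 hp1) (not_lt.2 (hd1.le.trans h4))
  unfold searchedSize
  rw [hd, this]

/-- The covered case: the first identified block that is not below the query value. -/
theorem Located.covered {A : Fin n → α} {x : α} {b u v : List (Cell n)} {k : Cell n}
    (h : Located A x b (u ++ k :: v)) (hinv : CellsInv A (b ++ (u ++ k :: v)))
    (hcov : Covered A (b ++ (u ++ k :: v)) x) (hu : ∀ c ∈ u, c.known = false)
    (hk : k.known = true) :
    numLT A x = (b.map fun c => c.elts.card).sum + ((u.map fun c => c.elts.card).sum
        + (k.elts.filter fun p => A p < x).card) ∧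
      blockMeeting (b ++ (u ++ k :: v)) (answerElts A (.rank x)) = k.elts := by
  have hpb := List.pairwise_append.1 hinv.pairwise
  have hpu := List.pairwise_append.1 hpb.2.1
  have hpk := List.pairwise_cons.1 hpu.2.1
  have hkm : k ∈ b ++ (u ++ k :: v) := by simp
  obtain ⟨z, hz, hxz⟩ := h.high k (by simp) hk
  have hlow : ∀ c ∈ b, ∀ p ∈ c.elts, A p < x := fun c hc =>
    h.lt (fun c hc => hinv.nonempty c (List.mem_append_left _ hc)) hc
  have hv : ∀ c ∈ v, ∀ p ∈ c.elts, x < A p := fun c hc p hp =>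
    hxz.trans_lt (hpk.1 c hc z hz p hp)
  -- The covering block is `k`: cells before the cut are below `x`, cells of `u` are unsorted, and
  -- cells of `v` are above `x`.
  have hkx : ∃ p ∈ k.elts, A p ≤ x := by
    obtain ⟨c, hc, hck, ⟨p, hp, hpx⟩, p', hp', hpx'⟩ := hcov
    rcases List.mem_append.1 hc with hc | hc
    · exact absurd (hlow c hc p' hp') (not_lt.2 hpx')
    rcases List.mem_append.1 hc with hc | hc
    · rw [hu c hc] at hck; cases hck
    rcases List.mem_cons.1 hc with rfl | hc
    · exact ⟨p, hp, hpx⟩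
    · exact absurd (hv c hc p hp) (not_lt.2 hpx)
  obtain ⟨y, hy, hyx⟩ := hkx
  have hux : ∀ c ∈ u, ∀ p ∈ c.elts, A p < x := fun c hc p hp =>
    (hpu.2.2 c hc k List.mem_cons_self p hp y hy).trans_le hyx
  constructor
  · rw [← card_allElts hpb.1, ← card_allElts hpu.1, ← Finset.card_union_of_disjoint,
      ← Finset.card_union_of_disjoint, numLT]
    · congr 1
      ext p
      simp only [Finset.mem_filter, Finset.mem_univ, true_and, Finset.mem_union, mem_allElts]
      constructor
      · intro hp
        obtain ⟨c, hc, hpc⟩ := hinv.cover p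
        rcases List.mem_append.1 hc with hc | hc
        · exact Or.inl ⟨c, hc, hpc⟩
        rcases List.mem_append.1 hc with hc | hc
        · exact Or.inr (Or.inl ⟨c, hc, hpc⟩)
        rcases List.mem_cons.1 hc with rfl | hc
        · exact Or.inr (Or.inr ⟨hpc, hp⟩)
        · exact absurd hp (not_lt.2 (hv c hc p hpc).le)
      · rintro (⟨c, hc, hp⟩ | ⟨c, hc, hp⟩ | hp)
        exacts [hlow c hc p hp, hux c hc p hp, hp.2]
    · refine Finset.disjoint_left.2 fun p hp hp' => ?_
      obtain ⟨c, hc, hpc⟩ := mem_allElts.1 hp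
      rcases Finset.mem_union.1 hp' with hp' | hp'
      · obtain ⟨d, hd, hpd⟩ := mem_allElts.1 hp'
        exact lt_irrefl _ (hpb.2.2 c hc d (List.mem_append_left _ hd) p hpc p hpd)
      · exact lt_irrefl _ (hpb.2.2 c hc k (by simp) p hpc p (Finset.mem_filter.1 hp').1)
    · refine Finset.disjoint_left.2 fun p hp hp' => ?_
      obtain ⟨c, hc, hpc⟩ := mem_allElts.1 hp
      exact lt_irrefl _ (hpu.2.2 c hc k (by simp) p hpc p (Finset.mem_filter.1 hp').1)
  · obtain ⟨w, hw⟩ := exists_mem_answerElts_rank A x y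
    have hw' : IsPred A x w ∨ (IsSucc A x w ∧ ∀ p', x < A p') := by
      simpa [answerElts] using hw
    have hwp : IsPred A x w := hw'.resolve_right fun h => absurd (h.2 y) (not_lt.2 hyx)
    refine blockMeeting_eq hinv hkm hk ?_ hw fun p' hp' => answerElts_rank_eq hp' hw
    obtain ⟨c, hc, hwc⟩ := hinv.cover w
    rcases List.mem_append.1 hc with hc | hc
    · exact absurd (hwp.2 y hyx) (not_le.2 (hpb.2.2 c hc k (by simp) w hwc y hy))
    rcases List.mem_append.1 hc with hc | hc
    · exact absurd (hwp.2 y hyx) (not_le.2 (hpu.2.2 c hc k (by simp) w hwc y hy))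
    rcases List.mem_cons.1 hc with rfl | hc
    · exact hwc
    · exact absurd hwp.1 (not_le.2 (hv c hc w hwc))

end RankServe

/-! ### The program for a `rank` query -/

section RankServe

variable {n : ℕ}

theorem takeWhile_append_cons_of_known {l : List (Cell n)} (h : ∃ c ∈ l, c.known = true) :
    ∃ k v, l.dropWhile (fun c => !c.known) = k :: v ∧ k.known = true ∧
      l = l.takeWhile (fun c => !c.known) ++ k :: v := by
  have hl := List.takeWhile_append_dropWhile (p := fun c : Cell n => !c.known) (l := l)
  cases hd : l.dropWhile fun c => !c.known with
  | nil =>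
    obtain ⟨c, hc, hk⟩ := h
    rw [List.dropWhile_eq_nil_iff] at hd
    simpa [hk] using hd c hc
  | cons k v =>
    refine ⟨k, v, rfl, ?_, by rw [← hd, hl]⟩
    have := List.head_dropWhile_not (fun c : Cell n => !c.known) (l := l) (by simp [hd])
    simpa [hd] using this

/-- If `x` is covered, all cells before the covering block are below `x`, the unsorted ones
included, so the answer is their total size plus a count inside that block. Otherwise every cell is
entirely on one side of `x`, and sizes suffice. -/
theorem exists_serveRank (s : FSState n) :
    ∃ t : CompTree (Option (Fin n)) (Answer n × FSState n),
      ∀ (α : Type u) [LinearOrder α] (A : Fin n → α) (x : α) (ρ : ℕ),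
      RunsSorted A s.runOf → CellsInv A s.cells → (runsMeeting s.runOf Finset.univ).card ≤ ρ →
      (knownCells s.cells = [] ∨ ∃ c ∈ s.cells, c.known = true ∧ c.elts = s.finger) →
      CorrectAnswer A (.rank x) (t.result fun k => k.elim x A).1 ∧
      (t.result fun k => k.elim x A).2 = fsServe A s (.rank x) ∧
      (knownCells (fsServe A s (.rank x)).cells = [] ∨ ∃ c ∈ (fsServe A s (.rank x)).cells,
        c.known = true ∧ c.elts = (fsServe A s (.rank x)).finger) ∧
      ((t.cost fun k => k.elim x A : ℕ) : ℝ) ≤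
        (potential s.runOf ρ (fsServe A s (.rank x)).cells - potential s.runOf ρ s.cells)
        + (if knownCells s.cells = [] then 0 else 11 * lg (fingerDistance A s (.rank x)))
        + 5 * lg (searchedSize A (fsServe A s (.rank x)) x) := by
  obtain ⟨loop, hloop⟩ := exists_rankLoop.{u} s.runOf n s.cells (fingerIndex s)
  choose search hsearch using exists_blockSearch.{u} (n := n)
  let size : List (Cell n) → ℕ := fun l => (l.map fun c => c.elts.card).sum
  let fin : List (Cell n) × ℕ × Bool → CompTree (Option (Fin n)) (Answer n × FSState n) := fun r =>
    if r.2.2 = true then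
      match (cutAt r.2.1 r.1).2.dropWhile fun c => !c.known with
      | k :: _ => (search k.elts).bind fun m => .done
        (.num (size (cutAt r.2.1 r.1).1 +
          (size ((cutAt r.2.1 r.1).2.takeWhile fun c => !c.known) + m)), ⟨s.runOf, r.1, k.elts⟩)
      | [] => .done (.num 0, s)
    else .done (.num (size (cutAt r.2.1 r.1).1), ⟨s.runOf, r.1,
      -- The answering block is the last one below `x`, or the first block of all if every element
      -- exceeds `x`.
      match (cutAt r.2.1 r.1).1.getLast?, (cutAt r.2.1 r.1).2.head? with
      | some c, _ => c.elts
      | none, some c => c.elts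
      | none, none => ∅⟩)
  refine ⟨loop.bind fin, fun α _ A x ρ hrun hinv hρ hf => ?_⟩
  obtain ⟨l1, l2⟩ := hloop α A x ρ hrun hinv hρ (fingerIndex_le s)
  have hfd := locateCost_fingerIndex_le hinv hf x
  have hinv' : CellsInv A (fsServe A s (.rank x)).cells := hinv.iterate hrun _ n
  have hns := not_mustSplit_fsServe hrun hinv (.rank x)
  have hfinger : (fsServe A s (.rank x)).finger
    = blockMeeting (fsServe A s (.rank x)).cells (answerElts A (.rank x)) := rfl
  have heta : fsServe A s (.rank x) = ⟨s.runOf, (fsServe A s (.rank x)).cells,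
    (fsServe A s (.rank x)).finger⟩ := rfl
  change _ = ((fsServe A s (.rank x)).cells, lowCount A x (fsServe A s (.rank x)).cells,
    decide (Covered A (fsServe A s (.rank x)).cells x)) at l1
  change _ ≤ _ + (potential s.runOf ρ (fsServe A s (.rank x)).cells - _) at l2
  have hss : ∀ c ∈ (fsServe A s (.rank x)).cells, c.known = true → (∃ p ∈ c.elts, A p < x) →
      (∃ p ∈ c.elts, x ≤ A p) → searchedSize A (fsServe A s (.rank x)) x = c.elts.card :=
    fun c hc hk h1 h2 => hinv'.searchedSize_eq hc hk h1 h2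
  have hlg1 : (1 : ℝ) ≤ lg (searchedSize A (fsServe A s (.rank x)) x) := le_max_left _ _
  set cells := (fsServe A s (.rank x)).cells with hcells
  have hloc := located_cutAt (A := A) (x := x) hinv'.nonempty hinv'.pairwise
  have happ := cutAt_append (lowCount A x cells) cells
  set t := lowCount A x cells with ht
  set b := (cutAt t cells).1 with hb
  set a := (cutAt t cells).2 with ha
  simp only [CompTree.result_bind, CompTree.cost_bind, l1]
  have hinv2 : CellsInv A (b ++ a) := by rw [happ]; exact hinv'
  by_cases hcov : Covered A cells x
  · have hcov2 : Covered A (b ++ a) x := by rw [happ]; exact hcov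
    have hex : ∃ c ∈ a, c.known = true := by
      obtain ⟨c, hc, hk, -, p, hp, hxp⟩ := hcov2
      rcases List.mem_append.1 hc with hc | hc
      · exact absurd (hloc.low c hc hk p hp) (not_lt.2 hxp)
      · exact ⟨c, hc, hk⟩
    obtain ⟨k, v, hdrop, hk, hsplit⟩ := takeWhile_append_cons_of_known hex
    set w := a.takeWhile fun c => !c.known with hw
    have hwk : ∀ c ∈ w, c.known = false := fun c hc => by
      simpa using List.mem_takeWhile_imp hc
    have hkm : k ∈ cells := by rw [← happ, hsplit]; simp
    have hkx := hloc.high k (by rw [hsplit]; simp) hk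
    have hcv : numLT A x = size b + (size w + (k.elts.filter fun p => A p < x).card) ∧
        blockMeeting cells (answerElts A (.rank x)) = k.elts := by
      have := Located.covered (b := b) (u := w) (v := v) (k := k) (by rw [← hsplit]; exact hloc)
        (by rw [← hsplit]; exact hinv2) (by rw [← hsplit]; exact hcov2) hwk hk
      rwa [← hsplit, happ] at this
    have hfin : fin (cells, t, decide (Covered A cells x)) = (search k.elts).bind fun m => .done
        (.num (size b + (size w + m)), ⟨s.runOf, cells, k.elts⟩) := by
      simp only [fin, hcov, decide_true, if_true, ← ha, hdrop, ← hb, ← hw]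
    obtain ⟨s1, s2⟩ := hsearch k.elts α A x (hinv'.sorted k hkm hk)
    rw [hfin]
    simp only [CompTree.result_bind, CompTree.cost_bind, s1, CompTree.result_done,
      CompTree.cost_done, add_zero]
    refine ⟨hcv.1.symm, ?_, Or.inr ⟨k, hkm, hk, ?_⟩, ?_⟩
    · rw [heta, hfinger, hcv.2]
    · rw [hfinger, hcv.2]
    · have h3 : ((search k.elts).cost (fun k => k.elim x A) : ℝ)
          ≤ 5 * lg (searchedSize A (fsServe A s (.rank x)) x) := by
        -- If no element of the block is smaller than `x`, one comparison was enough. Otherwise the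
        -- block has elements on both sides of `x`, so its size is the searched size `g`, and `2 log
        -- g + 3 ≤ 5 lg g`.
        split_ifs at s2 with h0
        · have : ((search k.elts).cost (fun k => k.elim x A) : ℝ) ≤ 1 := by exact_mod_cast s2
          linarith
        · have h1 : ∃ p ∈ k.elts, A p < x := by
            obtain ⟨p, hp⟩ := Finset.card_pos.1 (Nat.pos_of_ne_zero h0)
            exact ⟨p, (Finset.mem_filter.1 hp).1, (Finset.mem_filter.1 hp).2⟩
          rw [hss k hkm hk h1 hkx] at hlg1 ⊢
          have h4 : ((search k.elts).cost (fun k => k.elim x A) : ℝ)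
            ≤ 2 * Nat.log 2 k.elts.card + 3 := by exact_mod_cast s2
          have h5 := natLog_le_logb k.elts.card
          have h6 : Real.logb 2 k.elts.card ≤ lg k.elts.card := le_max_right _ _
          linarith
      push_cast
      linarith
  · have hcov2 : ¬ Covered A (b ++ a) x := by rw [happ]; exact hcov
    have hhead : ∀ c ∈ a.head?, c.known = true := by
      intro c hc
      by_contra hk
      obtain ⟨rest, hrest⟩ := List.head?_eq_some_iff.1 hc
      refine hns c (by rw [← happ, hrest]; simp) ?_
      rw [hrest] at happ hloc hinv2 hcov2
      have := hloc.mustSplit_head hinv2 hcov2 (by simpa using hk)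
      rwa [happ] at this
    have hlow : ∀ c ∈ b, ∀ p ∈ c.elts, A p < x := fun c hc =>
      hloc.lt (fun c hc => hinv2.nonempty c (List.mem_append_left _ hc)) hc
    have hhigh : ∀ c ∈ a, ∀ p ∈ c.elts, x < A p := fun c hc =>
      hloc.gt_of_known_head hinv2 hcov2 hhead hc
    have hnum := numLT_eq_sum hinv2 hlow hhigh
    have hbl : ∀ c, c.known = true → b.getLast? = some c ∨ (b = [] ∧ a.head? = some c) →
        blockMeeting cells (answerElts A (.rank x)) = c.elts := fun c hk hc => by
      have := blockMeeting_of_cut hinv2 hlow hhigh hk hc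
      rwa [happ] at this
    have hfin : fin (cells, t, decide (Covered A cells x)) = .done (.num (size b), ⟨s.runOf, cells,
        match b.getLast?, a.head? with
        | some c, _ => c.elts
        | none, some c => c.elts
        | none, none => ∅⟩) := by
      simp only [fin, hcov, decide_false, Bool.false_eq_true, if_false, ← ha, ← hb]
    rw [hfin]
    simp only [CompTree.result_done, CompTree.cost_done, add_zero]
    have hcost : ((loop.cost fun k => k.elim x A : ℕ) : ℝ) ≤
        potential s.runOf ρ cells - potential s.runOf ρ s.cells
        + (if knownCells s.cells = [] then 0 else 11 * lg (fingerDistance A s (.rank x)))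
        + 5 * lg (searchedSize A (fsServe A s (.rank x)) x) := by linarith
    -- The last cell before the cut is identified, as an unsorted one would be followed by an
    -- identified one before the cut. Both lists are empty only when there are no cells at all.
    have hblock : (b = [] ∧ a = []) ∨ ∃ c ∈ cells, c.known = true ∧
        (b.getLast? = some c ∨ (b = [] ∧ a.head? = some c)) := by
      cases hlast : b.getLast? with
      | some c =>
        have hcb := List.mem_of_getLast? hlast
        obtain ⟨b', hb'⟩ := List.getLast?_eq_some_iff.1 hlast
        refine Or.inr ⟨c, happ ▸ List.mem_append_left _ hcb, ?_, Or.inl rfl⟩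
        by_contra hk
        obtain ⟨m, hm, hmk, hcm⟩ := hloc.last c hcb (by simpa using hk)
        obtain ⟨z, hz⟩ := hinv2.nonempty c (List.mem_append_left _ hcb)
        obtain ⟨y, hy⟩ := hinv2.nonempty m (List.mem_append_left _ hm)
        rw [hb'] at hm
        rcases List.mem_append.1 hm with hm | hm
        · have hpw := (List.pairwise_append.1 hinv2.pairwise).1
          rw [hb'] at hpw
          exact lt_asymm (hcm z hz y hy) ((List.pairwise_append.1 hpw).2.2 m hm c (by simp) y hy z hz)
        · rw [List.mem_singleton] at hm
          exact hk (hm ▸ hmk)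
      | none =>
        rw [List.getLast?_eq_none_iff] at hlast
        cases hh : a.head? with
        | some c =>
          exact Or.inr ⟨c, happ ▸ List.mem_append_right _ (List.mem_of_head? hh), hhead c hh,
            Or.inr ⟨hlast, rfl⟩⟩
        | none => exact Or.inl ⟨hlast, List.head?_eq_none_iff.1 hh⟩
    rcases hblock with ⟨h1, h2⟩ | ⟨c, hcm, hk, hc⟩
    · have hnil : cells = [] := by rw [← happ, h1, h2]; rfl
      refine ⟨hnum.symm, ?_, Or.inl ?_, hcost⟩
      · rw [heta, hfinger, h1, h2, hnil]
        rfl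
      · rw [hnil]
        rfl
    · refine ⟨hnum.symm, ?_, Or.inr ⟨c, hcm, hk, by rw [hfinger, hbl c hk hc]⟩, hcost⟩
      rw [heta, hfinger, hbl c hk hc]
      congr 2
      rcases hc with hc | ⟨h1, hc⟩
      · rw [hc]
      · rw [h1, hc]
        rfl

end RankServe

/-! ### Summing up: the bound on the comparisons -/

section Totals

variable {n : ℕ}

/-- Comparing each element with its left neighbour finds all descents. The position `0` is compared
with itself, and the outcome is ignored. -/
theorem exists_preprocess : ∃ t : CompTree (Fin n) (FSState n),
    ∀ (α : Type u) [LinearOrder α] (A : Fin n → α), t.result A = fsInitial A ∧ t.cost A ≤ n := by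
  classical
  let f : Fin n → CompTree (Fin n) Bool := fun p =>
    (CompTree.ask p ⟨p.val - 1, by omega⟩).bind fun o => .done (decide (p.val ≠ 0 ∧ o = .lt))
  refine ⟨(CompTree.collect f Finset.univ).bind fun g => .done
    { runOf := fun p => (Finset.univ.filter fun p' : Fin n => p' ≤ p ∧ g p' = true).card
      cells := if n = 0 then [] else [⟨false, Finset.univ⟩]
      finger := ∅ }, fun α _ A => ⟨?_, ?_⟩⟩
  · rw [CompTree.result_bind]
    simp only [CompTree.result_done, fsInitial, FSState.mk.injEq, and_self, and_true]
    funext p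
    unfold runIndex
    congr 1
    ext p'
    simp only [Finset.mem_filter, Finset.mem_univ, true_and, and_congr_right_iff]
    intro _
    rw [CompTree.result_collect A f Finset.univ (Finset.mem_univ p')]
    simp only [f, CompTree.result_bind, CompTree.result_ask, CompTree.result_done,
      decide_eq_true_eq, cmp_eq_lt_iff]
    constructor
    · rintro ⟨h0, h⟩
      exact ⟨⟨p'.val - 1, by omega⟩, by simp only; omega, h⟩
    · rintro ⟨p'', h0, h⟩
      have : p'' = ⟨p'.val - 1, by omega⟩ := Fin.ext (by simp only; omega)
      exact ⟨by omega, this ▸ h⟩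
  · rw [CompTree.cost_bind, CompTree.cost_collect]
    simp [f]

variable {α : Type u} [LinearOrder α]

theorem lg_nonneg (d : ℕ) : 0 ≤ lg d := zero_le_one.trans (le_max_left _ _)

/-- What is needed of the two query programs. -/
def Serves (D : DeferredDS n) (A : Fin n → α) : Prop :=
  ∀ (s : FSState n) (ρ : ℕ) (q : Query n α),
    RunsSorted A s.runOf → CellsInv A s.cells → (runsMeeting s.runOf Finset.univ).card ≤ ρ →
    (knownCells s.cells = [] ∨ ∃ c ∈ s.cells, c.known = true ∧ c.elts = s.finger) →
    CorrectAnswer A q (D.serve A s q).1 ∧ (D.serve A s q).2 = fsServe A s q ∧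
    (knownCells (fsServe A s q).cells = [] ∨ ∃ c ∈ (fsServe A s q).cells,
      c.known = true ∧ c.elts = (fsServe A s q).finger) ∧
    (D.serveCost A s q : ℝ) ≤
      (potential s.runOf ρ (fsServe A s q).cells - potential s.runOf ρ s.cells)
      + (if knownCells s.cells = [] then 0 else 11 * lg (fingerDistance A s q))
      + 5 * ((searchedSizes A s [q]).map lg).sum

theorem searchedSizes_cons (A : Fin n → α) (s : FSState n) (q : Query n α) (qs : List (Query n α)) :
    searchedSizes A s (q :: qs) = searchedSizes A s [q] ++ searchedSizes A (fsServe A s q) qs := by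
  cases q <;> rfl

theorem sum_map_lg_nonneg (l : List ℕ) : 0 ≤ (l.map lg).sum :=
  List.sum_nonneg fun x hx => by
    obtain ⟨d, -, rfl⟩ := List.mem_map.1 hx
    exact lg_nonneg d

theorem sum_map_lg_tail_le (l : List ℕ) : (l.tail.map lg).sum ≤ (l.map lg).sum := by
  cases l with
  | nil => simp
  | cons a l => simpa using lg_nonneg a

/-- The potential differences telescope. A query asked when no block is identified has no finger
term, which is why the first distance is dropped in that case. -/
theorem Serves.serveAll {D : DeferredDS n} {A : Fin n → α} (hD : Serves D A) (qs : List (Query n α))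
    {s : FSState n} {ρ : ℕ} (hrun : RunsSorted A s.runOf) (hinv : CellsInv A s.cells)
    (hρ : (runsMeeting s.runOf Finset.univ).card ≤ ρ)
    (hf : knownCells s.cells = [] ∨ ∃ c ∈ s.cells, c.known = true ∧ c.elts = s.finger) :
    List.Forall₂ (CorrectAnswer A) qs (D.answersFrom A s qs) ∧
      qs.foldl (fun s q => (D.serve A s q).2) s = qs.foldl (fsServe A) s ∧
      (D.costFrom A s qs : ℝ) ≤
        (potential s.runOf ρ (qs.foldl (fsServe A) s).cells - potential s.runOf ρ s.cells)
        + 11 * ((if knownCells s.cells = [] then (fingerDistances A s qs).tail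
            else fingerDistances A s qs).map lg).sum
        + 5 * ((searchedSizes A s qs).map lg).sum := by
  induction qs generalizing s with
  | nil => simp [DeferredDS.answersFrom, DeferredDS.costFrom, fingerDistances, searchedSizes]
  | cons q qs ih =>
    obtain ⟨h1, h2, h3, h4⟩ := hD s ρ q hrun hinv hρ hf
    obtain ⟨i1, i2, i3⟩ := ih (s := fsServe A s q) hrun (hinv.iterate hrun q n) hρ h3
    refine ⟨?_, ?_, ?_⟩
    · simp only [DeferredDS.answersFrom, h2]
      exact List.Forall₂.cons h1 i1
    · simp only [List.foldl_cons, h2]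
      exact i2
    · rw [searchedSizes_cons, List.map_append, List.sum_append]
      simp only [DeferredDS.costFrom, h2, List.foldl_cons, fingerDistances, List.tail_cons]
      have h5 : ((if knownCells (fsServe A s q).cells = []
            then (fingerDistances A (fsServe A s q) qs).tail
            else fingerDistances A (fsServe A s q) qs).map lg).sum
          ≤ ((fingerDistances A (fsServe A s q) qs).map lg).sum := by
        split_ifs
        · exact sum_map_lg_tail_le _
        · exact le_rfl
      have h6 : 11 * ((if knownCells s.cells = [] then fingerDistances A (fsServe A s q) qs
            else fingerDistance A s q :: fingerDistances A (fsServe A s q) qs).map lg).sum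
          = (if knownCells s.cells = [] then 0 else 11 * lg (fingerDistance A s q))
            + 11 * ((fingerDistances A (fsServe A s q) qs).map lg).sum := by
        split_ifs
        · rw [zero_add]
        · rw [List.map_cons, List.sum_cons, mul_add]
      have hr : (fsServe A s q).runOf = s.runOf := rfl
      rw [hr] at i3
      push_cast
      linarith

/-- The part of the bound that depends on the final state. -/
noncomputable def stateBound (ρ : ℕ) (s : FSState n) : ℝ :=
  sumLogSelectionBlocks s + numSelectionBlocks s * Real.logb 2 ρ
    - sumPivotBlocks s - sumUnsortedRuns s

noncomputable def cellLog (runOf : Fin n → ℕ) (T : Finset (Fin n)) : ℝ :=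
  ∑ r ∈ runsMeeting runOf T, Real.logb 2 (runPart runOf T r).card

/-- Every cell is either identified or unsorted, so the two subtracted sums together subtract `k log
k` for each cell. -/
theorem stateBound_eq (ρ : ℕ) (s : FSState n) : stateBound ρ s = (s.cells.map fun c =>
    cellLog s.runOf c.elts + runEntropy ρ (runsMeeting s.runOf c.elts).card).sum := by
  simp only [stateBound, sumLogSelectionBlocks, numSelectionBlocks, sumPivotBlocks,
    sumUnsortedRuns, cellLog]
  induction s.cells with
  | nil => simp
  | cons c l ih =>
    simp only [List.map_cons, List.sum_cons, List.filter_cons, runEntropy] at ih ⊢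
    rcases c.known with _ | _ <;>
      simp only [Bool.not_false, Bool.not_true, if_true, Bool.false_eq_true, if_false,
        List.map_cons, List.sum_cons] <;>
      push_cast at ih ⊢ <;> linarith

theorem runPart_card_pos {runOf : Fin n → ℕ} {T : Finset (Fin n)} {r : ℕ}
    (hr : r ∈ runsMeeting runOf T) : 0 < (runPart runOf T r).card := by
  obtain ⟨p, hp, h⟩ := mem_runsMeeting.1 hr
  exact Finset.card_pos.2 ⟨p, mem_runPart.2 ⟨hp, h⟩⟩

theorem cellLog_nonneg (runOf : Fin n → ℕ) (T : Finset (Fin n)) : 0 ≤ cellLog runOf T :=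
  Finset.sum_nonneg fun _ hr =>
    Real.logb_nonneg (by norm_num) (by exact_mod_cast runPart_card_pos hr)

theorem cellWeight_eq_cellLog (runOf : Fin n → ℕ) (T : Finset (Fin n)) :
    cellWeight runOf T = 2 * cellLog runOf T + 2 * (runsMeeting runOf T).card := by
  rw [cellWeight, cellLog, Finset.mul_sum]
  rw [Finset.sum_congr rfl fun r hr => by
    rw [blockWeight, if_neg (runPart_card_pos hr).ne']]
  rw [Finset.sum_add_distrib]
  simp [mul_comm]

theorem card_runsMeeting_le (runOf : Fin n → ℕ) {ρ : ℕ}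
    (hρ : (runsMeeting runOf Finset.univ).card ≤ ρ) (T : Finset (Fin n)) :
    (runsMeeting runOf T).card ≤ ρ :=
  (Finset.card_le_card (runsMeeting_mono runOf (Finset.subset_univ _))).trans hρ

theorem cellPotential_nonneg {runOf : Fin n → ℕ} {ρ : ℕ}
    (hρ : (runsMeeting runOf Finset.univ).card ≤ ρ) (c : Cell n) : 0 ≤ cellPotential runOf ρ c := by
  have h1 := runEntropy_nonneg (card_runsMeeting_le runOf hρ c.elts)
  have h2 := cellLog_nonneg runOf c.elts
  have h3 : (0 : ℝ) ≤ (runsMeeting runOf c.elts).card := Nat.cast_nonneg _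
  rw [cellPotential, cellWeight_eq_cellLog]
  split_ifs <;> linarith

theorem potential_nonneg {runOf : Fin n → ℕ} {ρ : ℕ}
    (hρ : (runsMeeting runOf Finset.univ).card ≤ ρ) (cells : List (Cell n)) :
    0 ≤ potential runOf ρ cells := List.sum_nonneg fun x hx => by
  obtain ⟨c, -, rfl⟩ := List.mem_map.1 hx
  exact cellPotential_nonneg hρ c

theorem CellsInv.sum_runs_le {A : Fin n → α} {cells : List (Cell n)} (h : CellsInv A cells)
    (runOf : Fin n → ℕ) : (cells.map fun c => ((runsMeeting runOf c.elts).card : ℝ)).sum ≤ n := by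
  have h1 : (cells.map fun c => (runsMeeting runOf c.elts).card).sum ≤ n := by
    conv_rhs => rw [← h.sum_card]
    exact List.sum_le_sum fun c _ => Finset.card_image_le
  have h2 : ((cells.map fun c => (runsMeeting runOf c.elts).card).sum : ℝ)
      = (cells.map fun c => ((runsMeeting runOf c.elts).card : ℝ)).sum := by
    rw [Nat.cast_list_sum, List.map_map]
    rfl
  rw [← h2]
  exact_mod_cast h1

/-- `2402 = 2 + 2 * 1200` is the largest coefficient of the number of runs in the potential of a
cell, and there are at most `n` selection blocks. -/
theorem potential_le_stateBound {A : Fin n → α} {s : FSState n} (h : CellsInv A s.cells) {ρ : ℕ}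
    (hρ : (runsMeeting s.runOf Finset.univ).card ≤ ρ) :
    potential s.runOf ρ s.cells ≤ 1200 * stateBound ρ s + 2402 * n := by
  have h1 := h.sum_runs_le s.runOf
  have h2 : potential s.runOf ρ s.cells ≤ (s.cells.map fun c =>
      1200 * (cellLog s.runOf c.elts + runEntropy ρ (runsMeeting s.runOf c.elts).card)
      + 2402 * ((runsMeeting s.runOf c.elts).card : ℝ)).sum := by
    refine List.sum_le_sum fun c _ => ?_
    have h1 := runEntropy_nonneg (card_runsMeeting_le s.runOf hρ c.elts)
    have h2 := cellLog_nonneg s.runOf c.elts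
    have h3 : (0 : ℝ) ≤ (runsMeeting s.runOf c.elts).card := Nat.cast_nonneg _
    rw [cellPotential, cellWeight_eq_cellLog]
    split_ifs <;> linarith
  rw [List.sum_map_add, List.sum_map_mul_left, List.sum_map_mul_left, ← stateBound_eq] at h2
  linarith

theorem fsState_invariant (A : Fin n → α) (qs : List (Query n α)) :
    (fsState A qs).runOf = runIndex A ∧ CellsInv A (fsState A qs).cells := by
  have key : ∀ (qs : List (Query n α)) (s : FSState n), RunsSorted A s.runOf → CellsInv A s.cells →
      (qs.foldl (fsServe A) s).runOf = s.runOf ∧ CellsInv A (qs.foldl (fsServe A) s).cells := by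
    intro qs
    induction qs with
    | nil => exact fun s _ hs => ⟨rfl, hs⟩
    | cons q qs ih => exact fun s hr hs => ih (fsServe A s q) hr (hs.iterate hr q n)
  exact key qs _ (runsSorted_runIndex A) (cellsInv_initial A)

/-- One more `n` for the preprocessing gives `2403`. The initial potential is nonnegative and may be
dropped. -/
theorem Serves.total {D : DeferredDS n} {A : Fin n → α} (hD : Serves D A)
    (hpre : D.preprocess.result A = fsInitial A) (hcost : D.preprocess.cost A ≤ n)
    (qs : List (Query n α)) :
    List.Forall₂ (CorrectAnswer A) qs (D.answers A qs) ∧ D.finalState A qs = fsState A qs ∧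
      (D.comparisons A qs : ℝ) ≤ 2403 * synergisticBound A qs := by
  have hrun : RunsSorted A (fsInitial A).runOf := runsSorted_runIndex A
  have hinv := cellsInv_initial A
  have hρ : (runsMeeting (fsInitial A).runOf Finset.univ).card ≤ numRuns A := le_rfl
  have hK : knownCells (fsInitial A).cells = [] := by
    unfold fsInitial knownCells
    dsimp only
    split_ifs <;> rfl
  obtain ⟨h1, h2, h3⟩ := hD.serveAll qs hrun hinv hρ (Or.inl hK)
  rw [if_pos hK] at h3
  rw [DeferredDS.answers, DeferredDS.finalState, DeferredDS.comparisons, hpre]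
  refine ⟨h1, h2, ?_⟩
  obtain ⟨hrunOf, hfin⟩ := fsState_invariant A qs
  change _ ≤ potential _ _ (fsState A qs).cells - _ + _ + _ at h3
  change (fsState A qs).runOf = (fsInitial A).runOf at hrunOf
  have h4 := potential_le_stateBound hfin (ρ := numRuns A) (by rw [hrunOf]; exact hρ)
  have h5 := potential_nonneg hρ (fsInitial A).cells
  have h6 : 0 ≤ stateBound (numRuns A) (fsState A qs) := by
    rw [stateBound_eq, hrunOf]
    refine List.sum_nonneg fun x hx => ?_
    obtain ⟨c, -, rfl⟩ := List.mem_map.1 hx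
    exact add_nonneg (cellLog_nonneg _ _) (runEntropy_nonneg (card_runsMeeting_le _ hρ c.elts))
  have h7 : synergisticBound A qs = n + stateBound (numRuns A) (fsState A qs)
      + ((fingerDistances A (fsInitial A) qs).tail.map lg).sum
      + ((searchedSizes A (fsInitial A) qs).map lg).sum := by
    unfold synergisticBound stateBound
    ring
  have h8 := sum_map_lg_nonneg (fingerDistances A (fsInitial A) qs).tail
  have h9 := sum_map_lg_nonneg (searchedSizes A (fsInitial A) qs)
  have h10 : (D.preprocess.cost A : ℝ) ≤ n := by exact_mod_cast hcost
  rw [hrunOf] at h4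
  rw [h7]
  push_cast
  linarith

theorem exists_deferredDS (n : ℕ) : ∃ D : DeferredDS n,
    ∀ (α : Type u) [LinearOrder α] (A : Fin n → α),
      D.preprocess.result A = fsInitial A ∧ D.preprocess.cost A ≤ n ∧ Serves D A := by
  obtain ⟨pre, hpre⟩ := exists_preprocess.{u} (n := n)
  choose sel hsel using exists_serveSelect.{u} (n := n)
  choose rk hrk using exists_serveRank.{u} (n := n)
  refine ⟨⟨pre, sel, rk⟩, fun α _ A => ⟨(hpre α A).1, (hpre α A).2, ?_⟩⟩
  rintro s ρ (i | x) hrun hinv hρ hf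
  · obtain ⟨h1, h2, h3, h4⟩ := hsel s i α A ρ hrun hinv hρ
    refine ⟨h1, h2, Or.inr h3, ?_⟩
    have h5 : (0 : ℝ) ≤ if knownCells s.cells = [] then 0
        else 11 * lg (fingerDistance A s (.select i)) := by
      split_ifs
      · exact le_rfl
      · exact mul_nonneg (by norm_num) (lg_nonneg _)
    have h6 := sum_map_lg_nonneg (searchedSizes A s [.select i])
    change ((sel s i).cost A : ℝ) ≤ _
    linarith
  · obtain ⟨h1, h2, h3, h4⟩ := hrk s α A x ρ hrun hinv hρ hf
    refine ⟨h1, h2, h3, ?_⟩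
    change ((rk s).cost (fun k => k.elim x A) : ℝ) ≤ _
    simpa [searchedSizes] using h4

end Totals

/-! ### Estimates for runs inside a gap -/

section GapPotential

/-- `k ^ (3/4) * Δ ^ (1/4)`. -/
noncomputable def fourthRootMean (Δ : ℝ) (k : ℕ) : ℝ := √k * √√(k * Δ)

theorem fourthRootMean_zero (Δ : ℝ) : fourthRootMean Δ 0 = 0 := by simp [fourthRootMean]

theorem fourthRootMean_nonneg (Δ : ℝ) (k : ℕ) : 0 ≤ fourthRootMean Δ k :=
  mul_nonneg (Real.sqrt_nonneg _) (Real.sqrt_nonneg _)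

theorem fourthRootMean_mono {Δ : ℝ} (hΔ : 0 ≤ Δ) {k m : ℕ} (h : k ≤ m) :
    fourthRootMean Δ k ≤ fourthRootMean Δ m := by
  have h' : (k : ℝ) ≤ m := by exact_mod_cast h
  exact mul_le_mul (Real.sqrt_le_sqrt h') (Real.sqrt_le_sqrt (Real.sqrt_le_sqrt
    (mul_le_mul_of_nonneg_right h' hΔ))) (Real.sqrt_nonneg _) (Real.sqrt_nonneg _)

theorem fourthRootMean_le {Δ : ℝ} {k : ℕ} (h : k ≤ Δ) : fourthRootMean Δ k ≤ √Δ * √k := by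
  have h0 : (0 : ℝ) ≤ Δ := (Nat.cast_nonneg k).trans h
  rw [fourthRootMean, mul_comm (√Δ)]
  refine mul_le_mul_of_nonneg_left (Real.sqrt_le_sqrt ?_) (Real.sqrt_nonneg _)
  calc √(k * Δ) ≤ √(Δ * Δ) := Real.sqrt_le_sqrt (mul_le_mul_of_nonneg_right h h0)
    _ = Δ := Real.sqrt_mul_self h0

/-- With `Δ / k = z ^ 4` the logarithm is `4 ln z / ln 2 ≤ 6 z`. This trades the logarithm for a
power for which partitioning steps can be charged. -/
theorem mul_logb_div_le {Δ : ℝ} {k : ℕ} (h : k ≤ Δ) :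
    k * Real.logb 2 (Δ / k) ≤ 6 * fourthRootMean Δ k := by
  rcases Nat.eq_zero_or_pos k with rfl | hk
  · simp [fourthRootMean]
  have hk' : (0 : ℝ) < k := by exact_mod_cast hk
  have hΔ : 0 < Δ := hk'.trans_le h
  set z := √√(Δ / k) with hz
  have hy : 0 < Δ / k := div_pos hΔ hk'
  have hz0 : 0 < z := Real.sqrt_pos.2 (Real.sqrt_pos.2 hy)
  have hz4 : Δ / k = z ^ 4 := by
    have h1 : z ^ 2 = √(Δ / k) := Real.sq_sqrt (Real.sqrt_nonneg _)
    have h2 : √(Δ / k) ^ 2 = Δ / k := Real.sq_sqrt hy.le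
    rw [← h2, ← h1]
    ring
  have hf : fourthRootMean Δ k = k * z := by
    have h1 : (k : ℝ) * Δ = k ^ 2 * (Δ / k) := by field_simp
    rw [fourthRootMean, h1, Real.sqrt_mul (by positivity), Real.sqrt_sq hk'.le,
      Real.sqrt_mul hk'.le, ← mul_assoc, Real.mul_self_sqrt hk'.le]
  have hlog : Real.logb 2 (Δ / k) ≤ 6 * z := by
    rw [hz4, Real.logb, div_le_iff₀ (Real.log_pos (by norm_num)), Real.log_pow]
    have h1 := Real.log_le_sub_one_of_pos hz0
    have h2 := Real.log_two_gt_d9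
    push_cast
    nlinarith
  rw [hf]
  calc k * Real.logb 2 (Δ / k) ≤ k * (6 * z) := mul_le_mul_of_nonneg_left hlog hk'.le
    _ = 6 * (k * z) := by ring

/-- The decrease of `√V` when `V ≤ √(k Δ)` drops by `0.145 k`. -/
theorem fourthRootMean_le_sqrt_sub {Δ v v' : ℝ} (hv' : 0 ≤ v') {k : ℕ}
    (h1 : 0.145 * k ≤ v - v') (h2 : v ≤ √(k * Δ)) :
    64 * √Δ * √v' + 4 * fourthRootMean Δ k ≤ 64 * √Δ * √v := by
  have hk0 : (0 : ℝ) ≤ k := Nat.cast_nonneg k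
  have hvv : v' ≤ v := by linarith
  have hv : 0 ≤ v := hv'.trans hvv
  have e1 : √v * √v = v := Real.mul_self_sqrt hv
  have e2 : √v' * √v' = v' := Real.mul_self_sqrt hv'
  have e3 : √v' ≤ √v := Real.sqrt_le_sqrt hvv
  have e4 : √v ≤ √√(k * Δ) := Real.sqrt_le_sqrt h2
  set w := √√(k * Δ) with hw
  have e5 : w * w = √k * √Δ := by
    rw [hw, Real.mul_self_sqrt (Real.sqrt_nonneg _), Real.sqrt_mul hk0]
  have e6 : √(k : ℝ) * √k = k := Real.mul_self_sqrt hk0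
  have p1 : 0 ≤ √v' := Real.sqrt_nonneg _
  have p2 : 0 ≤ w := Real.sqrt_nonneg _
  have p3 : 0 ≤ √Δ := Real.sqrt_nonneg _
  have p4 : 0 ≤ √(k : ℝ) := Real.sqrt_nonneg _
  -- From `v - v' = (√v - √v') (√v + √v')`, where both roots are at most `w`, the fourth root of `k
  -- Δ`.
  have key : 0.145 * k ≤ (√v - √v') * (2 * w) := by
    calc 0.145 * (k : ℝ) ≤ (√v - √v') * (√v + √v') := by linarith [mul_comm (√v) (√v')]
      _ ≤ _ := mul_le_mul_of_nonneg_left (by linarith) (by linarith)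
  rcases p2.eq_or_lt with hw0 | hw0
  · have hf : fourthRootMean Δ k = 0 := by rw [fourthRootMean, ← hw, ← hw0, mul_zero]
    rw [hf]
    nlinarith
  · have hgoal : 4 * (√k * w) ≤ 64 * √Δ * (√v - √v') := by
      refine le_of_mul_le_mul_right ?_ (by linarith : 0 < 2 * w)
      calc 4 * (√k * w) * (2 * w) = 8 * √k * (w * w) := by ring
        _ = 8 * (√Δ * (√k * √k)) := by rw [e5]; ring
        _ = 8 * (√Δ * k) := by rw [e6]
        _ ≤ 64 * √Δ * (0.145 * k) := by
          have := mul_nonneg p3 hk0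
          linarith
        _ ≤ 64 * √Δ * ((√v - √v') * (2 * w)) := mul_le_mul_of_nonneg_left key (by linarith)
        _ = _ := by ring
    have hf : fourthRootMean Δ k = √k * w := rfl
    rw [hf]
    linarith

variable {n : ℕ}

/-- The sum of the square roots of the sizes of the parts of `T` in the runs. -/
noncomputable def sqrtWeight (runOf : Fin n → ℕ) (T : Finset (Fin n)) : ℝ :=
  ∑ r ∈ runsMeeting runOf T, √(runPart runOf T r).card

theorem sqrtWeight_nonneg (runOf : Fin n → ℕ) (T : Finset (Fin n)) : 0 ≤ sqrtWeight runOf T :=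
  Finset.sum_nonneg fun _ _ => Real.sqrt_nonneg _

theorem sqrtWeight_eq_sum (runOf : Fin n → ℕ) {T S : Finset (Fin n)} (h : T ⊆ S) :
    sqrtWeight runOf T = ∑ r ∈ runsMeeting runOf S, √(runPart runOf T r).card := by
  refine Finset.sum_subset (runsMeeting_mono runOf h) fun r _ hr => ?_
  simp [runPart_eq_empty hr]

theorem runPart_subset_runPart (runOf : Fin n → ℕ) {T S : Finset (Fin n)} (h : T ⊆ S) (r : ℕ) :
    runPart runOf T r ⊆ runPart runOf S r := Finset.filter_subset_filter _ h

theorem sqrtWeight_mono (runOf : Fin n → ℕ) {T S : Finset (Fin n)} (h : T ⊆ S) :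
    sqrtWeight runOf T ≤ sqrtWeight runOf S := by
  rw [sqrtWeight_eq_sum runOf h]
  exact Finset.sum_le_sum fun r _ => Real.sqrt_le_sqrt
    (by exact_mod_cast Finset.card_le_card (runPart_subset_runPart runOf h r))

theorem card_runsMeeting_le_sqrtWeight (runOf : Fin n → ℕ) (T : Finset (Fin n)) :
    ((runsMeeting runOf T).card : ℝ) ≤ sqrtWeight runOf T := by
  rw [sqrtWeight, Finset.card_eq_sum_ones]
  push_cast
  exact Finset.sum_le_sum fun r hr => Real.one_le_sqrt.2 (by exact_mod_cast runPart_card_pos hr)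

theorem sum_card_runPart (runOf : Fin n → ℕ) (T : Finset (Fin n)) :
    ∑ r ∈ runsMeeting runOf T, (runPart runOf T r).card = T.card :=
  (Finset.card_eq_sum_card_image runOf T).symm

/-- Cauchy–Schwarz over the runs that meet `T`. -/
theorem sqrtWeight_le (runOf : Fin n → ℕ) (T : Finset (Fin n)) {Δ : ℝ} (h : T.card ≤ Δ) :
    sqrtWeight runOf T ≤ √((runsMeeting runOf T).card * Δ) := by
  refine Real.le_sqrt_of_sq_le ?_
  calc sqrtWeight runOf T ^ 2
      ≤ (runsMeeting runOf T).card * ∑ r ∈ runsMeeting runOf T, √(runPart runOf T r).card ^ 2 :=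
        sq_sum_le_card_mul_sum_sq
    _ = (runsMeeting runOf T).card * (T.card : ℝ) := by
        rw [← sum_card_runPart runOf T]
        push_cast
        congr 1
        exact Finset.sum_congr rfl fun r _ => Real.sq_sqrt (Nat.cast_nonneg _)
    _ ≤ _ := mul_le_mul_of_nonneg_left h (Nat.cast_nonneg _)

/-- When half of the runs lose half of their elements, the weight drops. -/
theorem sqrtWeight_drop (runOf : Fin n → ℕ) {S N I : Finset (Fin n)} (hN : N ⊆ S)
    (hI : S \ N ⊆ I) {H : Finset ℕ} (hH : H ⊆ runsMeeting runOf S)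
    (hhalf : (runsMeeting runOf S).card ≤ 2 * H.card)
    (hlose : ∀ r ∈ H, (runPart runOf S r).card ≤ 2 * (runPart runOf S r \ N).card) :
    0.145 * ((runsMeeting runOf S).card : ℝ)
      ≤ sqrtWeight runOf (S ∩ I) - sqrtWeight runOf (N ∩ I) := by
  have hsub : N ∩ I ⊆ S ∩ I := Finset.inter_subset_inter_right hN
  have hmem : ∀ r ∈ H, ∃ p ∈ runPart runOf S r \ N, p ∈ S ∩ I := by
    intro r hr
    have h1 := runPart_card_pos (hH hr)
    have h2 := hlose r hr
    obtain ⟨p, hp⟩ := Finset.card_pos.1 (show 0 < (runPart runOf S r \ N).card by omega)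
    obtain ⟨hp1, hp2⟩ := Finset.mem_sdiff.1 hp
    have hpS := (mem_runPart.1 hp1).1
    exact ⟨p, hp, Finset.mem_inter.2 ⟨hpS, hI (Finset.mem_sdiff.2 ⟨hpS, hp2⟩)⟩⟩
  have hHsub : H ⊆ runsMeeting runOf (S ∩ I) := fun r hr => by
    obtain ⟨p, hp, hpT⟩ := hmem r hr
    exact mem_runsMeeting.2 ⟨p, hpT, (mem_runPart.1 (Finset.mem_sdiff.1 hp).1).2⟩
  -- At most half of the elements in the interval remain, `√(1 / 2) < 0.71`, and the part was
  -- nonempty, so its root drops by at least `0.29`. At least half of the runs do so, whence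
  -- `0.145`.
  have hrun : ∀ r ∈ H, (0.29 : ℝ)
      ≤ √(runPart runOf (S ∩ I) r).card - √(runPart runOf (N ∩ I) r).card := by
    intro r hr
    have hcard : (runPart runOf (N ∩ I) r).card + (runPart runOf S r \ N).card
        ≤ (runPart runOf (S ∩ I) r).card := by
      rw [← Finset.card_union_of_disjoint]
      · refine Finset.card_le_card (Finset.union_subset (runPart_subset_runPart runOf hsub r) ?_)
        intro p hp
        obtain ⟨hp1, hp2⟩ := Finset.mem_sdiff.1 hp
        obtain ⟨hpS, hpr⟩ := mem_runPart.1 hp1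
        exact mem_runPart.2 ⟨Finset.mem_inter.2 ⟨hpS, hI (Finset.mem_sdiff.2 ⟨hpS, hp2⟩)⟩, hpr⟩
      · exact Finset.disjoint_left.2 fun p hp hp' => (Finset.mem_sdiff.1 hp').2
          (Finset.mem_inter.1 (mem_runPart.1 hp).1).1
    have h1 := hlose r hr
    have h2 := runPart_card_pos (hHsub hr)
    have h3 := Finset.card_le_card (runPart_subset_runPart runOf
      (Finset.inter_subset_left : S ∩ I ⊆ S) r)
    set t := (runPart runOf (S ∩ I) r).card
    set t' := (runPart runOf (N ∩ I) r).card
    have h4 : (t' : ℝ) ≤ 0.71 ^ 2 * t := by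
      have : (2 * t' : ℝ) ≤ t := by exact_mod_cast (by omega : 2 * t' ≤ t)
      have h0 : (0 : ℝ) ≤ t := Nat.cast_nonneg t
      norm_num
      linarith
    have h5 : √(t' : ℝ) ≤ 0.71 * √t := by
      calc √(t' : ℝ) ≤ √(0.71 ^ 2 * t) := Real.sqrt_le_sqrt h4
        _ = 0.71 * √t := by rw [Real.sqrt_mul (by norm_num), Real.sqrt_sq (by norm_num)]
    have h6 : (1 : ℝ) ≤ √t := Real.one_le_sqrt.2 (by exact_mod_cast h2)
    linarith
  rw [sqrtWeight_eq_sum runOf hsub, sqrtWeight, ← Finset.sum_sub_distrib]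
  have hc : ((runsMeeting runOf S).card : ℝ) ≤ 2 * H.card := by exact_mod_cast hhalf
  calc 0.145 * ((runsMeeting runOf S).card : ℝ) ≤ H.card * 0.29 := by linarith
    _ = ∑ _r ∈ H, (0.29 : ℝ) := by rw [Finset.sum_const, nsmul_eq_mul]
    _ ≤ ∑ r ∈ H, (√(runPart runOf (S ∩ I) r).card - √(runPart runOf (N ∩ I) r).card) :=
        Finset.sum_le_sum hrun
    _ ≤ _ := Finset.sum_le_sum_of_subset_of_nonneg hHsub fun r _ _ => sub_nonneg.2
        (Real.sqrt_le_sqrt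
          (Nat.cast_le.2 (Finset.card_le_card (runPart_subset_runPart runOf hsub r))))

end GapPotential

/-! ### The potential of a gap does not increase in a partitioning step -/

section GapStep

variable {n : ℕ}

/-- The elements with ranks in `[a, b)`. -/
def rankInterval (rk : Fin n → ℕ) (a b : ℕ) : Finset (Fin n) :=
  Finset.univ.filter fun p => a ≤ rk p ∧ rk p < b

theorem mem_rankInterval {rk : Fin n → ℕ} {a b : ℕ} {p : Fin n} :
    p ∈ rankInterval rk a b ↔ a ≤ rk p ∧ rk p < b := by simp [rankInterval]

/-- The elements of `T` surround the interval `[a, b)` of ranks. -/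
def Surrounds (rk : Fin n → ℕ) (a b : ℕ) (T : Finset (Fin n)) : Prop :=
  (∃ p ∈ T, rk p < a) ∧ ∃ p ∈ T, b ≤ rk p

open Classical in
/-- A bound for the number of runs with which the cell `c` and all cells that can still be made out
of it contribute inside the interval `[a, b)` of ranks, if no query falls into the interval. -/
noncomputable def gapPotential (runOf rk : Fin n → ℕ) (a b : ℕ) (Δ : ℝ) (c : Cell n) : ℝ :=
  -- Such cells are final as long as the queries avoid the interval.
  if c.known = true ∨ c.elts ⊆ rankInterval rk a b then
    fourthRootMean Δ (runsMeeting runOf (c.elts ∩ rankInterval rk a b)).card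
  -- `320 = 5 * 64`: a step makes at most five cells, and a cell that does not surround the interval
  -- has potential at most `64 * Δ`.
  else if Surrounds rk a b c.elts then 320 * Δ
  else 64 * √Δ * √(sqrtWeight runOf (c.elts ∩ rankInterval rk a b))

variable {runOf rk : Fin n → ℕ} {a b : ℕ} {Δ : ℝ}

theorem card_runsMeeting_inter_le (hΔ : ((rankInterval rk a b).card : ℝ) ≤ Δ)
    (T : Finset (Fin n)) :
    ((runsMeeting runOf (T ∩ rankInterval rk a b)).card : ℝ) ≤ Δ := by
  refine le_trans ?_ hΔ
  exact_mod_cast Finset.card_image_le.trans (Finset.card_le_card Finset.inter_subset_right)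

theorem fourthRootMean_runs_le (hΔ : ((rankInterval rk a b).card : ℝ) ≤ Δ) (T : Finset (Fin n)) :
    fourthRootMean Δ (runsMeeting runOf (T ∩ rankInterval rk a b)).card
      ≤ √Δ * √(sqrtWeight runOf (T ∩ rankInterval rk a b)) :=
  (fourthRootMean_le (card_runsMeeting_inter_le hΔ T)).trans
    (mul_le_mul_of_nonneg_left (Real.sqrt_le_sqrt (card_runsMeeting_le_sqrtWeight _ _))
      (Real.sqrt_nonneg _))

theorem sqrt_mul_sqrt_sqrtWeight_le (hΔ : ((rankInterval rk a b).card : ℝ) ≤ Δ)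
    (T : Finset (Fin n)) : √Δ * √(sqrtWeight runOf (T ∩ rankInterval rk a b)) ≤ Δ := by
  have h0 : 0 ≤ Δ := (Nat.cast_nonneg _).trans hΔ
  have h1 : ((T ∩ rankInterval rk a b).card : ℝ) ≤ Δ := le_trans
    (by exact_mod_cast Finset.card_le_card Finset.inter_subset_right) hΔ
  have h2 : sqrtWeight runOf (T ∩ rankInterval rk a b) ≤ Δ := by
    refine (sqrtWeight_le runOf _ h1).trans ?_
    calc _ ≤ √(Δ * Δ) := Real.sqrt_le_sqrt
          (mul_le_mul_of_nonneg_right (card_runsMeeting_inter_le hΔ T) h0)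
      _ = Δ := Real.sqrt_mul_self h0
  calc _ ≤ √Δ * √Δ := mul_le_mul_of_nonneg_left (Real.sqrt_le_sqrt h2) (Real.sqrt_nonneg _)
    _ = Δ := Real.mul_self_sqrt h0

theorem gapPotential_le_of_not_surrounds (hΔ : ((rankInterval rk a b).card : ℝ) ≤ Δ) {c : Cell n}
    (h : ¬ Surrounds rk a b c.elts) : gapPotential runOf rk a b Δ c ≤ 64 * Δ := by
  have h0 : 0 ≤ Δ := (Nat.cast_nonneg _).trans hΔ
  have h1 := fourthRootMean_runs_le (runOf := runOf) hΔ c.elts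
  have h2 := sqrt_mul_sqrt_sqrtWeight_le (runOf := runOf) hΔ c.elts
  unfold gapPotential
  rw [if_neg h]
  split_ifs <;> linarith

theorem gapPotential_le (hΔ : ((rankInterval rk a b).card : ℝ) ≤ Δ) (c : Cell n) :
    gapPotential runOf rk a b Δ c ≤ 320 * Δ := by
  have h0 : 0 ≤ Δ := (Nat.cast_nonneg _).trans hΔ
  by_cases h : Surrounds rk a b c.elts
  · have h1 := fourthRootMean_runs_le (runOf := runOf) hΔ c.elts
    have h2 := sqrt_mul_sqrt_sqrtWeight_le (runOf := runOf) hΔ c.elts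
    unfold gapPotential
    rw [if_pos h]
    split_ifs <;> linarith
  · have := gapPotential_le_of_not_surrounds (runOf := runOf) hΔ h
    linarith

theorem fourthRootMean_le_gapPotential (hΔ : ((rankInterval rk a b).card : ℝ) ≤ Δ) (c : Cell n) :
    fourthRootMean Δ (runsMeeting runOf (c.elts ∩ rankInterval rk a b)).card
      ≤ gapPotential runOf rk a b Δ c := by
  have h0 : 0 ≤ Δ := (Nat.cast_nonneg _).trans hΔ
  have h1 := fourthRootMean_runs_le (runOf := runOf) hΔ c.elts
  have h2 := sqrt_mul_sqrt_sqrtWeight_le (runOf := runOf) hΔ c.elts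
  have h3 := mul_nonneg (Real.sqrt_nonneg Δ)
    (Real.sqrt_nonneg (sqrtWeight runOf (c.elts ∩ rankInterval rk a b)))
  unfold gapPotential
  split_ifs <;> linarith

theorem gapPotential_eq_zero {c : Cell n} (h : ¬ Surrounds rk a b c.elts)
    (hc : c.elts ∩ rankInterval rk a b = ∅) : gapPotential runOf rk a b Δ c = 0 := by
  unfold gapPotential
  rw [if_neg h, hc]
  simp [runsMeeting, sqrtWeight, fourthRootMean_zero]

variable {α : Type u} [LinearOrder α] {A : Fin n → α}

/-- At most one of several separated cells surrounds the interval. -/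
theorem sum_gapPotential_le_of_pairwise (hrk : ∀ p p', A p < A p' → rk p < rk p') (hab : a ≤ b)
    (hΔ : ((rankInterval rk a b).card : ℝ) ≤ Δ) {l : List (Cell n)}
    (hl : l.Pairwise fun c d => Below A c.elts d.elts) (hlen : l.length ≤ 5) :
    (l.map (gapPotential runOf rk a b Δ)).sum ≤ 320 * Δ := by
  have h0 : 0 ≤ Δ := (Nat.cast_nonneg _).trans hΔ
  by_cases h : ∃ c ∈ l, Surrounds rk a b c.elts
  · obtain ⟨c, hc, ⟨y, hy, hya⟩, z, hz, hbz⟩ := h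
    obtain ⟨l1, l2, rfl⟩ := List.append_of_mem hc
    obtain ⟨-, h2, h3⟩ := List.pairwise_append.1 hl
    have hzero : ∀ d ∈ l1 ++ l2, gapPotential runOf rk a b Δ d = 0 := by
      intro d hd
      have hd' : (∀ p ∈ d.elts, rk p < a) ∨ ∀ p ∈ d.elts, b ≤ rk p := by
        rcases List.mem_append.1 hd with hd | hd
        · exact Or.inl fun p hp => (hrk _ _ (h3 d hd c List.mem_cons_self p hp y hy)).trans hya
        · exact Or.inr fun p hp =>
            hbz.trans (hrk _ _ ((List.pairwise_cons.1 h2).1 d hd z hz p hp)).le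
      refine gapPotential_eq_zero ?_ ?_
      · rintro ⟨⟨p, hp, hpa⟩, p', hp', hpb⟩
        rcases hd' with hd' | hd'
        · have := hd' p' hp'; omega
        · have := hd' p hp; omega
      · rw [Finset.eq_empty_iff_forall_notMem]
        intro p hp
        obtain ⟨hp, hpI⟩ := Finset.mem_inter.1 hp
        rw [mem_rankInterval] at hpI
        rcases hd' with hd' | hd'
        · have := hd' p hp; omega
        · have := hd' p hp; omega
    have hz' : ∀ l' : List (Cell n), (∀ d ∈ l', gapPotential runOf rk a b Δ d = 0) →
        (l'.map (gapPotential runOf rk a b Δ)).sum = 0 := fun l' h => by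
      rw [List.map_congr_left (g := fun _ => (0 : ℝ)) h]
      simp
    rw [List.map_append, List.sum_append, List.map_cons, List.sum_cons,
      hz' l1 fun d hd => hzero d (List.mem_append_left _ hd),
      hz' l2 fun d hd => hzero d (List.mem_append_right _ hd), zero_add, add_zero]
    exact gapPotential_le hΔ c
  · push Not at h
    have h1 : (l.map (gapPotential runOf rk a b Δ)).sum ≤ (l.map fun _ => 64 * Δ).sum :=
      List.sum_le_sum fun c hc => gapPotential_le_of_not_surrounds hΔ (h c hc)
    have h2 : (l.length : ℝ) ≤ 5 := by exact_mod_cast hlen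
    rw [List.map_const', List.sum_replicate, nsmul_eq_mul] at h1
    nlinarith

theorem Surrounds.mono {T S : Finset (Fin n)} (h : Surrounds rk a b T) (hTS : T ⊆ S) :
    Surrounds rk a b S := by
  obtain ⟨⟨p, hp, h1⟩, p', hp', h2⟩ := h
  exact ⟨⟨p, hTS hp, h1⟩, p', hTS hp', h2⟩

/-- The part `N` of a cell that does not surround the interval, and that is cut into `N` below or
above the other parts: if `N` is partly in the interval, then the other parts are inside it or
outside it. -/
theorem sdiff_subset_or_disjoint (hrk : ∀ p p', A p < A p' → rk p < rk p')
    {S N : Finset (Fin n)} (hS : ¬ Surrounds rk a b S) (hN : N ⊆ S)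
    (hsep : Below A N (S \ N) ∨ Below A (S \ N) N) {y z : Fin n} (hy : y ∈ N)
    (hyI : y ∈ rankInterval rk a b) (hz : z ∈ N) (hzI : z ∉ rankInterval rk a b) :
    S \ N ⊆ rankInterval rk a b ∨ (S \ N) ∩ rankInterval rk a b = ∅ := by
  rw [mem_rankInterval] at hyI hzI
  have hS' : ∀ p ∈ S, ∀ p' ∈ S, rk p < a → ¬ b ≤ rk p' := fun p hp p' hp' h1 h2 =>
    hS ⟨⟨p, hp, h1⟩, p', hp', h2⟩
  have hmem : ∀ x ∈ S \ N, x ∈ S := fun x hx => (Finset.mem_sdiff.1 hx).1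
  by_cases hza : rk z < a
  · rcases hsep with hsep | hsep
    · refine Or.inl fun x hx => mem_rankInterval.2 ⟨?_, ?_⟩
      · exact hyI.1.trans (hrk _ _ (hsep y hy x hx)).le
      · exact not_le.1 (hS' z (hN hz) x (hmem x hx) hza)
    · refine Or.inr (Finset.eq_empty_iff_forall_notMem.2 fun x hx => ?_)
      obtain ⟨hx, hxI⟩ := Finset.mem_inter.1 hx
      have := hrk _ _ (hsep x hx z hz)
      have := (mem_rankInterval.1 hxI).1
      omega
  · have hzb : b ≤ rk z := by
      by_contra h
      exact hzI ⟨not_lt.1 hza, not_le.1 h⟩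
    rcases hsep with hsep | hsep
    · refine Or.inr (Finset.eq_empty_iff_forall_notMem.2 fun x hx => ?_)
      obtain ⟨hx, hxI⟩ := Finset.mem_inter.1 hx
      have := hrk _ _ (hsep z hz x hx)
      have := (mem_rankInterval.1 hxI).2
      omega
    · refine Or.inl fun x hx => mem_rankInterval.2 ⟨?_, ?_⟩
      · by_contra h
        exact hS' x (hmem x hx) z (hN hz) (not_le.1 h) hzb
      · exact (hrk _ _ (hsep x hx y hy)).trans hyI.2

/-- The sum over the parts of a partitioning step, for a cell that does not surround the interval:
the case that the part `N` is partly in the interval. -/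
theorem gapPotential_add_le (hrk : ∀ p p', A p < A p' → rk p < rk p')
    (hΔ : ((rankInterval rk a b).card : ℝ) ≤ Δ) {S N F : Finset (Fin n)}
    {Bs : List (Finset (Fin n))} (hS : ¬ Surrounds rk a b S) (hN : N ⊆ S) (hF : F ⊆ S \ N)
    (hBs : ∀ B ∈ Bs, B ⊆ S \ N) (hlen : Bs.length ≤ 3)
    (hsep : Below A N (S \ N) ∨ Below A (S \ N) N)
    (hlose : ∃ H ⊆ runsMeeting runOf S, (runsMeeting runOf S).card ≤ 2 * H.card ∧
      ∀ r ∈ H, (runPart runOf S r).card ≤ 2 * (runPart runOf S r \ N).card) {y z : Fin n}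
    (hy : y ∈ N) (hyI : y ∈ rankInterval rk a b) (hz : z ∈ N) (hzI : z ∉ rankInterval rk a b) :
    gapPotential runOf rk a b Δ ⟨false, N⟩ + gapPotential runOf rk a b Δ ⟨false, F⟩
      + (Bs.map fun B => gapPotential runOf rk a b Δ ⟨true, B⟩).sum
      ≤ gapPotential runOf rk a b Δ ⟨false, S⟩ := by
  have h0 : 0 ≤ Δ := (Nat.cast_nonneg _).trans hΔ
  have hNS : ¬ Surrounds rk a b N := fun h => hS (h.mono hN)
  have hΘN : gapPotential runOf rk a b Δ ⟨false, N⟩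
      = 64 * √Δ * √(sqrtWeight runOf (N ∩ rankInterval rk a b)) := by
    unfold gapPotential
    rw [if_neg (by rintro (h | h); exacts [Bool.false_ne_true h, hzI (h hz)]), if_neg hNS]
  have hΘS : gapPotential runOf rk a b Δ ⟨false, S⟩
      = 64 * √Δ * √(sqrtWeight runOf (S ∩ rankInterval rk a b)) := by
    unfold gapPotential
    rw [if_neg (by rintro (h | h); exacts [Bool.false_ne_true h, hzI (h (hN hz))]), if_neg hS]
  rw [hΘN, hΘS]
  -- Either the other parts, at most four, are inside the interval, and each is charged one of the
  -- four terms by which the potential drops; or they are outside and contribute nothing.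
  rcases sdiff_subset_or_disjoint hrk hS hN hsep hy hyI hz hzI with hI | hI
  · obtain ⟨H, hH, hhalf, hl⟩ := hlose
    have hdrop := sqrtWeight_drop runOf hN hI hH hhalf hl
    have hup : sqrtWeight runOf (S ∩ rankInterval rk a b)
        ≤ √((runsMeeting runOf S).card * Δ) := by
      have h1 : ((S ∩ rankInterval rk a b).card : ℝ) ≤ Δ := le_trans
        (by exact_mod_cast Finset.card_le_card Finset.inter_subset_right) hΔ
      refine (sqrtWeight_le runOf _ h1).trans (Real.sqrt_le_sqrt ?_)
      exact mul_le_mul_of_nonneg_right (Nat.cast_le.2 (Finset.card_le_card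
        (runsMeeting_mono runOf Finset.inter_subset_left))) h0
    have hmain := fourthRootMean_le_sqrt_sub (sqrtWeight_nonneg _ _) hdrop hup
    have hpart : ∀ (k : Bool) (T : Finset (Fin n)), T ⊆ S \ N →
        gapPotential runOf rk a b Δ ⟨k, T⟩ ≤ fourthRootMean Δ (runsMeeting runOf S).card := by
      intro k T hT
      unfold gapPotential
      rw [if_pos (Or.inr (hT.trans hI))]
      exact fourthRootMean_mono h0 (Finset.card_le_card (runsMeeting_mono runOf
        (Finset.inter_subset_left.trans (hT.trans Finset.sdiff_subset))))
    have hB : (Bs.map fun B => gapPotential runOf rk a b Δ ⟨true, B⟩).sum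
        ≤ 3 * fourthRootMean Δ (runsMeeting runOf S).card := by
      have h1 : (Bs.map fun B => gapPotential runOf rk a b Δ ⟨true, B⟩).sum
          ≤ (Bs.map fun _ => fourthRootMean Δ (runsMeeting runOf S).card).sum :=
        List.sum_le_sum fun B hB => hpart true B (hBs B hB)
      rw [List.map_const', List.sum_replicate, nsmul_eq_mul] at h1
      have h2 : (Bs.length : ℝ) ≤ 3 := by exact_mod_cast hlen
      exact h1.trans (mul_le_mul_of_nonneg_right h2 (fourthRootMean_nonneg _ _))
    have := hpart false F hF
    linarith
  · have hzero : ∀ (k : Bool) (T : Finset (Fin n)), T ⊆ S \ N →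
        gapPotential runOf rk a b Δ ⟨k, T⟩ = 0 := fun k T hT =>
      gapPotential_eq_zero (fun h => hS (h.mono (hT.trans Finset.sdiff_subset)))
        (Finset.subset_empty.1 (hI ▸ Finset.inter_subset_inter_right hT))
    rw [hzero false F hF, List.map_congr_left (g := fun _ => (0 : ℝ))
      fun B hB => hzero true B (hBs B hB)]
    have := Real.sqrt_le_sqrt (sqrtWeight_mono runOf (Finset.inter_subset_inter_right
      (u := rankInterval rk a b) hN))
    have h1 := mul_le_mul_of_nonneg_left this
      (mul_nonneg (by norm_num : (0 : ℝ) ≤ 64) (Real.sqrt_nonneg Δ))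
    simpa using h1

/-- If `S` surrounds the interval, the value `320 * Δ` covers all parts. If not, and one of the two
remainders lies partly in the interval, then `gapPotential_add_le` applies. In the last case each of
the at most five parts contributes at most the term of `S` in `fourthRootMean_runs_le`, and `5 ≤
64`. -/
theorem sum_gapPotential_splitCell_le (hrun : RunsSorted A runOf)
    (hrk : ∀ p p', A p < A p' → rk p < rk p') (hab : a ≤ b)
    (hΔ : ((rankInterval rk a b).card : ℝ) ≤ Δ) {S : Finset (Fin n)} {x : Fin n} (hx : x ∈ S)
    (hxI : x ∉ rankInterval rk a b) :
    ((splitCell A runOf S).map (gapPotential runOf rk a b Δ)).sum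
      ≤ gapPotential runOf rk a b Δ ⟨false, S⟩ := by
  have h0 : 0 ≤ Δ := (Nat.cast_nonneg _).trans hΔ
  obtain ⟨L, R, Bs, h1, h2⟩ := exists_isPartitioning hrun ⟨x, hx⟩
  rw [h1]
  obtain ⟨hLS, hRS, hBS⟩ := h2.subset
  have hpw := h2.pairwise
  simp only [List.pairwise_cons, List.pairwise_append, List.mem_append,
    List.mem_singleton] at hpw
  have hsplit : ∀ p ∈ S, p ∈ L ∨ (∃ B ∈ Bs, p ∈ B) ∨ p ∈ R := fun p hp => by
    obtain ⟨T, hT, hpT⟩ := (h2.mem_iff p).1 hp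
    simp only [List.mem_cons, List.mem_append, List.not_mem_nil, or_false] at hT
    rcases hT with rfl | hT | rfl
    exacts [Or.inl hpT, Or.inr (Or.inl ⟨T, hT, hpT⟩), Or.inr (Or.inr hpT)]
  have hsepL : Below A L (S \ L) := by
    intro p hp p' hp'
    obtain ⟨hp'S, hp'L⟩ := Finset.mem_sdiff.1 hp'
    rcases hsplit p' hp'S with h | ⟨B, hB, h⟩ | h
    exacts [absurd h hp'L, hpw.1 B (Or.inl hB) p hp p' h, hpw.1 R (Or.inr rfl) p hp p' h]
  have hsepR : Below A (S \ R) R := by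
    intro p' hp' p hp
    obtain ⟨hp'S, hp'R⟩ := Finset.mem_sdiff.1 hp'
    rcases hsplit p' hp'S with h | ⟨B, hB, h⟩ | h
    exacts [hpw.1 R (Or.inr rfl) p' h p hp, hpw.2.2.2 B hB R rfl p' h p hp, absurd h hp'R]
  by_cases hS : Surrounds rk a b S
  · have hΘS : gapPotential runOf rk a b Δ ⟨false, S⟩ = 320 * Δ := by
      unfold gapPotential
      rw [if_neg (by rintro (h | h); exacts [Bool.false_ne_true h, hxI (h hx)]), if_pos hS]
    rw [hΘS]
    refine sum_gapPotential_le_of_pairwise hrk hab hΔ h2.refinesCell.pairwise ?_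
    refine (List.length_filter_le _ _).trans ?_
    have := h2.length_le
    simp only [List.length_cons, List.length_append, List.length_map, List.length_nil]
    omega
  rw [sum_partitionCells _ _ _ _ fun k => gapPotential_eq_zero
    (by rintro ⟨⟨p, hp, -⟩, -⟩; simp at hp) (by simp)]
  have hdis : ∀ {T T' : Finset (Fin n)}, Below A T T' → ∀ p ∈ T, p ∉ T' := fun h p hp hp' =>
    lt_irrefl _ (h p hp p hp')
  by_cases hL : ∃ y ∈ L, y ∈ rankInterval rk a b ∧ ∃ z ∈ L, z ∉ rankInterval rk a b
  · obtain ⟨y, hy, hyI, z, hz, hzI⟩ := hL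
    have := gapPotential_add_le (F := R) (Bs := Bs) hrk hΔ hS hLS
      (fun p hp => Finset.mem_sdiff.2
        ⟨hRS hp, fun h => hdis (hpw.1 R (Or.inr rfl)) p h hp⟩)
      (fun B hB p hp => Finset.mem_sdiff.2
        ⟨hBS B hB hp, fun h => hdis (hpw.1 B (Or.inl hB)) p h hp⟩)
      h2.length_le (Or.inl hsepL) h2.upper hy hyI hz hzI
    linarith
  by_cases hR : ∃ y ∈ R, y ∈ rankInterval rk a b ∧ ∃ z ∈ R, z ∉ rankInterval rk a b
  · obtain ⟨y, hy, hyI, z, hz, hzI⟩ := hR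
    have := gapPotential_add_le (F := L) (Bs := Bs) hrk hΔ hS hRS
      (fun p hp => Finset.mem_sdiff.2
        ⟨hLS hp, fun h => hdis (hpw.1 R (Or.inr rfl)) p hp h⟩)
      (fun B hB p hp => Finset.mem_sdiff.2
        ⟨hBS B hB hp, fun h => hdis (hpw.2.2.2 B hB R rfl) p hp h⟩)
      h2.length_le (Or.inr hsepR) h2.lower hy hyI hz hzI
    linarith
  set f := fourthRootMean Δ (runsMeeting runOf (S ∩ rankInterval rk a b)).card with hf
  have hf0 : 0 ≤ f := fourthRootMean_nonneg _ _
  have hsmall : ∀ T ⊆ S, fourthRootMean Δ (runsMeeting runOf (T ∩ rankInterval rk a b)).card ≤ f :=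
    fun T hT => fourthRootMean_mono h0 (Finset.card_le_card (runsMeeting_mono runOf
      (Finset.inter_subset_inter_right hT)))
  have hunsorted : ∀ T ⊆ S, ¬ (∃ y ∈ T, y ∈ rankInterval rk a b ∧
      ∃ z ∈ T, z ∉ rankInterval rk a b) → gapPotential runOf rk a b Δ ⟨false, T⟩ ≤ f := by
    intro T hT hno
    by_cases hTI : T ⊆ rankInterval rk a b
    · unfold gapPotential
      rw [if_pos (Or.inr hTI)]
      exact hsmall T hT
    · obtain ⟨z, hz, hzI⟩ := Finset.not_subset.1 hTI
      rw [gapPotential_eq_zero (fun h => hS (h.mono hT))]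
      · exact hf0
      · exact Finset.eq_empty_iff_forall_notMem.2 fun y hy =>
          hno ⟨y, (Finset.mem_inter.1 hy).1, (Finset.mem_inter.1 hy).2, z, hz, hzI⟩
  have hB : (Bs.map fun B => gapPotential runOf rk a b Δ ⟨true, B⟩).sum ≤ 3 * f := by
    have h3 : (Bs.map fun B => gapPotential runOf rk a b Δ ⟨true, B⟩).sum
        ≤ (Bs.map fun _ => f).sum := List.sum_le_sum fun B hB => by
      unfold gapPotential
      rw [if_pos (Or.inl rfl)]
      exact hsmall B (hBS B hB)
    rw [List.map_const', List.sum_replicate, nsmul_eq_mul] at h3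
    have h4 : (Bs.length : ℝ) ≤ 3 := by exact_mod_cast h2.length_le
    exact h3.trans (mul_le_mul_of_nonneg_right h4 hf0)
  have hΘS : gapPotential runOf rk a b Δ ⟨false, S⟩
      = 64 * √Δ * √(sqrtWeight runOf (S ∩ rankInterval rk a b)) := by
    unfold gapPotential
    rw [if_neg (by rintro (h | h); exacts [Bool.false_ne_true h, hxI (h hx)]), if_neg hS]
  have h5 := fourthRootMean_runs_le (runOf := runOf) hΔ S
  have h6 := hunsorted L hLS hL
  have h7 := hunsorted R hRS hR
  rw [hΘS]
  linarith

end GapStep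

/-! ### Ranks without ties, and the ranks next to which a query splits -/

section LexRank

variable {n : ℕ} {α : Type u} [LinearOrder α]

/-- The number of elements before `p` in the order by values and positions. -/
def lexRank (A : Fin n → α) (p : Fin n) : ℕ :=
  (Finset.univ.filter fun p' => lexKey A p' < lexKey A p).card

theorem lexRank_lt (A : Fin n → α) (p : Fin n) : lexRank A p < n := by
  have h : (Finset.univ.filter fun p' => lexKey A p' < lexKey A p) ⊂ Finset.univ :=
    Finset.filter_ssubset.2 ⟨p, Finset.mem_univ _, lt_irrefl _⟩
  have := Finset.card_lt_card h
  rwa [Finset.card_univ, Fintype.card_fin] at this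

theorem lexRank_lt_lexRank {A : Fin n → α} {p p' : Fin n} (h : lexKey A p < lexKey A p') :
    lexRank A p < lexRank A p' := by
  refine Finset.card_lt_card (Finset.ssubset_iff_of_subset ?_ |>.2 ⟨p, ?_, ?_⟩)
  · intro y hy
    rw [Finset.mem_filter] at hy ⊢
    exact ⟨hy.1, hy.2.trans h⟩
  · simpa using h
  · simp

theorem lexRank_lt_of_lt {A : Fin n → α} {p p' : Fin n} (h : A p < A p') :
    lexRank A p < lexRank A p' := lexRank_lt_lexRank (lexKey_lt.2 (Or.inl h))

theorem lexRank_injective (A : Fin n → α) : Function.Injective (lexRank A) := by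
  intro p p' h
  by_contra hne
  rcases lt_or_gt_of_ne ((lexKey_injective A).ne hne) with h' | h'
  · exact absurd h (lexRank_lt_lexRank h').ne
  · exact absurd h (lexRank_lt_lexRank h').ne'

theorem exists_lexRank_eq (A : Fin n → α) {j : ℕ} (hj : j < n) : ∃ p, lexRank A p = j := by
  obtain ⟨p, -, hp⟩ := exists_card_lt_eq (lexKey A) Finset.univ (lexKey_injective A).injOn j
    (by simpa using hj)
  exact ⟨p, hp⟩

theorem isSelected_lexRank (A : Fin n → α) (p : Fin n) :
    IsSelected A ⟨lexRank A p, lexRank_lt A p⟩ (A p) := by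
  constructor
  · change numLT A (A p) ≤ lexRank A p
    unfold numLT lexRank
    exact Finset.card_le_card fun y hy => by
      rw [Finset.mem_filter] at hy ⊢
      exact ⟨hy.1, lexKey_lt.2 (Or.inl hy.2)⟩
  · change lexRank A p < numLE A (A p)
    unfold numLE lexRank
    refine Finset.card_lt_card (Finset.ssubset_iff_of_subset ?_ |>.2 ⟨p, ?_, ?_⟩)
    · intro y hy
      rw [Finset.mem_filter] at hy ⊢
      refine ⟨hy.1, ?_⟩
      rcases lexKey_lt.1 hy.2 with h | h
      exacts [h.le, h.1.le]
    · simp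
    · simp

/-- Equal elements occupy the ranks from `numLT` up to `numLE`, and they are all in the same cell.
-/
theorem CellsInv.exists_lexRank_eq {A : Fin n → α} {cells : List (Cell n)} (hinv : CellsInv A cells)
    {c : Cell n} (hc : c ∈ cells) {p : Fin n} (hp : p ∈ c.elts) {j : ℕ} (h1 : numLT A (A p) ≤ j)
    (h2 : j < numLE A (A p)) : ∃ e ∈ c.elts, lexRank A e = j := by
  have hj : j < n := h2.trans_le ((Finset.card_le_univ _).trans (by simp))
  obtain ⟨e, he⟩ := _root_.exists_lexRank_eq A hj
  have hsel := isSelected_lexRank A e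
  have : IsSelected A ⟨lexRank A e, lexRank_lt A e⟩ (A p) := by
    constructor
    · simpa only [he] using h1
    · simpa only [he] using h2
  have heq := hsel.eq this
  obtain ⟨d, hd, hed⟩ := hinv.cover e
  exact ⟨e, hinv.eq_of_mem hd hc hed hp heq ▸ hed, he⟩

theorem numLT_lt_numLE (A : Fin n → α) (p : Fin n) : numLT A (A p) < numLE A (A p) :=
  (isSelected_lexRank A p).1.trans_lt (isSelected_lexRank A p).2

/-- A cell is partitioned only if it has an element next to the rank of the query. -/
theorem MustSplit.exists_lexRank {A : Fin n → α} {cells : List (Cell n)} (hinv : CellsInv A cells)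
    {q : Query n α} {c : Cell n} (hc : c ∈ cells) (h : MustSplit A cells q c) :
    ∃ p ∈ c.elts, lexRank A p = queryRank A q ∨ lexRank A p + 1 = queryRank A q := by
  rcases q with i | x
  · obtain ⟨-, p, hp, hsel⟩ := h
    obtain ⟨e, he, her⟩ := hinv.exists_lexRank_eq hc hp hsel.1 hsel.2
    exact ⟨e, he, Or.inr (by rw [her]; rfl)⟩
  obtain ⟨hk, hcov, p, hp, hpx⟩ := h
  -- If the value `x` occurs, its elements begin at the rank of the query. If not, the elements
  -- equal to the predecessor end just before that rank, and those equal to the successor begin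
  -- there.
  by_cases hex : ∃ e, A e = x
  · obtain ⟨e, rfl⟩ := hex
    have hec : ∃ e' ∈ c.elts, A e' = A e := by
      rcases hpx with hpx | hpx
      · exact ⟨p, hp, le_antisymm hpx.1 (hpx.2 e le_rfl)⟩
      obtain ⟨d, hd, hed⟩ := hinv.cover e
      refine ⟨e, ?_, rfl⟩
      rcases hinv.below_or hd hc with rfl | hb | hb
      · exact hed
      · exfalso
        by_cases hdk : d.known = true
        · exact hcov ⟨d, hd, hdk, ⟨e, hed, le_rfl⟩, e, hed, le_rfl⟩
        · obtain ⟨m, hm, hmk, hdm, hmc⟩ := hinv.separated d hd c hc (by simpa using hdk) hk hb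
          obtain ⟨z, hz⟩ := hinv.nonempty m hm
          exact absurd (hmc z hz p hp) (not_lt.2 (hpx.2 z (hdm e hed z hz)))
      · exact absurd (hb p hp e hed) (not_lt.2 hpx.1.le)
    obtain ⟨e', he', heq⟩ := hec
    obtain ⟨y, hy, hyr⟩ := hinv.exists_lexRank_eq hc he' (le_refl _) (numLT_lt_numLE A e')
    exact ⟨y, hy, Or.inl (by rw [hyr, heq]; rfl)⟩
  · push Not at hex
    rcases hpx with hpx | hpx
    · have hr : numLT A x = numLE A (A p) := by
        unfold numLT numLE
        congr 1
        ext y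
        simp only [Finset.mem_filter, Finset.mem_univ, true_and]
        exact ⟨fun h => hpx.2 y h.le, fun h => h.trans_lt (lt_of_le_of_ne hpx.1 (hex p))⟩
      have hlt := numLT_lt_numLE A p
      obtain ⟨y, hy, hyr⟩ := hinv.exists_lexRank_eq hc hp (j := numLE A (A p) - 1) (by omega)
        (by omega)
      refine ⟨y, hy, Or.inr ?_⟩
      change _ = numLT A x
      omega
    · have hr : numLT A x = numLT A (A p) := by
        unfold numLT
        congr 1
        ext y
        simp only [Finset.mem_filter, Finset.mem_univ, true_and]
        refine ⟨fun h => h.trans hpx.1, fun h => lt_of_not_ge fun hle => ?_⟩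
        exact absurd (hpx.2 y (lt_of_le_of_ne hle (hex y).symm)) (not_le.2 h)
      obtain ⟨y, hy, hyr⟩ := hinv.exists_lexRank_eq hc hp le_rfl (numLT_lt_numLE A p)
      refine ⟨y, hy, Or.inl ?_⟩
      change _ = numLT A x
      omega

end LexRank

/-! ### The entropy inside one gap -/

section Gap

variable {n : ℕ} {α : Type u} [LinearOrder α] {A : Fin n → α} {runOf : Fin n → ℕ} {a b : ℕ} {Δ : ℝ}

theorem sum_map_flatMap_le {β : Type*} (Θ : β → ℝ) (g : β → List β) (l : List β)
    (h : ∀ c ∈ l, ((g c).map Θ).sum ≤ Θ c) : ((l.flatMap g).map Θ).sum ≤ (l.map Θ).sum := by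
  induction l with
  | nil => simp
  | cons c l ih =>
    rw [List.flatMap_cons, List.map_append, List.sum_append, List.map_cons, List.sum_cons]
    exact add_le_add (h c List.mem_cons_self) (ih fun d hd => h d (List.mem_cons_of_mem _ hd))

/-- The query does not touch the ranks in `[a, b)`. -/
def Avoids (r a b : ℕ) : Prop := (r < a ∨ b ≤ r) ∧ (r ≤ a ∨ b < r)

/-- A cell that is split has an element at the rank of the query or just before it. This element is
outside the interval, as the estimate for a partitioning step requires. -/
theorem sum_gapPotential_refineOnce_le (hrun : RunsSorted A runOf) {cells : List (Cell n)}
    (hinv : CellsInv A cells) (hab : a ≤ b) (hΔ : ((rankInterval (lexRank A) a b).card : ℝ) ≤ Δ)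
    {q : Query n α} (hq : Avoids (queryRank A q) a b) :
    ((refineOnce A runOf q cells).map (gapPotential runOf (lexRank A) a b Δ)).sum
      ≤ (cells.map (gapPotential runOf (lexRank A) a b Δ)).sum := by
  refine sum_map_flatMap_le _ _ _ fun c hc => ?_
  split_ifs with hm
  · obtain ⟨p, hp, hpr⟩ := hm.exists_lexRank hinv hc
    have hk := hm.known_eq_false
    have hce : (⟨false, c.elts⟩ : Cell n) = c := by rw [← hk]
    have := sum_gapPotential_splitCell_le hrun (fun _ _ => lexRank_lt_of_lt) hab hΔ hp
      (by
        rw [mem_rankInterval]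
        obtain ⟨h1, h2⟩ := hq
        omega)
    rwa [hce] at this
  · simp

theorem sum_gapPotential_iterate_le (hrun : RunsSorted A runOf) {cells : List (Cell n)}
    (hinv : CellsInv A cells) (hab : a ≤ b) (hΔ : ((rankInterval (lexRank A) a b).card : ℝ) ≤ Δ)
    {q : Query n α} (hq : Avoids (queryRank A q) a b) (m : ℕ) :
    (((refineOnce A runOf q)^[m] cells).map (gapPotential runOf (lexRank A) a b Δ)).sum
      ≤ (cells.map (gapPotential runOf (lexRank A) a b Δ)).sum := by
  induction m generalizing cells with
  | zero => exact le_rfl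
  | succ m ih =>
    exact (ih (hinv.refineOnce hrun q)).trans (sum_gapPotential_refineOnce_le hrun hinv hab hΔ hq)

theorem sum_gapPotential_fsState_le (A : Fin n → α) (hab : a ≤ b)
    (hΔ : ((rankInterval (lexRank A) a b).card : ℝ) ≤ Δ) (qs : List (Query n α))
    (hqs : ∀ q ∈ qs, Avoids (queryRank A q) a b) :
    ((fsState A qs).cells.map (gapPotential (runIndex A) (lexRank A) a b Δ)).sum ≤ 320 * Δ := by
  have key : ∀ (qs : List (Query n α)) (s : FSState n), s.runOf = runIndex A →
      CellsInv A s.cells → (∀ q ∈ qs, Avoids (queryRank A q) a b) →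
      ((qs.foldl (fsServe A) s).cells.map (gapPotential (runIndex A) (lexRank A) a b Δ)).sum
      ≤ (s.cells.map (gapPotential (runIndex A) (lexRank A) a b Δ)).sum := by
    intro qs
    induction qs with
    | nil => exact fun s _ _ _ => le_rfl
    | cons q qs ih =>
      intro s hr hs hq
      have hrun : RunsSorted A s.runOf := hr ▸ runsSorted_runIndex A
      refine (ih (fsServe A s q) hr (hs.iterate hrun q n) fun q' hq' =>
        hq q' (List.mem_cons_of_mem _ hq')).trans ?_
      have hstep : (fsServe A s q).cells = (refineOnce A (runIndex A) q)^[n] s.cells := hr ▸ rfl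
      rw [hstep]
      exact sum_gapPotential_iterate_le (runsSorted_runIndex A) hs hab hΔ
        (hq q List.mem_cons_self) n
  refine (key qs _ rfl (cellsInv_initial A) hqs).trans ?_
  have h0 : 0 ≤ Δ := (Nat.cast_nonneg _).trans hΔ
  unfold fsInitial
  dsimp only
  split_ifs
  · simpa using h0
  · simpa using gapPotential_le hΔ _

theorem CellsInv.sum_card_inter_le {cells : List (Cell n)} (hinv : CellsInv A cells)
    (I : Finset (Fin n)) : (cells.map fun c => (c.elts ∩ I).card).sum ≤ I.card := by
  have h := card_allElts (A := A) (l := cells.map fun c => ⟨c.known, c.elts ∩ I⟩)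
    (List.pairwise_map.2 (hinv.pairwise.imp fun {c d} h =>
      h.mono Finset.inter_subset_left Finset.inter_subset_left))
  rw [List.map_map] at h
  change _ = (cells.map fun c => (c.elts ∩ I).card).sum at h
  rw [← h]
  refine Finset.card_le_card fun p hp => ?_
  obtain ⟨c, hc, hpc⟩ := mem_allElts.1 hp
  obtain ⟨d, -, rfl⟩ := List.mem_map.1 hc
  exact (Finset.mem_inter.1 hpc).2

theorem runEntropy_empty (ρ : ℕ) (runOf : Fin n → ℕ) :
    runEntropy ρ (runsMeeting runOf (∅ : Finset (Fin n))).card = 0 := by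
  simp [runsMeeting, runEntropy, xlogx]

/-- `k log n - k log k = k (log n - log d) + k log (d / k)`. The numbers `k` add up to at most `d`,
and the last terms are at most six times the gap potential; `1920 = 6 * 320`. -/
theorem sum_runEntropy_gap_le (A : Fin n → α) (qs : List (Query n α)) {d : ℕ}
    (hd : (rankInterval (lexRank A) a b).card ≤ d) (hdn : d ≤ n)
    (hqs : ∀ q ∈ qs, Avoids (queryRank A q) a b) :
    ((fsState A qs).cells.map fun c => runEntropy n
      (runsMeeting (runIndex A) (c.elts ∩ rankInterval (lexRank A) a b)).card).sum
      ≤ (d * Real.logb 2 n - xlogx d) + 1920 * d := by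
  have hpos : 0 ≤ d * Real.logb 2 n - xlogx d := runEntropy_nonneg hdn
  have hd0 : (0 : ℝ) ≤ d := Nat.cast_nonneg d
  -- The endpoints may come in the wrong order when a gap is too short to have an interior; the
  -- interval is empty then.
  by_cases hab : a ≤ b
  swap
  · have he : rankInterval (lexRank A) a b = ∅ := Finset.eq_empty_iff_forall_notMem.2 fun p hp => by
      have := mem_rankInterval.1 hp
      omega
    simp only [he, Finset.inter_empty, runEntropy_empty]
    rw [List.map_const', List.sum_replicate, smul_zero]
    linarith
  have hΔ : ((rankInterval (lexRank A) a b).card : ℝ) ≤ (d : ℝ) := by exact_mod_cast hd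
  have hΘ := sum_gapPotential_fsState_le A hab hΔ qs hqs
  have hinv := (fsState_invariant A qs).2
  have hk : ((fsState A qs).cells.map fun c => ((runsMeeting (runIndex A)
      (c.elts ∩ rankInterval (lexRank A) a b)).card : ℝ)).sum ≤ d := by
    have h1 : ((fsState A qs).cells.map fun c => (runsMeeting (runIndex A)
        (c.elts ∩ rankInterval (lexRank A) a b)).card).sum ≤ d :=
      ((List.sum_le_sum fun c _ => Finset.card_image_le).trans
        (hinv.sum_card_inter_le _)).trans hd
    have h2 : (((fsState A qs).cells.map fun c => (runsMeeting (runIndex A)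
        (c.elts ∩ rankInterval (lexRank A) a b)).card).sum : ℝ) ≤ d := by exact_mod_cast h1
    rw [Nat.cast_list_sum, List.map_map] at h2
    exact h2
  have hcell : ∀ c : Cell n, runEntropy n
      (runsMeeting (runIndex A) (c.elts ∩ rankInterval (lexRank A) a b)).card
      ≤ ((runsMeeting (runIndex A) (c.elts ∩ rankInterval (lexRank A) a b)).card : ℝ)
        * (Real.logb 2 n - Real.logb 2 d)
        + 6 * gapPotential (runIndex A) (lexRank A) a b d c := by
    intro c
    have h1 := fourthRootMean_le_gapPotential (runOf := runIndex A) hΔ c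
    have h2 := card_runsMeeting_inter_le (runOf := runIndex A) hΔ c.elts
    have h3 := mul_logb_div_le h2
    set k := (runsMeeting (runIndex A) (c.elts ∩ rankInterval (lexRank A) a b)).card
    rcases Nat.eq_zero_or_pos k with hk0 | hk0
    · rw [hk0] at h3 h1 ⊢
      simp only [runEntropy, xlogx, Nat.cast_zero, zero_mul, sub_zero] at h3 ⊢
      linarith
    · have hk' : (0 : ℝ) < k := by exact_mod_cast hk0
      rw [Real.logb_div (hk'.trans_le h2).ne' hk'.ne'] at h3
      unfold runEntropy xlogx
      linarith
  have hsum := List.sum_le_sum (l := (fsState A qs).cells) fun c _ => hcell c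
  rw [List.sum_map_add, List.sum_map_mul_right, List.sum_map_mul_left] at hsum
  rcases Nat.eq_zero_or_pos d with h0 | h0
  · have hz : ∀ c : Cell n, (c.elts ∩ rankInterval (lexRank A) a b) = ∅ := fun c => by
      rw [Finset.card_eq_zero.1 (by omega : (rankInterval (lexRank A) a b).card = 0),
        Finset.inter_empty]
    simp only [hz, runEntropy_empty]
    rw [List.map_const', List.sum_replicate, smul_zero]
    linarith
  have hlog : 0 ≤ Real.logb 2 n - Real.logb 2 d := sub_nonneg.2
    (Real.logb_le_logb_of_le (by norm_num) (by exact_mod_cast h0) (by exact_mod_cast hdn))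
  have := mul_le_mul_of_nonneg_right hk hlog
  unfold xlogx
  linarith

end Gap

/-! ### Summing over the gaps: the second bound -/

section GapSum

/-- The intervals between consecutive members of `a, l, m`. -/
def gapPairs (m : ℕ) (a : ℕ) (l : List ℕ) : List (ℕ × ℕ) := (a :: l).zip (l ++ [m])

theorem gapPairs_cons (m a r : ℕ) (l : List ℕ) :
    gapPairs m a (r :: l) = (a, r) :: gapPairs m r l := rfl

theorem gapPairs_nil (m a : ℕ) : gapPairs m a [] = [(a, m)] := rfl

theorem sum_gapPairs {m a : ℕ} {l : List ℕ} (h : (a :: l).Pairwise (· ≤ ·))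
    (hm : ∀ r ∈ a :: l, r ≤ m) : ((gapPairs m a l).map fun g => g.2 - g.1).sum = m - a := by
  induction l generalizing a with
  | nil => simp [gapPairs_nil]
  | cons r l ih =>
    obtain ⟨h1, h2⟩ := List.pairwise_cons.1 h
    rw [gapPairs_cons, List.map_cons, List.sum_cons, ih h2 fun x hx => hm x (by simp_all)]
    have := h1 r List.mem_cons_self
    have := hm r (by simp)
    simp only
    omega

theorem sub_le_of_mem_gapPairs {m a : ℕ} {l : List ℕ} (h : (a :: l).Pairwise (· ≤ ·))
    (hm : ∀ r ∈ a :: l, r ≤ m) {g : ℕ × ℕ} (hg : g ∈ gapPairs m a l) : g.2 - g.1 ≤ m := by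
  have := List.single_le_sum (l := (gapPairs m a l).map fun g => g.2 - g.1)
    (fun _ _ => Nat.zero_le _) _ (List.mem_map_of_mem hg)
  rw [sum_gapPairs h hm] at this
  omega

theorem avoids_of_mem_gapPairs {m a : ℕ} {l : List ℕ} (h : (a :: l).Pairwise (· ≤ ·))
    {g : ℕ × ℕ} (hg : g ∈ gapPairs m a l) {r : ℕ} (hr : r ∈ l) : r ≤ g.1 ∨ g.2 ≤ r := by
  induction l generalizing a with
  | nil => simp at hr
  | cons x l ih =>
    obtain ⟨-, h2⟩ := List.pairwise_cons.1 h
    obtain ⟨h3, -⟩ := List.pairwise_cons.1 h2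
    rw [gapPairs_cons] at hg
    rcases List.mem_cons.1 hg with rfl | hg
    · rcases List.mem_cons.1 hr with rfl | hr
      · exact Or.inr le_rfl
      · exact Or.inr (h3 r hr)
    · rcases List.mem_cons.1 hr with rfl | hr
      · have hg1 : g.1 ∈ r :: l := (List.of_mem_zip hg).1
        rcases List.mem_cons.1 hg1 with h | h
        · exact Or.inl h.ge
        · exact Or.inl (h3 _ h)
      · exact ih h2 hg hr

/-- The right end of the gap is the first member of the list above `j`, or `m`. -/
theorem exists_mem_gapPairs {m a : ℕ} {l : List ℕ} {j : ℕ} (haj : a < j) (hjm : j + 1 < m)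
    (hl : ∀ r ∈ l, j ≠ r ∧ j + 1 ≠ r) :
    ∃ g ∈ gapPairs m a l, g.1 + 1 ≤ j ∧ j < g.2 - 1 := by
  induction l generalizing a with
  | nil => exact ⟨(a, m), by simp [gapPairs_nil], by simp only; omega, by simp only; omega⟩
  | cons r l ih =>
    rw [gapPairs_cons]
    have hr := hl r List.mem_cons_self
    rcases lt_or_ge j r with h | h
    · exact ⟨(a, r), List.mem_cons_self, by simp only; omega, by simp only; omega⟩
    · obtain ⟨g, hg, h1⟩ := ih (a := r) (by omega) fun x hx => hl x (List.mem_cons_of_mem _ hx)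
      exact ⟨g, List.mem_cons_of_mem _ hg, h1⟩

theorem cast_sum_map {β : Type*} (l : List β) (f : β → ℕ) :
    ((l.map f).sum : ℝ) = (l.map fun x => (f x : ℝ)).sum := by
  rw [Nat.cast_list_sum, List.map_map]
  rfl

theorem logb_two_natCast_nonneg (m : ℕ) : 0 ≤ Real.logb 2 m :=
  div_nonneg (Real.log_natCast_nonneg m) (Real.log_nonneg (by norm_num))

theorem sum_map_sum_comm {β γ : Type*} (l : List β) (l' : List γ) (F : β → γ → ℝ) :
    (l.map fun c => (l'.map fun g => F c g).sum).sum
      = (l'.map fun g => (l.map fun c => F c g).sum).sum := by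
  induction l with
  | nil => simp
  | cons c l ih => simp only [List.map_cons, List.sum_cons, ih, List.sum_map_add]

variable {n : ℕ} {α : Type u} [LinearOrder α]

theorem runsMeeting_union (runOf : Fin n → ℕ) (S T : Finset (Fin n)) :
    runsMeeting runOf (S ∪ T) = runsMeeting runOf S ∪ runsMeeting runOf T := Finset.image_union S T

theorem card_runsMeeting_le_sum (runOf : Fin n → ℕ) {T T0 : Finset (Fin n)}
    {l : List (Finset (Fin n))} (h : ∀ p ∈ T, p ∈ T0 ∨ ∃ I ∈ l, p ∈ I) :
    (runsMeeting runOf T).card ≤ (l.map fun I => (runsMeeting runOf (T ∩ I)).card).sum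
      + (T ∩ T0).card := by
  induction l generalizing T with
  | nil =>
    have : T ∩ T0 = T := Finset.inter_eq_left.2 fun p hp => by simpa using h p hp
    simp only [List.map_nil, List.sum_nil, zero_add, this]
    exact Finset.card_image_le
  | cons I l ih =>
    rw [List.map_cons, List.sum_cons]
    have h1 : (runsMeeting runOf T).card ≤ (runsMeeting runOf (T ∩ I)).card
        + (runsMeeting runOf (T \ I)).card := by
      have e : T = (T ∩ I) ∪ (T \ I) := by
        rw [Finset.union_comm, Finset.sdiff_union_inter]
      conv_lhs => rw [e, runsMeeting_union]
      exact Finset.card_union_le _ _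
    have h2 := ih (T := T \ I) fun p hp => by
      obtain ⟨hpT, hpI⟩ := Finset.mem_sdiff.1 hp
      refine (h p hpT).imp_right fun ⟨J, hJ, hpJ⟩ => ⟨J, ?_, hpJ⟩
      exact (List.mem_cons.1 hJ).resolve_left fun h => hpI (h ▸ hpJ)
    have h3 : (l.map fun J => (runsMeeting runOf (T \ I ∩ J)).card).sum
        ≤ (l.map fun J => (runsMeeting runOf (T ∩ J)).card).sum :=
      List.sum_le_sum fun J _ => Finset.card_le_card (runsMeeting_mono runOf
        (Finset.inter_subset_inter_right Finset.sdiff_subset))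
    have h4 : (T \ I ∩ T0).card ≤ (T ∩ T0).card :=
      Finset.card_le_card (Finset.inter_subset_inter_right Finset.sdiff_subset)
    omega

/-- The `k` runs are distributed over the pieces, and `log n - log k` only grows when `k` is
replaced by the number of runs of a piece. The exceptional elements in `T0` are charged `log n`
each. -/
theorem runEntropy_le_sum (runOf : Fin n → ℕ) {T T0 : Finset (Fin n)}
    {l : List (Finset (Fin n))} (h : ∀ p ∈ T, p ∈ T0 ∨ ∃ I ∈ l, p ∈ I) :
    runEntropy n (runsMeeting runOf T).card
      ≤ (l.map fun I => runEntropy n (runsMeeting runOf (T ∩ I)).card).sum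
        + (T ∩ T0).card * Real.logb 2 n := by
  have h1 := card_runsMeeting_le_sum runOf h
  have hkn : (runsMeeting runOf T).card ≤ n :=
    Finset.card_image_le.trans ((Finset.card_le_univ _).trans (by simp))
  have hle : ∀ I, (runsMeeting runOf (T ∩ I)).card ≤ (runsMeeting runOf T).card := fun I =>
    Finset.card_le_card (runsMeeting_mono runOf Finset.inter_subset_left)
  set k := (runsMeeting runOf T).card with hk
  have hT0 : (0 : ℝ) ≤ (T ∩ T0).card := Nat.cast_nonneg _
  have hlogn : 0 ≤ Real.logb 2 n := logb_two_natCast_nonneg n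
  rcases Nat.eq_zero_or_pos k with h0 | h0
  · rw [h0]
    have : 0 ≤ (l.map fun I => runEntropy n (runsMeeting runOf (T ∩ I)).card).sum :=
      List.sum_nonneg fun x hx => by
        obtain ⟨I, -, rfl⟩ := List.mem_map.1 hx
        exact runEntropy_nonneg ((hle I).trans hkn)
    have := mul_nonneg hT0 hlogn
    have : runEntropy n 0 = 0 := by simp [runEntropy, xlogx]
    linarith
  have hlog : 0 ≤ Real.logb 2 n - Real.logb 2 k := sub_nonneg.2
    (Real.logb_le_logb_of_le (by norm_num) (by exact_mod_cast h0) (by exact_mod_cast hkn))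
  have hlogk : 0 ≤ Real.logb 2 k := logb_two_natCast_nonneg k
  have h2 : (k : ℝ) ≤ (l.map fun I => ((runsMeeting runOf (T ∩ I)).card : ℝ)).sum
      + (T ∩ T0).card := by
    have h2 : (k : ℝ) ≤ ((l.map fun I => (runsMeeting runOf (T ∩ I)).card).sum : ℕ)
      + (T ∩ T0).card := by exact_mod_cast h1
    rwa [cast_sum_map] at h2
  calc runEntropy n k = k * (Real.logb 2 n - Real.logb 2 k) := by
        unfold runEntropy xlogx
        ring
    _ ≤ ((l.map fun I => ((runsMeeting runOf (T ∩ I)).card : ℝ)).sum + (T ∩ T0).card)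
        * (Real.logb 2 n - Real.logb 2 k) := mul_le_mul_of_nonneg_right h2 hlog
    _ = (l.map fun I => ((runsMeeting runOf (T ∩ I)).card : ℝ)
          * (Real.logb 2 n - Real.logb 2 k)).sum
        + (T ∩ T0).card * (Real.logb 2 n - Real.logb 2 k) := by
        rw [add_mul, List.sum_map_mul_right]
    _ ≤ _ := by
        refine add_le_add (List.sum_le_sum fun I _ => ?_)
          (mul_le_mul_of_nonneg_left (by linarith) hT0)
        have := xlogx_le (hle I)
        unfold runEntropy
        linarith

theorem card_filter_lexRank_le (A : Fin n → α) (s : Finset ℕ) :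
    (Finset.univ.filter fun p => lexRank A p ∈ s).card ≤ s.card :=
  Finset.card_le_card_of_injOn (lexRank A) (fun _ hp => (Finset.mem_filter.1 hp).2)
    (lexRank_injective A).injOn

theorem queryRank_le (A : Fin n → α) (q : Query n α) : queryRank A q ≤ n := by
  rcases q with i | x
  · exact i.isLt
  · exact (Finset.card_le_univ (Finset.univ.filter fun p => A p < x)).trans (by simp)

theorem queryGaps_eq (A : Fin n → α) (qs : List (Query n α)) :
    queryGaps A qs = (gapPairs n 0 (sortedRanks A qs)).map fun g => g.2 - g.1 := by
  unfold queryGaps gapPairs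
  rw [List.zip_eq_zipWith, List.map_zipWith]

theorem mem_sortedRanks {A : Fin n → α} {qs : List (Query n α)} {r : ℕ} :
    r ∈ sortedRanks A qs ↔ ∃ q ∈ qs, queryRank A q = r := by
  unfold sortedRanks
  rw [List.mem_insertionSort, List.mem_map]

theorem length_sortedRanks (A : Fin n → α) (qs : List (Query n α)) :
    (sortedRanks A qs).length = qs.length := by
  unfold sortedRanks
  rw [List.length_insertionSort, List.length_map]

theorem pairwise_zero_sortedRanks (A : Fin n → α) (qs : List (Query n α)) :
    (0 :: sortedRanks A qs).Pairwise (· ≤ ·) :=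
  List.pairwise_cons.2 ⟨fun _ _ => Nat.zero_le _, List.pairwise_insertionSort _ _⟩

theorem le_of_mem_zero_sortedRanks (A : Fin n → α) (qs : List (Query n α)) :
    ∀ r ∈ 0 :: sortedRanks A qs, r ≤ n := by
  intro r hr
  rcases List.mem_cons.1 hr with rfl | hr
  · exact Nat.zero_le _
  · obtain ⟨q, -, rfl⟩ := mem_sortedRanks.1 hr
    exact queryRank_le A q

/-- The ranks at the ends of the gaps. -/
def borderRanks (A : Fin n → α) (qs : List (Query n α)) : Finset ℕ :=
  insert 0 (insert (n - 1) ((sortedRanks A qs).toFinset ∪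
    (sortedRanks A qs).toFinset.image fun r => r - 1))

theorem card_borderRanks_le (A : Fin n → α) (qs : List (Query n α)) :
    (borderRanks A qs).card ≤ 2 * qs.length + 2 := by
  have h1 := (sortedRanks A qs).toFinset_card_le
  rw [length_sortedRanks] at h1
  have h2 : ((sortedRanks A qs).toFinset.image fun r => r - 1).card
      ≤ (sortedRanks A qs).toFinset.card := Finset.card_image_le
  have h3 := Finset.card_union_le (sortedRanks A qs).toFinset
    ((sortedRanks A qs).toFinset.image fun r => r - 1)
  have h4 := Finset.card_insert_le (n - 1) ((sortedRanks A qs).toFinset ∪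
    (sortedRanks A qs).toFinset.image fun r => r - 1)
  have h5 := Finset.card_insert_le 0 (insert (n - 1) ((sortedRanks A qs).toFinset ∪
    (sortedRanks A qs).toFinset.image fun r => r - 1))
  unfold borderRanks
  omega

/-- The interior ranks are estimated gap by gap, and each of the at most `2 q + 2` border ranks
contributes at most `log n`. -/
theorem sum_runEntropy_fsState_le (A : Fin n → α) (qs : List (Query n α)) :
    ((fsState A qs).cells.map fun c => runEntropy n (runsMeeting (runIndex A) c.elts).card).sum
      ≤ xlogx n - ((queryGaps A qs).map xlogx).sum + 1920 * n
        + (2 * qs.length + 2) * Real.logb 2 n := by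
  have hpw := pairwise_zero_sortedRanks A qs
  have hle := le_of_mem_zero_sortedRanks A qs
  have hinv := (fsState_invariant A qs).2
  set P := gapPairs n 0 (sortedRanks A qs) with hP
  -- A query of rank `r` can split cells that hold the rank `r` or `r - 1`, so each gap is shortened
  -- by one rank at both ends.
  let I : ℕ × ℕ → Finset (Fin n) := fun g => rankInterval (lexRank A) (g.1 + 1) (g.2 - 1)
  set T0 := Finset.univ.filter fun p => lexRank A p ∈ borderRanks A qs with hT0
  have hcov : ∀ p, p ∈ T0 ∨ ∃ J ∈ P.map I, p ∈ J := by
    intro p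
    by_cases hp : lexRank A p ∈ borderRanks A qs
    · exact Or.inl (Finset.mem_filter.2 ⟨Finset.mem_univ _, hp⟩)
    · have hlt := lexRank_lt A p
      simp only [borderRanks, Finset.mem_insert, Finset.mem_union, List.mem_toFinset,
        Finset.mem_image, not_or, not_exists, not_and] at hp
      obtain ⟨g, hg, h1, h2⟩ := exists_mem_gapPairs (m := n) (a := 0) (l := sortedRanks A qs)
        (j := lexRank A p) (by omega) (by omega) fun r hr =>
          ⟨fun h => hp.2.2.1 (h ▸ hr), fun h => hp.2.2.2 r hr (by omega)⟩
      exact Or.inr ⟨I g, List.mem_map_of_mem hg, mem_rankInterval.2 ⟨h1, h2⟩⟩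
  have hcell : ∀ c ∈ (fsState A qs).cells, runEntropy n (runsMeeting (runIndex A) c.elts).card
      ≤ (P.map fun g => runEntropy n (runsMeeting (runIndex A) (c.elts ∩ I g)).card).sum
        + ((c.elts ∩ T0).card : ℝ) * Real.logb 2 n := by
    intro c _
    have := runEntropy_le_sum (runIndex A) (T := c.elts) (T0 := T0) fun p _ => hcov p
    rwa [List.map_map] at this
  have h1 := List.sum_le_sum hcell
  rw [List.sum_map_add, List.sum_map_mul_right, sum_map_sum_comm] at h1
  have h2 : ((fsState A qs).cells.map fun c => ((c.elts ∩ T0).card : ℝ)).sum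
      ≤ 2 * qs.length + 2 := by
    have h3 := (hinv.sum_card_inter_le T0).trans
      ((card_filter_lexRank_le A _).trans (card_borderRanks_le A qs))
    rw [← cast_sum_map]
    exact_mod_cast h3
  have h3 : ∀ g ∈ P, ((fsState A qs).cells.map fun c => runEntropy n
      (runsMeeting (runIndex A) (c.elts ∩ I g)).card).sum
      ≤ ((g.2 - g.1 : ℕ) : ℝ) * (Real.logb 2 n + 1920) - xlogx (g.2 - g.1) := by
    intro g hg
    have hcard : (rankInterval (lexRank A) (g.1 + 1) (g.2 - 1)).card ≤ g.2 - g.1 := by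
      have hsub : rankInterval (lexRank A) (g.1 + 1) (g.2 - 1)
          ⊆ Finset.univ.filter fun p => lexRank A p ∈ Finset.Ico g.1 g.2 := fun p hp => by
        rw [mem_rankInterval] at hp
        simp only [Finset.mem_filter, Finset.mem_univ, true_and, Finset.mem_Ico]
        omega
      simpa using (Finset.card_le_card hsub).trans (card_filter_lexRank_le A _)
    have := sum_runEntropy_gap_le A qs hcard (sub_le_of_mem_gapPairs hpw hle hg) fun q hq => by
      have := avoids_of_mem_gapPairs hpw hg (mem_sortedRanks.2 ⟨q, hq, rfl⟩)
      unfold Avoids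
      omega
    rw [mul_add]
    linarith
  have h4 := List.sum_le_sum h3
  have h5 : (P.map fun g => ((g.2 - g.1 : ℕ) : ℝ) * (Real.logb 2 n + 1920)
      - xlogx (g.2 - g.1)).sum = n * (Real.logb 2 n + 1920)
        - ((queryGaps A qs).map xlogx).sum := by
    have h6 : (P.map fun g => ((g.2 - g.1 : ℕ) : ℝ)).sum = n := by
      have h7 := sum_gapPairs hpw hle
      rw [Nat.sub_zero] at h7
      rw [← cast_sum_map]
      exact_mod_cast h7
    rw [queryGaps_eq, List.map_map, ← h6, ← List.sum_map_mul_right]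
    have : ∀ (l : List (ℕ × ℕ)) (f g : ℕ × ℕ → ℝ), (l.map fun x => f x - g x).sum
        = (l.map f).sum - (l.map g).sum := by
      intro l f g
      induction l with
      | nil => simp
      | cons x l ih =>
        simp only [List.map_cons, List.sum_cons, ih]
        ring
    exact this _ _ _
  have hlogn : 0 ≤ Real.logb 2 n := logb_two_natCast_nonneg n
  have h6 := mul_le_mul_of_nonneg_right h2 hlogn
  have h7 : xlogx n = n * Real.logb 2 n := rfl
  rw [h5] at h4
  linarith

theorem cellLog_le_card (runOf : Fin n → ℕ) (T : Finset (Fin n)) : cellLog runOf T ≤ T.card := by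
  rw [← sum_card_runPart runOf T, cellLog]
  push_cast
  refine Finset.sum_le_sum fun r hr => ?_
  have hpos := runPart_card_pos hr
  rw [Real.logb_le_iff_le_rpow (by norm_num) (by exact_mod_cast hpos), Real.rpow_natCast]
  exact_mod_cast Nat.lt_two_pow_self.le

theorem lg_mono {d m : ℕ} (h : d ≤ m) : lg d ≤ lg m := by
  rcases Nat.eq_zero_or_pos d with rfl | hd
  · simp [lg]
  · exact max_le_max le_rfl
      (Real.logb_le_logb_of_le (by norm_num) (by exact_mod_cast hd) (by exact_mod_cast h))

theorem lg_one_le (m : ℕ) : lg 1 ≤ lg m := by simp [lg]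

theorem CellsInv.length_le {A : Fin n → α} {cells : List (Cell n)} (h : CellsInv A cells) :
    cells.length ≤ n := by
  have h1 := h.sum_card
  have h2 : (cells.map fun _ => 1).sum ≤ (cells.map fun c => c.elts.card).sum :=
    List.sum_le_sum fun c hc => Finset.card_pos.2 (h.nonempty c hc)
  rw [h1] at h2
  simpa using h2

theorem sum_map_lg_le {l : List ℕ} {m k : ℕ} (hl : ∀ d ∈ l, lg d ≤ lg m) (hk : l.length ≤ k) :
    (l.map lg).sum ≤ k * lg m := by
  have h1 : (l.map lg).sum ≤ (l.map fun _ => lg m).sum := List.sum_le_sum hl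
  rw [List.map_const', List.sum_replicate, nsmul_eq_mul] at h1
  exact h1.trans (mul_le_mul_of_nonneg_right (by exact_mod_cast hk) (lg_nonneg m))

theorem lg_searchedSize_le (A : Fin n → α) (s : FSState n) (x : α) :
    lg (searchedSize A s x) ≤ lg n := by
  unfold searchedSize
  split
  · exact lg_one_le n
  · exact lg_mono ((Finset.card_le_univ _).trans (by simp))

theorem lg_searchedSizes_le (A : Fin n → α) (s : FSState n) (qs : List (Query n α)) :
    (searchedSizes A s qs).length ≤ qs.length ∧ ∀ g ∈ searchedSizes A s qs, lg g ≤ lg n := by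
  induction qs generalizing s with
  | nil => simp [searchedSizes]
  | cons q qs ih =>
    rcases q with i | x
    · obtain ⟨h1, h2⟩ := ih (fsServe A s (.select i))
      exact ⟨h1.trans (Nat.le_succ _), h2⟩
    · obtain ⟨h1, h2⟩ := ih (fsServe A s (.rank x))
      refine ⟨Nat.succ_le_succ h1, fun g hg => ?_⟩
      rcases List.mem_cons.1 hg with rfl | hg
      · exact lg_searchedSize_le A _ x
      · exact h2 g hg

theorem lg_fingerDistances_le {A : Fin n → α} (qs : List (Query n α)) {s : FSState n}
    (hrun : RunsSorted A s.runOf) (hinv : CellsInv A s.cells) :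
    (fingerDistances A s qs).length = qs.length ∧ ∀ d ∈ fingerDistances A s qs, lg d ≤ lg n := by
  induction qs generalizing s with
  | nil => simp [fingerDistances]
  | cons q qs ih =>
    obtain ⟨h1, h2⟩ := ih (s := fsServe A s q) hrun (hinv.iterate hrun q n)
    refine ⟨congrArg Nat.succ h1, fun d hd => ?_⟩
    rcases List.mem_cons.1 hd with rfl | hd
    · exact lg_mono (List.countP_le_length.trans hinv.length_le)
    · exact h2 d hd

/-- The part `n log n - ∑ Δ log Δ` of the gap bound is thus nonnegative, so constants may be
multiplied onto the whole bound. -/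
theorem sum_xlogx_queryGaps_le (A : Fin n → α) (qs : List (Query n α)) :
    ((queryGaps A qs).map xlogx).sum ≤ xlogx n := by
  have hpw := pairwise_zero_sortedRanks A qs
  have hle := le_of_mem_zero_sortedRanks A qs
  rw [queryGaps_eq, List.map_map]
  have h1 : ((gapPairs n 0 (sortedRanks A qs)).map (xlogx ∘ fun g => g.2 - g.1)).sum
      ≤ ((gapPairs n 0 (sortedRanks A qs)).map
        fun g => ((g.2 - g.1 : ℕ) : ℝ) * Real.logb 2 n).sum :=
    List.sum_le_sum fun g hg => xlogx_le (sub_le_of_mem_gapPairs hpw hle hg)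
  have h2 := sum_gapPairs hpw hle
  rw [Nat.sub_zero] at h2
  rw [List.sum_map_mul_right, ← cast_sum_map, h2] at h1
  exact h1

/-- `1924 = 1 + 1 + 1920 + 2`: the term `n`, the logarithms of the block sizes, the entropy inside
the gaps, and `2 log n ≤ 2 n` for the border ranks that belong to no query. Each logarithm charged
to a query is at most `lg n`, and `ρ ≤ n`. -/
theorem synergisticBound_le_gapBound (A : Fin n → α) (qs : List (Query n α)) :
    synergisticBound A qs ≤ 1924 * gapBound A qs := by
  obtain ⟨hr, hinv⟩ := fsState_invariant A qs
  have hρ : numRuns A ≤ n := Finset.card_image_le.trans (by simp)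
  have h1 := sum_runEntropy_fsState_le A qs
  obtain ⟨f1, f2⟩ := lg_fingerDistances_le qs (runsSorted_runIndex A) (cellsInv_initial A)
  obtain ⟨g1, g2⟩ := lg_searchedSizes_le A (fsInitial A) qs
  have h2 := sum_map_lg_le (fun d hd => f2 d (List.mem_of_mem_tail hd))
    (show (fingerDistances A (fsInitial A) qs).tail.length ≤ qs.length by
      rw [List.length_tail, f1]; omega)
  have h3 := sum_map_lg_le g2 g1
  have hstate : stateBound (numRuns A) (fsState A qs) ≤ n + ((fsState A qs).cells.map fun c =>
      runEntropy n (runsMeeting (runIndex A) c.elts).card).sum := by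
    have h4 : ((fsState A qs).cells.map fun c => (c.elts.card : ℝ)).sum = n := by
      rw [← cast_sum_map]
      exact_mod_cast hinv.sum_card
    rw [stateBound_eq, hr, ← h4, ← List.sum_map_add]
    refine List.sum_le_sum fun c _ => add_le_add (cellLog_le_card _ _) ?_
    have hk := card_runsMeeting_le (runIndex A) (ρ := numRuns A) le_rfl c.elts
    unfold runEntropy
    rcases Nat.eq_zero_or_pos (runsMeeting (runIndex A) c.elts).card with h0 | h0
    · rw [h0]
      simp
    · refine sub_le_sub_right (mul_le_mul_of_nonneg_left ?_ (Nat.cast_nonneg _)) _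
      exact Real.logb_le_logb_of_le (by norm_num) (by exact_mod_cast h0.trans_le hk)
        (by exact_mod_cast hρ)
  have h7 : synergisticBound A qs = n + stateBound (numRuns A) (fsState A qs)
      + ((fingerDistances A (fsInitial A) qs).tail.map lg).sum
      + ((searchedSizes A (fsInitial A) qs).map lg).sum := by
    unfold synergisticBound stateBound
    ring
  have h8 := sum_xlogx_queryGaps_le A qs
  have h9 : Real.logb 2 n ≤ lg n := le_max_right _ _
  have h10 : Real.logb 2 n ≤ n := by
    rcases Nat.eq_zero_or_pos n with h0 | h0
    · simp [h0]
    · rw [Real.logb_le_iff_le_rpow (by norm_num) (by exact_mod_cast h0), Real.rpow_natCast]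
      exact_mod_cast Nat.lt_two_pow_self.le
  have hq : (0 : ℝ) ≤ qs.length := Nat.cast_nonneg _
  have hn : (0 : ℝ) ≤ n := Nat.cast_nonneg _
  have h11 := mul_le_mul_of_nonneg_left h9 hq
  have h12 := mul_nonneg hq (lg_nonneg n)
  unfold gapBound
  rw [h7]
  linarith

end GapSum

/-- One data structure (a family of comparison programs that depends only on `n`) realizes the
Full-Synergistic Deferred Data Structure on all multisets and all online query sequences, answers
correctly, and obeys the bounds with an absolute constant. -/
theorem mainTheorem1 :
    ∃ (C : ℝ) (D : ∀ n : ℕ, DeferredDS n),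
      ∀ (n : ℕ) (α : Type*) [LinearOrder α] (A : Fin n → α) (qs : List (Query n α)),
        List.Forall₂ (CorrectAnswer A) qs ((D n).answers A qs) ∧
        (D n).finalState A qs = fsState A qs ∧
        ((D n).comparisons A qs : ℝ) ≤ C * synergisticBound A qs ∧
        synergisticBound A qs ≤ C * gapBound A qs := by
  choose D hD using exists_deferredDS
  -- The larger of the constants `2403` and `1924` of the two bounds.
  refine ⟨2403, D, fun n α _ A qs => ?_⟩
  obtain ⟨h1, h2, h3⟩ := hD n α A
  obtain ⟨t1, t2, t3⟩ := h3.total h1 h2 qs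
  refine ⟨t1, t2, t3, (synergisticBound_le_gapBound A qs).trans ?_⟩
  refine mul_le_mul_of_nonneg_right (by norm_num) ?_
  have h8 := sum_xlogx_queryGaps_le A qs
  have h12 := mul_nonneg (Nat.cast_nonneg (α := ℝ) qs.length) (lg_nonneg n)
  have hn : (0 : ℝ) ≤ n := Nat.cast_nonneg _
  unfold gapBound
  linarith
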